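/- All manifolds are smooth, Hausdorff, second countable and without boundary; all maps and forms are smooth. **Definitions.** Let $B$ be an $n$-manifold. A fibration $\pi\colon M\to B$ is a locally trivial one, with some non-empty manifold $F$ as fibre. A *lattice* $P$ of rank $k$ on $B$ is a family of subgroups $P_x\subset T^*_xB$ such that every point of $B$ has a neighbourhood $U$ with $1$-forms $\alpha_1,\dots,\alpha_k$ on $U$ that are linearly independent at each $x\in U$ and satisfy $P_x=\mathbb Z\alpha_1(x)+\dots+\mathbb Z\alpha_k(x)$. The lattice is *closed* if every $1$-form $\alpha$ on an open set $U\subset B$ with $\alpha(x)\in P_x$ for all $x\in U$ is closed. The quotient $T^*B/P$ is a fibration over $B$ whose fibres are the abelian groups $T^*_xB/P_x$. An *affine fibration with underlying fibration* $T^*B/P$ is a fibration $\pi\colon E\to B$ together with a smooth fibrewise action of $T^*B/P$ in which each group $T^*_xB/P_x$ acts freely and transitively on the fibre $\pi^{-1}(x)$. Two affine fibrations over $B$ are *equivalent* if they have the same underlying fibration $T^*B/P$ and there is a fibrewise diffeomorphism of their total spaces, identical on the base, which preserves the action. An *almost Lagrangian fibration* $\pi\colon(M^{2n},\eta)\to B^n$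 is a fibration with connected fibres together with a non-degenerate $2$-form $\eta$ on $M$ (not necessarily closed) such that $\eta$ vanishes on each fibre, $d\eta=\pi^*\psi$ for some $3$-form $\psi$ on $B$, and for all $x\in B$ and $\alpha\in T^*_xB$ the shifting $v_\alpha$ is complete; here $v_\alpha$ is the vector field on the fibre $\pi^{-1}(x)$ given by $\eta(v_\alpha,\cdot)=\pi^*\alpha$. Let $s_\alpha\colon\pi^{-1}(x)\to\pi^{-1}(x)$ be the time-one flow of $v_\alpha$. Two almost Lagrangian fibrations $\pi_i\colon(M_i^{2n},\eta_i)\to B^n$, $i=1,2$, are *Lagrangian equivalent up to a twisting* if there are a $2$-form $\varphi$ on $B$ and a diffeomorphism $f\colon M_1\to M_2$ with $\pi_2\circ f=\pi_1$ and $f^*\eta_2=\eta_1+\pi_1^*\varphi$. **Theorem.** 1) For any almost Lagrangian fibration $\pi\colon(M^{2n},\eta)\to B^n$ there is a closed lattice $P$ on $B$ such that $\pi$ is an affine fibration with underlying fibration $T^*B/P$, the class $[\alpha]\in T^*_xB/P_x$ of a covector $\alpha$ acting on $\pi^{-1}(x)$ by $s_\alpha$. 2) Let $P$ be a closed lattice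 on $B$. Any affine fibration $\pi\colon E\to B$ with underlying fibration $T^*B/P$ is realized by an almost Lagrangian fibration: there is a $2$-form $\eta$ on $E$ such that $\pi\colon(E,\eta)\to B$ is an almost Lagrangian fibration and $s_\alpha z=[\alpha]\circ z$ for all $x\in B$, $\alpha\in T^*_xB$ and $z\in\pi^{-1}(x)$. 3) Two almost Lagrangian fibrations over $B$ are Lagrangian equivalent up to a twisting if and only if the affine fibrations corresponding to them by 1) are equivalent. -/

import Mathlib

open scoped Manifold ContDiff


noncomputable section

namespace LagFib

/-! ### Differential forms on manifolds -/

section Forms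

variable {m : ℕ} {M : Type*} [TopologicalSpace M] [ChartedSpace (EuclideanSpace ℝ (Fin m)) M]

/-- A (not necessarily smooth) differential `k`-form on an `m`-manifold `M`: an alternating
`k`-linear form on each tangent space. -/
abbrev Form (m : ℕ) (M : Type*) [TopologicalSpace M] [ChartedSpace (EuclideanSpace ℝ (Fin m)) M]
    (k : ℕ) : Type _ :=
  ∀ x : M, (TangentSpace (𝓡 m) x) [⋀^Fin k]→L[ℝ] ℝ

/-- The coordinate expression of a `k`-form in the chart around `x₀`, that is its pullback under
the inverse of that chart (meaningful on the target of the chart, which is open). -/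
def Form.inChart {k : ℕ} (θ : Form m M k) (x₀ : M) (y : EuclideanSpace ℝ (Fin m)) :
    (EuclideanSpace ℝ (Fin m)) [⋀^Fin k]→L[ℝ] ℝ :=
  (θ ((extChartAt (𝓡 m) x₀).symm y)).compContinuousLinearMap
    (mfderiv 𝓘(ℝ, EuclideanSpace ℝ (Fin m)) (𝓡 m) (extChartAt (𝓡 m) x₀).symm y)

/-- A `k`-form is smooth if its coordinate expressions are smooth. -/
def Form.IsSmooth {k : ℕ} (θ : Form m M k) : Prop :=
  ∀ x₀ : M, ContDiffOn ℝ ∞ (θ.inChart x₀) (extChartAt (𝓡 m) x₀).target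

/-- The exterior derivative of a `k`-form, computed at `x` in the chart around `x`. -/
def Form.d {k : ℕ} (θ : Form m M k) : Form m M (k + 1) := fun x =>
  (extDeriv (θ.inChart x) (extChartAt (𝓡 m) x x)).compContinuousLinearMap
    (mfderiv (𝓡 m) 𝓘(ℝ, EuclideanSpace ℝ (Fin m)) (extChartAt (𝓡 m) x) x)

/-- The pullback of a `k`-form under a map. -/
def Form.pullback {m' : ℕ} {M' : Type*} [TopologicalSpace M']
    [ChartedSpace (EuclideanSpace ℝ (Fin m')) M'] {k : ℕ} (f : M → M') (θ : Form m' M' k) :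
    Form m M k := fun z =>
  (θ (f z)).compContinuousLinearMap (mfderiv (𝓡 m) (𝓡 m') f z)

end Forms

/-! ### The cotangent bundle, 1-forms, lattices -/

section Cotangent

variable (n : ℕ) {B : Type*} [TopologicalSpace B] [ChartedSpace (EuclideanSpace ℝ (Fin n)) B]

/-- The cotangent space `T*ₓB`. -/
abbrev CotangentSpace (x : B) : Type _ := TangentSpace (𝓡 n) x →L[ℝ] ℝ

/-- The total space of the cotangent bundle `T*B` (with the smooth structure of the bundle of
continuous linear maps from the tangent bundle to the trivial line bundle). -/
abbrev CotangentBundle (B : Type*) [TopologicalSpace B]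
    [ChartedSpace (EuclideanSpace ℝ (Fin n)) B] : Type _ :=
  Bundle.TotalSpace (EuclideanSpace ℝ (Fin n) →L[ℝ] ℝ) (fun x : B => CotangentSpace n x)

variable {n}

/-- The covector field `α` is a smooth 1-form (section of `T*B`) over the set `U`. -/
def IsSmoothCovectorFieldOn [IsManifold (𝓡 n) ∞ B] (α : ∀ x : B, CotangentSpace n x)
    (U : Set B) : Prop :=
  ContMDiffOn (𝓡 n) ((𝓡 n).prod 𝓘(ℝ, EuclideanSpace ℝ (Fin n) →L[ℝ] ℝ)) ∞
    (fun x => (⟨x, α x⟩ : CotangentBundle n B)) U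

/-- A covector field viewed as a differential form of degree one. -/
def toForm (α : ∀ x : B, CotangentSpace n x) : Form n B 1 := fun x =>
  ContinuousAlternatingMap.ofSubsingleton ℝ (TangentSpace (𝓡 n) x) ℝ (0 : Fin 1) (α x)

/-- `P` is a lattice of rank `k` in `T*B`: a family of subgroups `Pₓ ⊆ T*ₓB`, each of which is
a lattice `ℤᵏ` generated by `k` linearly independent covectors, varying smoothly with `x`. -/
def IsLattice [IsManifold (𝓡 n) ∞ B] (k : ℕ) (P : ∀ x : B, AddSubgroup (CotangentSpace n x)) :
    Prop :=
  ∀ x₀ : B, ∃ U : Set B, IsOpen U ∧ x₀ ∈ U ∧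
    ∃ α : Fin k → ∀ x : B, CotangentSpace n x,
      (∀ i, IsSmoothCovectorFieldOn (α i) U) ∧
      ∀ x ∈ U, LinearIndependent ℝ (fun i => α i x) ∧
        P x = AddSubgroup.closure (Set.range fun i => α i x)

/-- A lattice of rank `k` is closed if every local section of it is a closed 1-form. -/
structure IsClosedLattice [IsManifold (𝓡 n) ∞ B] (k : ℕ)
    (P : ∀ x : B, AddSubgroup (CotangentSpace n x)) : Prop where
  isLattice : IsLattice k P
  closed : ∀ (U : Set B), IsOpen U → ∀ α : ∀ x : B, CotangentSpace n x,
    IsSmoothCovectorFieldOn α U → (∀ x ∈ U, α x ∈ P x) → ∀ x ∈ U, (toForm α).d x = 0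

end Cotangent

/-! ### Fibrations -/

section Fibrations

universe uM uB

variable {n : ℕ} {B : Type uB} [TopologicalSpace B] [ChartedSpace (EuclideanSpace ℝ (Fin n)) B]
  {M : Type uM} [TopologicalSpace M] [ChartedSpace (EuclideanSpace ℝ (Fin (2 * n))) M]

/-- `pr : M²ⁿ → Bⁿ` is a (smooth) locally trivial fibration with some non-empty `n`-dimensional
manifold `F` as its fibre. -/
def IsSmoothFibration (pr : M → B) : Prop :=
  ContMDiff (𝓡 (2 * n)) (𝓡 n) ∞ pr ∧
  ∃ (F : Type uM) (_ : TopologicalSpace F) (_ : ChartedSpace (EuclideanSpace ℝ (Fin n)) F),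
    IsManifold (𝓡 n) ∞ F ∧ Nonempty F ∧
    ∀ x : B, ∃ e : Bundle.Trivialization F pr, x ∈ e.baseSet ∧
      ContMDiffOn (𝓡 (2 * n)) ((𝓡 n).prod (𝓡 n)) ∞ e e.source ∧
      ContMDiffOn ((𝓡 n).prod (𝓡 n)) (𝓡 (2 * n)) ∞ e.toOpenPartialHomeomorph.symm e.target

/-- A maximal isotropic fibration: a locally trivial fibration with connected fibres, whose total
space carries a smooth non-degenerate 2-form `η` that vanishes on the fibres. -/
structure IsMaximalIsotropicFibration (pr : M → B) (η : Form (2 * n) M 2) : Prop where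
  fibration : IsSmoothFibration (n := n) pr
  connected : ∀ x : B, IsConnected (pr ⁻¹' {x})
  smooth : η.IsSmooth
  nondegenerate : ∀ (z : M) (v : TangentSpace (𝓡 (2 * n)) z),
    (∀ w : TangentSpace (𝓡 (2 * n)) z, η z ![v, w] = 0) → v = 0
  isotropic : ∀ (z : M) (v w : TangentSpace (𝓡 (2 * n)) z),
    mfderiv (𝓡 (2 * n)) (𝓡 n) pr z v = 0 → mfderiv (𝓡 (2 * n)) (𝓡 n) pr z w = 0 →
      η z ![v, w] = 0

/-- The pullback `pr*α` of a covector `α ∈ T*ₓB` at a point `z` of the fibre over `x`. -/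
def pullbackCovector (pr : M → B) {x : B} (α : CotangentSpace n x) (z : M) (h : pr z = x) :
    TangentSpace (𝓡 (2 * n)) z →L[ℝ] ℝ :=
  (h.symm ▸ α : CotangentSpace n (pr z)).comp (mfderiv (𝓡 (2 * n)) (𝓡 n) pr z)

/-- `v` is the value at `z` of the shifting `v_α` of the covector `α ∈ T*ₓB`, where `z` lies over
`x`: the vector dual to `pr*α` with respect to `η`, that is `η(v, w) = (pr*α)(w)` for all `w`
(it exists and is unique if `η` is non-degenerate). -/
def IsShifting (pr : M → B) (η : Form (2 * n) M 2) {x : B} (α : CotangentSpace n x) (z : M)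
    (h : pr z = x) (v : TangentSpace (𝓡 (2 * n)) z) : Prop :=
  ∀ w : TangentSpace (𝓡 (2 * n)) z, η z ![v, w] = pullbackCovector pr α z h w

/-- `γ : ℝ → M` is a complete trajectory of the vector field `v_α` on the fibre over `x`. -/
def IsShiftingTrajectory (pr : M → B) (η : Form (2 * n) M 2) {x : B} (α : CotangentSpace n x)
    (γ : ℝ → M) : Prop :=
  ∀ t : ℝ, ∃ (h : pr (γ t) = x) (v : TangentSpace (𝓡 (2 * n)) (γ t)),
    IsShifting pr η α (γ t) h v ∧
    HasMFDerivAt 𝓘(ℝ, ℝ) (𝓡 (2 * n)) γ t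
      ((1 : ℝ →L[ℝ] ℝ).smulRight v)

/-- All shiftings are complete: through every point of the fibre over `x` there passes a trajectory
of `v_α` that is defined for all times. -/
def ShiftingsComplete (pr : M → B) (η : Form (2 * n) M 2) : Prop :=
  ∀ (x : B) (α : CotangentSpace n x) (z : M), pr z = x →
    ∃ γ : ℝ → M, γ 0 = z ∧ IsShiftingTrajectory pr η α γ

/-- `s_α z = z'`: the time-one flow of the shifting `v_α` takes `z` to `z'`. -/
def IsTimeOneShift (pr : M → B) (η : Form (2 * n) M 2) {x : B} (α : CotangentSpace n x)
    (z z' : M) : Prop :=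
  ∃ γ : ℝ → M, IsShiftingTrajectory pr η α γ ∧ γ 0 = z ∧ γ 1 = z'

/-- An almost Lagrangian fibration: a maximal isotropic fibration with complete shiftings such that
`dη = pr*ψ` for some 3-form `ψ` on the base. -/
structure IsAlmostLagrangianFibration (pr : M → B) (η : Form (2 * n) M 2) : Prop
    extends IsMaximalIsotropicFibration pr η where
  complete : ShiftingsComplete pr η
  basic : ∃ ψ : Form n B 3, ψ.IsSmooth ∧ η.d = Form.pullback pr ψ

/-! ### Affine fibrations with underlying fibration `T*B/P` -/

open Classical in
/-- Given actions of the groups `T*ₓB / Pₓ` on the fibres of `pr`, the induced map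
`(a, z) ↦ [a] ∘ z`, defined for covectors `a` and points `z` over the same point of the base
(and extended by `z` to the other pairs). -/
def fibrewiseAct (pr : M → B) (P : ∀ x : B, AddSubgroup (CotangentSpace n x))
    (action : ∀ x : B, AddAction (CotangentSpace n x ⧸ P x) (pr ⁻¹' {x}))
    (a : CotangentBundle n B) (z : M) : M :=
  if h : pr z = a.proj then
    (((action a.proj).vadd (QuotientAddGroup.mk a.2) ⟨z, h⟩ : pr ⁻¹' {a.proj}) : M)
  else z

/-- The structure of an affine fibration with underlying fibration `T*B/P` on `pr : M → B`: `pr` is a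
locally trivial fibration and each group `T*ₓB / Pₓ` acts regularly (freely and transitively) on
the fibre `pr⁻¹(x)`. The action depends smoothly on all its arguments; as `T*B → T*B/P` is a
surjective local diffeomorphism, this says that the map `(a, z) ↦ [a] ∘ z` is smooth on the fibre
product of `T*B` and `M` over `B`. -/
structure AffineFibration [IsManifold (𝓡 n) ∞ B] (pr : M → B)
    (P : ∀ x : B, AddSubgroup (CotangentSpace n x)) where
  fibration : IsSmoothFibration (n := n) pr
  action : ∀ x : B, AddAction (CotangentSpace n x ⧸ P x) (pr ⁻¹' {x})
  regular : ∀ (x : B) (z z' : pr ⁻¹' {x}), ∃! w : CotangentSpace n x ⧸ P x,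
    (action x).vadd w z = z'
  smooth : ContMDiffOn
    (((𝓡 n).prod 𝓘(ℝ, EuclideanSpace ℝ (Fin n) →L[ℝ] ℝ)).prod (𝓡 (2 * n))) (𝓡 (2 * n)) ∞
    (fun p : CotangentBundle n B × M => fibrewiseAct pr P action p.1 p.2)
    {p | pr p.2 = p.1.proj}

/-- The affine fibration `A` is the one corresponding to the 2-form `η`: its action is given by
`α ↦ s_α`. -/
def AffineFibration.IsInducedBy [IsManifold (𝓡 n) ∞ B] {pr : M → B}
    {P : ∀ x : B, AddSubgroup (CotangentSpace n x)} (A : AffineFibration pr P)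
    (η : Form (2 * n) M 2) : Prop :=
  ∀ (x : B) (α : CotangentSpace n x) (z : pr ⁻¹' {x}),
    IsTimeOneShift pr η α (z : M)
      ((A.action x).vadd (QuotientAddGroup.mk α) z : pr ⁻¹' {x})

end Fibrations

/-! ### Equivalences -/

section Equivalences

variable {n : ℕ} {B : Type*} [TopologicalSpace B] [ChartedSpace (EuclideanSpace ℝ (Fin n)) B]
  {M₁ : Type*} [TopologicalSpace M₁] [ChartedSpace (EuclideanSpace ℝ (Fin (2 * n))) M₁]
  {M₂ : Type*} [TopologicalSpace M₂] [ChartedSpace (EuclideanSpace ℝ (Fin (2 * n))) M₂]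

/-- Two fibrations over `B` with 2-forms on the total spaces are Lagrangian equivalent: there is
a fibrewise diffeomorphism, identical on the base, which respects the 2-forms. -/
def LagrangianEquivalent (pr₁ : M₁ → B) (η₁ : Form (2 * n) M₁ 2) (pr₂ : M₂ → B)
    (η₂ : Form (2 * n) M₂ 2) : Prop :=
  ∃ f : M₁ ≃ₘ^∞⟮𝓡 (2 * n), 𝓡 (2 * n)⟯ M₂,
    (∀ z, pr₂ (f z) = pr₁ z) ∧ Form.pullback f η₂ = η₁

/-- Lagrangian equivalent up to a twisting: after adding to `η₁` the pullback of a 2-form `φ` on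
the base the two fibrations become Lagrangian equivalent. -/
def LagrangianEquivalentUpToTwisting (pr₁ : M₁ → B) (η₁ : Form (2 * n) M₁ 2) (pr₂ : M₂ → B)
    (η₂ : Form (2 * n) M₂ 2) : Prop :=
  ∃ φ : Form n B 2, φ.IsSmooth ∧
    LagrangianEquivalent pr₁ (η₁ + Form.pullback pr₁ φ) pr₂ η₂

/-- Two affine fibrations are equivalent: they have the same underlying fibration `T*B/P`, and there
is a fibrewise diffeomorphism of the total spaces, identical on the base, which preserves the
action. -/
def AffineFibration.Equivalent [IsManifold (𝓡 n) ∞ B] {pr₁ : M₁ → B} {pr₂ : M₂ → B}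
    {P₁ P₂ : ∀ x : B, AddSubgroup (CotangentSpace n x)}
    (A₁ : AffineFibration pr₁ P₁) (A₂ : AffineFibration pr₂ P₂) : Prop :=
  P₁ = P₂ ∧
  ∃ f : M₁ ≃ₘ^∞⟮𝓡 (2 * n), 𝓡 (2 * n)⟯ M₂,
    (∀ z, pr₂ (f z) = pr₁ z) ∧
    ∀ (a : CotangentBundle n B) (z : M₁), pr₁ z = a.proj →
      f (fibrewiseAct pr₁ P₁ A₁.action a z) = fibrewiseAct pr₂ P₂ A₂.action a (f z)

end Equivalences

end LagFib

end

/-!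
An almost Lagrangian fibration is studied in coordinates that linearize the shiftings. In any
chart `(y, u)` in which the projection is `y`, the form `η` pairs the vectors tangent to the
fibres with those of the base by an invertible matrix. Because `η` vanishes on the fibres and `dη`
comes from the base, the rows of this matrix are closed forms on the fibres, so they have
primitives which depend smoothly on all variables, by the Poincaré lemma with parameters
(`exists_primitive_with_parameter`). These primitives, in place of `u`, turn the shiftings into
constant vector fields (`IsAlmostLagrangianFibration.exists_adaptedChart`). Hence the shifts
commute and are additive in the covector near every point, and therefore globally
(`flow_add_of_locally_add`, `timeShift_add`). Their orbits on a fibre are open, so a connected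
fibre is one orbit (`timeShift_transitive`), and the shift depends smoothly on covector and point
(`contMDiffAt_chartShift`). As the acting group is abelian, a covector fixing one point of a fibre
fixes all of them. So the quotient of the cotangent space by the group of periods acts freely and
transitively: this is `inducedAffineFibration`.

The rest of the argument concerns an affine fibration and the parametrizations
`(y, ξ) ↦ [ξ] ∘ σ (y)` of its total space, for local sections `σ` (`AffineFibration.orbitMap`).
They are local diffeomorphisms if the groups `P x` contain no line (`exists_orbitChart`). This
makes `P x` discrete and each fibre a quotient of the cotangent space by `P x`, so
`ξ ↦ [ξ] ∘ σ (x)` is a covering. Identifying nearby fibres by a local trivialization and lifting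
the identification through these coverings carries a basis of one period group to the neighbouring
ones, smoothly; so the periods form a lattice (`AffineFibration.exists_isLattice`).

A 2-form `η` with horizontal `dη` whose shiftings generate the action has the normal form
`dξ ∧ dy + β` in the coordinates `(y, ξ)`, where `β` is a form on the base
(`AffineFibration.pull_orbitMap_eq`). The three parts of the theorem follow from it.

* Moving `σ` by a local section `α` of the periods does not change it, but changes the restriction
  of `η` to it by `dα`; hence `dα = 0` (`AffineFibration.isClosed_section`).
* Conversely, if the lattice is closed, then `dξ ∧ dy` is invariant under translations by sections
  of the lattice, so it descends to the total space over small open sets of the base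
  (`AffineFibration.exists_isGeneratedBy`). A partition of unity on the base glues these forms to
  a form that still has the normal form, with another `β`, and is therefore the form of an almost
  Lagrangian fibration (`AffineFibration.exists_isAlmostLagrangianFibration`).
* An equivalence of affine fibrations respects the coordinates `(y, ξ)`, so the difference of the
  2-forms is a difference of forms `β` in every chart, that is a form on the base
  (`AffineFibration.exists_eq_pullback`). In the other direction, a diffeomorphism respecting the
  2-forms up to a form on the base maps trajectories of shiftings to trajectories of shiftings
  (`IsShiftingTrajectory.comp_diffeomorph`).
-/

open scoped Manifold ContDiff

noncomputable section

namespace LagFib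

open Set Filter Function Metric
open scoped Topology

/-! ### Calculus of differential forms -/

section Calculus

variable {U V W : Type*} [NormedAddCommGroup U] [NormedSpace ℝ U]
  [NormedAddCommGroup V] [NormedSpace ℝ V] [NormedAddCommGroup W] [NormedSpace ℝ W]

/-- An alternating form on a finite-dimensional space depends smoothly on parameters if its values
on fixed vectors do. -/
theorem contDiffAt_alternating_of_apply [FiniteDimensional ℝ V] {k : ℕ}
    {f : U → V [⋀^Fin k]→L[ℝ] ℝ} {x : U} {r : WithTop ℕ∞}
    (h : ∀ v : Fin k → V, ContDiffAt ℝ r (fun y => f y v) x) : ContDiffAt ℝ r f x := by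
  classical
  let b := Module.finBasis ℝ V
  let L : (V [⋀^Fin k]→L[ℝ] ℝ) →ₗ[ℝ] ((Fin k → Fin (Module.finrank ℝ V)) → ℝ) :=
    { toFun := fun g s => g (fun i => b (s i))
      map_add' := fun _ _ => rfl
      map_smul' := fun _ _ => rfl }
  have hL : LinearMap.ker L = ⊥ := by
    rw [LinearMap.ker_eq_bot]
    intro g g' hg
    have : g.toMultilinearMap = g'.toMultilinearMap :=
      Module.Basis.ext_multilinear (fun _ => b) (fun s => congrFun hg s)
    ext v
    exact congrArg (fun m => m v) this
  obtain ⟨R, hR⟩ := L.exists_leftInverse_of_injective hL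
  have hf : f = fun y => R.toContinuousLinearMap (L (f y)) := by
    funext y
    exact (LinearMap.congr_fun hR (f y)).symm
  rw [hf]
  refine (ContinuousLinearMap.contDiff _).contDiffAt.comp x ?_
  exact contDiffAt_pi.2 fun s => h _

theorem contDiffAt_alternating_apply {k : ℕ}
    {f : U → V [⋀^Fin k]→L[ℝ] ℝ} {g : Fin k → U → V} {x : U} {r : WithTop ℕ∞}
    (hf : ContDiffAt ℝ r f x) (hg : ∀ i, ContDiffAt ℝ r (g i) x) :
    ContDiffAt ℝ r (fun y => f y (fun i => g i y)) x := by
  let C := ContinuousMultilinearMap.compContinuousLinearMapContinuousMultilinear ℝ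
    (fun _ : Fin k => ℝ) (fun _ : Fin k => V) ℝ
  have h1 : ContDiffAt ℝ r
      (fun y => C (fun i => ContinuousLinearMap.toSpanSingleton ℝ (g i y))) x := by
    refine (ContinuousMultilinearMap.contDiff (𝕜 := ℝ) (E := fun _ : Fin k => (ℝ →L[ℝ] V))
      (F := (V [×k]→L[ℝ] ℝ) →L[ℝ] (ℝ [×k]→L[ℝ] ℝ)) C).contDiffAt.comp x (contDiffAt_pi.2 fun i => ?_)
    exact (ContinuousLinearMap.contDiff
      (ContinuousLinearMap.toSpanSingletonCLE (𝕜 := ℝ) (E := V)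
        : V →L[ℝ] (ℝ →L[ℝ] V))).contDiffAt.comp x (hg i)
  have h2 : ContDiffAt ℝ r
      (fun y => ContinuousAlternatingMap.toContinuousMultilinearMapCLM ℝ (f y)) x :=
    (ContinuousLinearMap.contDiff _).contDiffAt.comp x hf
  have h3 := (ContinuousLinearMap.contDiff (ContinuousMultilinearMap.apply ℝ
    (fun _ : Fin k => ℝ) ℝ (fun _ => (1 : ℝ)))).contDiffAt.comp x (h1.clm_apply h2)
  refine h3.congr_of_eventuallyEq (Eventually.of_forall fun y => ?_)
  simp [C]

theorem contDiffAt_compContinuousLinearMap [FiniteDimensional ℝ V] {k : ℕ}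
    {f : U → W [⋀^Fin k]→L[ℝ] ℝ} {g : U → V →L[ℝ] W} {x : U} {r : WithTop ℕ∞}
    (hf : ContDiffAt ℝ r f x) (hg : ContDiffAt ℝ r g x) :
    ContDiffAt ℝ r (fun y => (f y).compContinuousLinearMap (g y)) x :=
  contDiffAt_alternating_of_apply fun v =>
    contDiffAt_alternating_apply (g := fun j y => g y (v j)) hf
      fun _ => hg.clm_apply contDiffAt_const

theorem extDeriv_two_apply {Ω : V → V [⋀^Fin 2]→L[ℝ] ℝ} {p : V}
    (h : DifferentiableAt ℝ Ω p) (a b c : V) :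
    extDeriv Ω p ![a, b, c] = fderiv ℝ (fun q => Ω q ![b, c]) p a
      - fderiv ℝ (fun q => Ω q ![a, c]) p b + fderiv ℝ (fun q => Ω q ![a, b]) p c := by
  rw [extDeriv_apply h, Fin.sum_univ_three]
  have e0 : Fin.removeNth (0 : Fin 3) ![a, b, c] = ![b, c] := by
    ext i; fin_cases i <;> rfl
  have e1 : Fin.removeNth (1 : Fin 3) ![a, b, c] = ![a, c] := by
    ext i; fin_cases i <;> rfl
  have e2 : Fin.removeNth (2 : Fin 3) ![a, b, c] = ![a, b] := by
    ext i; fin_cases i <;> rfl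
  rw [e0, e1, e2]
  simp
  ring

theorem extDeriv_one_apply {Ω : V → V [⋀^Fin 1]→L[ℝ] ℝ} {p : V}
    (h : DifferentiableAt ℝ Ω p) (a b : V) :
    extDeriv Ω p ![a, b] = fderiv ℝ (fun q => Ω q ![b]) p a
      - fderiv ℝ (fun q => Ω q ![a]) p b := by
  rw [extDeriv_apply h, Fin.sum_univ_two]
  have e0 : Fin.removeNth (0 : Fin 2) ![a, b] = ![b] := by
    ext i; fin_cases i; rfl
  have e1 : Fin.removeNth (1 : Fin 2) ![a, b] = ![a] := by
    ext i; fin_cases i; rfl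
  rw [e0, e1]
  simp
  ring

/-- The inverse function theorem for smooth maps, with smoothness of the local inverse on a whole
open set. -/
theorem exists_smooth_localInverse [FiniteDimensional ℝ V] [FiniteDimensional ℝ W] {f : V → W}
    {O : Set V} (hO : IsOpen O)
    (hf : ContDiffOn ℝ ∞ f O) {p : V} (hp : p ∈ O) (hinj : Injective (fderiv ℝ f p))
    (hdim : Module.finrank ℝ V = Module.finrank ℝ W) :
    ∃ e : OpenPartialHomeomorph V W, p ∈ e.source ∧ e.source ⊆ O ∧ (e : V → W) = f ∧
      ContDiffOn ℝ ∞ e.symm e.target := by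
  have hfp : ContDiffAt ℝ ∞ f p := hf.contDiffAt (hO.mem_nhds hp)
  let L : V ≃L[ℝ] W :=
    (LinearEquiv.ofInjectiveOfFinrankEq (fderiv ℝ f p : V →ₗ[ℝ] W) hinj hdim).toContinuousLinearEquiv
  have hL : (L : V →L[ℝ] W) = fderiv ℝ f p := by
    ext v; rfl
  have hd : HasFDerivAt f (L : V →L[ℝ] W) p := by
    rw [hL]
    exact (hfp.differentiableAt (by simp)).hasFDerivAt
  let e0 := hfp.toOpenPartialHomeomorph f hd (by simp)
  have he0 : (e0 : V → W) = f := hfp.toOpenPartialHomeomorph_coe hd (by simp)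
  have hp0 : p ∈ e0.source := hfp.mem_toOpenPartialHomeomorph_source hd (by simp)
  have hcont : ContinuousOn (fderiv ℝ f) O :=
    (hf.continuousOn_fderiv_of_isOpen hO (by simp))
  let G : Set V := O ∩ fderiv ℝ f ⁻¹' (range ((↑) : (V ≃L[ℝ] W) → V →L[ℝ] W))
  have hG : IsOpen G := hcont.isOpen_inter_preimage hO (ContinuousLinearEquiv.isOpen)
  have hpG : p ∈ G := ⟨hp, L, hL⟩
  refine ⟨e0.restrOpen G hG, ⟨hp0, hpG⟩, fun q hq => hq.2.1, he0, fun w hw => ?_⟩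
  have hw' : w ∈ e0.target := by
    have := hw.1
    simpa using this
  have hq : e0.symm w ∈ G := by
    have := (e0.restrOpen G hG).map_target hw
    exact this.2
  obtain ⟨hqO, M, hM⟩ := hq
  have hfq : ContDiffAt ℝ ∞ f (e0.symm w) := hf.contDiffAt (hO.mem_nhds hqO)
  refine (e0.contDiffAt_symm hw' (f₀' := M) ?_ ?_).contDiffWithinAt
  · rw [he0, hM]
    exact (hfq.differentiableAt (by simp)).hasFDerivAt
  · rw [he0]; exact hfq

end Calculus

section Forms

variable {V W : Type*} [NormedAddCommGroup V] [NormedSpace ℝ V]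
  [NormedAddCommGroup W] [NormedSpace ℝ W]
  {m : ℕ} {M : Type*} [TopologicalSpace M] [ChartedSpace (EuclideanSpace ℝ (Fin m)) M]
  {k : ℕ}

/-- The pullback of a `k`-form on a manifold under a map defined on a normed space. -/
def Form.pull (g : V → M) (θ : Form m M k) (p : V) : V [⋀^Fin k]→L[ℝ] ℝ :=
  (θ (g p)).compContinuousLinearMap (mfderiv 𝓘(ℝ, V) (𝓡 m) g p)

theorem Form.pull_apply (g : V → M) (θ : Form m M k) (p : V) (v : Fin k → V) :
    θ.pull g p v = θ (g p) (fun i => mfderiv 𝓘(ℝ, V) (𝓡 m) g p (v i)) := rfl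

theorem Form.inChart_eq_pull (θ : Form m M k) (x : M) :
    θ.inChart x = θ.pull (extChartAt (𝓡 m) x).symm := rfl

/-- A `k`-form is smooth at `x` if its coordinate expression in the chart around `x` is. -/
def Form.SmoothAt (θ : Form m M k) (x : M) : Prop :=
  ContDiffAt ℝ ∞ (θ.inChart x) (extChartAt (𝓡 m) x x)

theorem Form.pull_congr {g g' : V → M} (θ : Form m M k) {p : V} (h : g =ᶠ[𝓝 p] g') :
    θ.pull g =ᶠ[𝓝 p] θ.pull g' := by
  filter_upwards [h.eventuallyEq_nhds] with q hq
  ext v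
  rw [Form.pull_apply, Form.pull_apply, hq.mfderiv_eq, hq.eq_of_nhds]

theorem Form.pull_comp (θ : Form m M k) {g : V → M} {h : W → V} {q : W}
    (hg : MDifferentiableAt 𝓘(ℝ, V) (𝓡 m) g (h q)) (hh : DifferentiableAt ℝ h q) :
    θ.pull (g ∘ h) q = (θ.pull g (h q)).compContinuousLinearMap (fderiv ℝ h q) := by
  ext v
  rw [Form.pull_apply, mfderiv_comp q hg hh.mdifferentiableAt, mfderiv_eq_fderiv]
  rfl

variable [IsManifold (𝓡 m) ∞ M]

theorem mdifferentiableAt_extChartAt_symm {x : M} {y : EuclideanSpace ℝ (Fin m)}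
    (hy : y ∈ (extChartAt (𝓡 m) x).target) :
    MDifferentiableAt 𝓘(ℝ, EuclideanSpace ℝ (Fin m)) (𝓡 m) (extChartAt (𝓡 m) x).symm y :=
  (((contMDiffOn_extChartAt_symm (n := ∞) x).contMDiffAt
    ((isOpen_extChartAt_target x).mem_nhds hy))).mdifferentiableAt (by simp)

theorem contMDiffAt_extChartAt_symm_of_mem {x : M} {y : EuclideanSpace ℝ (Fin m)}
    (hy : y ∈ (extChartAt (𝓡 m) x).target) :
    ContMDiffAt 𝓘(ℝ, EuclideanSpace ℝ (Fin m)) (𝓡 m) ∞ (extChartAt (𝓡 m) x).symm y :=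
  ((contMDiffOn_extChartAt_symm (n := ∞) x).contMDiffAt
    ((isOpen_extChartAt_target x).mem_nhds hy))

/-- A map into a manifold is, near a point, the composition of an inverse chart with a map between
vector spaces. -/
theorem pull_eventuallyEq {g : V → M} {p : V} (θ : Form m M k)
    (hg : ContMDiffAt 𝓘(ℝ, V) (𝓡 m) ∞ g p) :
    ContDiffAt ℝ ∞ (extChartAt (𝓡 m) (g p) ∘ g) p ∧
    θ.pull g =ᶠ[𝓝 p] fun q =>
      (θ.inChart (g p) ((extChartAt (𝓡 m) (g p) ∘ g) q)).compContinuousLinearMap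
        (fderiv ℝ (extChartAt (𝓡 m) (g p) ∘ g) q) := by
  have h1 : ContDiffAt ℝ ∞ (extChartAt (𝓡 m) (g p) ∘ g) p :=
    ((contMDiffAt_extChartAt (n := ∞)).comp p hg).contDiffAt
  refine ⟨h1, ?_⟩
  have hs : ∀ᶠ q in 𝓝 p, g q ∈ (extChartAt (𝓡 m) (g p)).source :=
    hg.continuousAt.preimage_mem_nhds (extChartAt_source_mem_nhds (g p))
  have h2 : g =ᶠ[𝓝 p] (extChartAt (𝓡 m) (g p)).symm ∘ (extChartAt (𝓡 m) (g p) ∘ g) := by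
    filter_upwards [hs] with q hq
    exact ((extChartAt (𝓡 m) (g p)).left_inv hq).symm
  refine (Form.pull_congr θ h2).trans ?_
  filter_upwards [hs, (h1.of_le (m := 1) (by simp)).eventually (by simp)] with q hq hd
  exact Form.pull_comp θ
    (mdifferentiableAt_extChartAt_symm ((extChartAt (𝓡 m) (g p)).map_source hq))
    (hd.differentiableAt (by simp))

theorem Form.SmoothAt.pull [FiniteDimensional ℝ V] {θ : Form m M k} {g : V → M} {p : V}
    (hθ : θ.SmoothAt (g p)) (hg : ContMDiffAt 𝓘(ℝ, V) (𝓡 m) ∞ g p) :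
    ContDiffAt ℝ ∞ (θ.pull g) p := by
  obtain ⟨h1, h2⟩ := pull_eventuallyEq θ hg
  refine ContDiffAt.congr_of_eventuallyEq ?_ h2
  exact contDiffAt_compContinuousLinearMap (ContDiffAt.comp (g := θ.inChart (g p)) p hθ h1)
    (h1.fderiv_right (by simp))

/-- The exterior derivative commutes with pullbacks. As `Form.d` at a point is computed in the chart
around that point, this contains its independence of the chart. -/
theorem extDeriv_pull {θ : Form m M k} {g : V → M} {p : V}
    (hθ : θ.SmoothAt (g p)) (hg : ContMDiffAt 𝓘(ℝ, V) (𝓡 m) ∞ g p) :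
    extDeriv (θ.pull g) p = θ.d.pull g p := by
  obtain ⟨h1, h2⟩ := pull_eventuallyEq θ hg
  rw [h2.extDeriv_eq]
  rw [extDeriv_pullback (f := extChartAt (𝓡 m) (g p) ∘ g) (r := ∞)
    (ContDiffAt.differentiableAt (n := ∞) hθ (by simp)) h1
    (by simpa using (WithTop.coe_le_coe.2 le_top : ((2 : ℕ∞) : WithTop ℕ∞) ≤ ∞))]
  ext v
  rw [Form.pull_apply]
  refine congrArg (extDeriv (θ.inChart (g p)) (extChartAt (𝓡 m) (g p) (g p)))
    (funext fun i => ?_)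
  have := mfderiv_comp p ((contMDiffAt_extChartAt (n := ∞) (I := 𝓡 m) (x := g p)).mdifferentiableAt
    (by simp)) (hg.mdifferentiableAt (by simp))
  exact (DFunLike.congr_fun (mfderiv_eq_fderiv.symm.trans this) (v i) :)

/-- Smoothness in the whole domain of every chart follows from smoothness at the centre of every
chart. -/
theorem Form.isSmooth_iff {θ : Form m M k} : θ.IsSmooth ↔ ∀ x, θ.SmoothAt x := by
  constructor
  · intro h x
    exact (h x).contDiffAt (extChartAt_target_mem_nhds x)
  · intro h x y hy
    exact ((h _).pull (contMDiffAt_extChartAt_symm_of_mem hy)).contDiffWithinAt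

/-- Smoothness of a form can be checked on a smooth local parametrization. -/
theorem Form.smoothAt_of_pull [FiniteDimensional ℝ V] {θ : Form m M k} {g : V → M} {h : M → V}
    {x : M} (hh : ContMDiffAt (𝓡 m) 𝓘(ℝ, V) ∞ h x)
    (hg : ContMDiffAt 𝓘(ℝ, V) (𝓡 m) ∞ g (h x)) (hgh : ∀ᶠ z in 𝓝 x, g (h z) = z)
    (hθ : ContDiffAt ℝ ∞ (θ.pull g) (h x)) : θ.SmoothAt x := by
  have hx : (extChartAt (𝓡 m) x).symm (extChartAt (𝓡 m) x x) = x := extChartAt_to_inv x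
  have hc : ContMDiffAt 𝓘(ℝ, EuclideanSpace ℝ (Fin m)) (𝓡 m) ∞ (extChartAt (𝓡 m) x).symm
      (extChartAt (𝓡 m) x x) :=
    contMDiffAt_extChartAt_symm_of_mem (mem_extChartAt_target x)
  let j := h ∘ (extChartAt (𝓡 m) x).symm
  have hjx : j (extChartAt (𝓡 m) x x) = h x := by simp only [j, comp_apply, hx]
  have hj : ContDiffAt ℝ ∞ j (extChartAt (𝓡 m) x x) :=
    (ContMDiffAt.comp (extChartAt (𝓡 m) x x) (by rw [hx]; exact hh) hc).contDiffAt
  have h2 : (extChartAt (𝓡 m) x).symm =ᶠ[𝓝 (extChartAt (𝓡 m) x x)] g ∘ j := by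
    have : ∀ᶠ y in 𝓝 (extChartAt (𝓡 m) x x), g (h ((extChartAt (𝓡 m) x).symm y)) =
        (extChartAt (𝓡 m) x).symm y := by
      have hct := hc.continuousAt
      rw [ContinuousAt, hx] at hct
      exact hct.eventually hgh
    filter_upwards [this] with y hy
    exact hy.symm
  have h3 := Form.pull_congr θ h2
  rw [Form.SmoothAt, Form.inChart_eq_pull]
  refine ContDiffAt.congr_of_eventuallyEq ?_ h3
  have h4 : ∀ᶠ y in 𝓝 (extChartAt (𝓡 m) x x),
      θ.pull (g ∘ j) y = (θ.pull g (j y)).compContinuousLinearMap (fderiv ℝ j y) := by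
    have e1 : ∀ᶠ p in 𝓝 (h x), ContMDiffAt 𝓘(ℝ, V) (𝓡 m) 1 g p :=
      (contMDiffAt_iff_contMDiffAt_nhds (by simp)).1 (hg.of_le (m := 1) (by simp))
    have e2 : Tendsto j (𝓝 (extChartAt (𝓡 m) x x)) (𝓝 (h x)) := by
      have := hj.continuousAt
      rwa [ContinuousAt, hjx] at this
    filter_upwards [e2.eventually e1, (hj.of_le (m := 1) (by simp)).eventually (by simp)]
      with y hy1 hy2
    exact Form.pull_comp θ (hy1.mdifferentiableAt (by simp)) (hy2.differentiableAt (by simp))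
  refine ContDiffAt.congr_of_eventuallyEq ?_ h4
  refine contDiffAt_compContinuousLinearMap (ContDiffAt.comp (g := θ.pull g) _ ?_ hj)
    (hj.fderiv_right (by simp))
  rw [hjx]; exact hθ

end Forms

/-! ### Cotangent coordinates and local sections of a fibration -/

section CotangentCoordinates

variable {n : ℕ} {B : Type*} [TopologicalSpace B] [ChartedSpace (EuclideanSpace ℝ (Fin n)) B]

/-- The covector at `x` with components `ξ` in the chart around `x₀`. -/
def cov (x₀ x : B) : (EuclideanSpace ℝ (Fin n) →L[ℝ] ℝ) →ₗ[ℝ] CotangentSpace n x where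
  toFun ξ := ξ.comp (mfderiv (𝓡 n) 𝓘(ℝ, EuclideanSpace ℝ (Fin n)) (extChartAt (𝓡 n) x₀) x)
  map_add' ξ ζ := ContinuousLinearMap.add_comp ξ ζ _
  map_smul' c ξ := ContinuousLinearMap.smul_comp c ξ _

/-- The components of a covector at `x` in the chart around `x₀`. -/
def components (x₀ x : B) : CotangentSpace n x →ₗ[ℝ] (EuclideanSpace ℝ (Fin n) →L[ℝ] ℝ) where
  toFun α := ContinuousLinearMap.comp (M₁ := EuclideanSpace ℝ (Fin n)) α
    (mfderiv 𝓘(ℝ, EuclideanSpace ℝ (Fin n)) (𝓡 n) (extChartAt (𝓡 n) x₀).symm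
      (extChartAt (𝓡 n) x₀ x))
  map_add' ξ ζ := ContinuousLinearMap.add_comp ξ ζ _
  map_smul' c ξ := ContinuousLinearMap.smul_comp c ξ _

theorem components_apply (x₀ x : B) (α : CotangentSpace n x) (v : EuclideanSpace ℝ (Fin n)) :
    components x₀ x α v = α (mfderiv 𝓘(ℝ, EuclideanSpace ℝ (Fin n)) (𝓡 n)
      (extChartAt (𝓡 n) x₀).symm (extChartAt (𝓡 n) x₀ x) v) := rfl

variable [IsManifold (𝓡 n) ∞ B]

theorem mfderiv_extChartAt_symm_apply {x₀ x : B}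
    (hx : x ∈ (chartAt (EuclideanSpace ℝ (Fin n)) x₀).source)
    (v : EuclideanSpace ℝ (Fin n)) :
    mfderiv (𝓡 n) 𝓘(ℝ, EuclideanSpace ℝ (Fin n)) (extChartAt (𝓡 n) x₀) x
      (mfderiv 𝓘(ℝ, EuclideanSpace ℝ (Fin n)) (𝓡 n) (extChartAt (𝓡 n) x₀).symm
        (extChartAt (𝓡 n) x₀ x) v) = v := by
  have : IsManifold (𝓡 n) 1 B := IsManifold.of_le (n := ∞) (by simp)
  have hx' : x ∈ (extChartAt (𝓡 n) x₀).source := by rwa [extChartAt_source]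
  have := mfderiv_extChartAt_comp_mfderivWithin_extChartAt_symm' (I := 𝓡 n) hx'
  rw [ModelWithCorners.range_eq_univ, mfderivWithin_univ] at this
  exact DFunLike.congr_fun this v

theorem mfderiv_symm_extChartAt_apply {x₀ x : B}
    (hx : x ∈ (chartAt (EuclideanSpace ℝ (Fin n)) x₀).source)
    (v : TangentSpace (𝓡 n) x) :
    (mfderiv 𝓘(ℝ, EuclideanSpace ℝ (Fin n)) (𝓡 n) (extChartAt (𝓡 n) x₀).symm
        (extChartAt (𝓡 n) x₀ x)
        (mfderiv (𝓡 n) 𝓘(ℝ, EuclideanSpace ℝ (Fin n)) (extChartAt (𝓡 n) x₀) x v) :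
      EuclideanSpace ℝ (Fin n)) = v := by
  have : IsManifold (𝓡 n) 1 B := IsManifold.of_le (n := ∞) (by simp)
  have hx' : x ∈ (extChartAt (𝓡 n) x₀).source := by rwa [extChartAt_source]
  have := mfderivWithin_extChartAt_symm_comp_mfderiv_extChartAt' (I := 𝓡 n) hx'
  rw [ModelWithCorners.range_eq_univ, mfderivWithin_univ] at this
  exact DFunLike.congr_fun this v

theorem components_cov {x₀ x : B} (hx : x ∈ (chartAt (EuclideanSpace ℝ (Fin n)) x₀).source)
    (ξ : EuclideanSpace ℝ (Fin n) →L[ℝ] ℝ) : components x₀ x (cov x₀ x ξ) = ξ := by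
  ext1 v
  exact congrArg ξ (mfderiv_extChartAt_symm_apply hx v)

theorem cov_components {x₀ x : B} (hx : x ∈ (chartAt (EuclideanSpace ℝ (Fin n)) x₀).source)
    (α : CotangentSpace n x) : cov x₀ x (components x₀ x α) = α := by
  refine ContinuousLinearMap.ext fun v => ?_
  exact congrArg α (mfderiv_symm_extChartAt_apply hx v)

/-- A map to the cotangent bundle is smooth if its base point and the components of the covector in
a fixed chart are smooth. -/
theorem contMDiffWithinAt_cotangentBundle_iff {EN HN N : Type*} [NormedAddCommGroup EN]
    [NormedSpace ℝ EN] [TopologicalSpace HN] {I : ModelWithCorners ℝ EN HN} [TopologicalSpace N]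
    [ChartedSpace HN N] {f : N → CotangentBundle n B} {s : Set N} {y : N} {x₀ : B}
    (hy : (f y).proj ∈ (chartAt (EuclideanSpace ℝ (Fin n)) x₀).source) :
    ContMDiffWithinAt I ((𝓡 n).prod 𝓘(ℝ, EuclideanSpace ℝ (Fin n) →L[ℝ] ℝ)) ∞ f s y ↔
      ContMDiffWithinAt I (𝓡 n) ∞ (fun q => (f q).proj) s y ∧
      ContMDiffWithinAt I 𝓘(ℝ, EuclideanSpace ℝ (Fin n) →L[ℝ] ℝ) ∞
        (fun q => components x₀ (f q).proj (f q).2) s y := by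
  have : IsManifold (𝓡 n) 1 B := IsManifold.of_le (n := ∞) (by simp)
  let e := trivializationAt (EuclideanSpace ℝ (Fin n) →L[ℝ] ℝ)
    (fun x : B => CotangentSpace n x) x₀
  have hye : f y ∈ e.source := by
    rw [e.mem_source, hom_trivializationAt_baseSet]
    exact ⟨by simpa using hy, by simp⟩
  rw [e.contMDiffWithinAt_iff hye]
  refine and_congr_right fun h => ?_
  have key : ∀ q, (f q).proj ∈ (chartAt (EuclideanSpace ℝ (Fin n)) x₀).source →
      (e (f q)).2 = components x₀ (f q).proj (f q).2 := by
    intro q hq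
    rw [hom_trivializationAt_apply]
    ext1 v
    rw [ContinuousLinearMap.inCoordinates_eq (by simpa using hq) (by simp)]
    have hs := TangentBundle.symmL_trivializationAt (𝕜 := ℝ) (I := 𝓡 n) (x₀ := x₀)
      (x := (f q).proj) hq
    rw [ModelWithCorners.range_eq_univ, mfderivWithin_univ] at hs
    rw [components_apply, ← hs]
    simp
    exact congrArg (f q).2 (Bundle.Trivialization.symmL_apply _ (by simpa using hq) v).symm
  have hev : ∀ᶠ q in 𝓝[s] y, (e (f q)).2 = components x₀ (f q).proj (f q).2 := by
    have : ∀ᶠ q in 𝓝[s] y, (f q).proj ∈ (chartAt (EuclideanSpace ℝ (Fin n)) x₀).source :=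
      h.continuousWithinAt.preimage_mem_nhdsWithin
        ((chartAt (EuclideanSpace ℝ (Fin n)) x₀).open_source.mem_nhds hy)
    filter_upwards [this] with q hq using key q hq
  exact ⟨fun h1 => h1.congr_of_eventuallyEq (hev.mono fun _ hq => hq.symm) (key y hy).symm,
    fun h1 => h1.congr_of_eventuallyEq hev (key y hy)⟩

end CotangentCoordinates

section Fibration

universe uM uB
variable {n : ℕ} {B : Type uB} [TopologicalSpace B] [ChartedSpace (EuclideanSpace ℝ (Fin n)) B]
  {M : Type uM} [TopologicalSpace M] [ChartedSpace (EuclideanSpace ℝ (Fin (2 * n))) M]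
  {pr : M → B}

theorem isShifting_cov_iff {η : Form (2 * n) M 2} {x₀ x : B}
    {ξ : EuclideanSpace ℝ (Fin n) →L[ℝ] ℝ} {z : M}
    {h : pr z = x} {v : TangentSpace (𝓡 (2 * n)) z} :
    IsShifting pr η (cov x₀ x ξ) z h v ↔ ∀ w : TangentSpace (𝓡 (2 * n)) z, η z ![v, w] =
      ξ (mfderiv (𝓡 n) 𝓘(ℝ, EuclideanSpace ℝ (Fin n)) (extChartAt (𝓡 n) x₀) (pr z)
        (mfderiv (𝓡 (2 * n)) (𝓡 n) pr z w)) := by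
  subst h
  exact Iff.rfl

/-- Local sections of a fibration through a given point. -/
theorem IsSmoothFibration.exists_section (hf : IsSmoothFibration (n := n) pr) (z : M) :
    ∃ (U : Set B) (σ : B → M), IsOpen U ∧ pr z ∈ U ∧ ContMDiffOn (𝓡 n) (𝓡 (2 * n)) ∞ σ U ∧
      (∀ x ∈ U, pr (σ x) = x) ∧ σ (pr z) = z := by
  obtain ⟨-, F, _, _, hF, -, he⟩ := hf
  obtain ⟨e, hx, he1, he2⟩ := he (pr z)
  have hz : z ∈ e.source := e.mem_source.2 hx
  refine ⟨e.baseSet, fun x => e.toOpenPartialHomeomorph.symm (x, (e z).2), e.open_baseSet, hx,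
    ?_, ?_, ?_⟩
  · refine he2.comp (contMDiffOn_id.prodMk contMDiffOn_const) fun x hxx => ?_
    exact e.mem_target.2 hxx
  · intro x hxx
    exact e.proj_symm_apply (e.mem_target.2 hxx)
  · have h1 : (pr z, (e z).2) = e z := by rw [← e.coe_fst hz]
    show e.toOpenPartialHomeomorph.symm (pr z, (e z).2) = z
    rw [h1]
    exact e.toOpenPartialHomeomorph.left_inv hz

theorem IsSmoothFibration.mfderiv_surjective (hf : IsSmoothFibration (n := n) pr) (z : M) :
    Surjective (mfderiv (𝓡 (2 * n)) (𝓡 n) pr z) := by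
  obtain ⟨U, σ, hU, hz, hσ, hpr, hσz⟩ := hf.exists_section z
  intro v
  have h1 : MDifferentiableAt (𝓡 n) (𝓡 (2 * n)) σ (pr z) :=
    (hσ.contMDiffAt (hU.mem_nhds hz)).mdifferentiableAt (by simp)
  have h2 : MDifferentiableAt (𝓡 (2 * n)) (𝓡 n) pr (σ (pr z)) :=
    hf.1.contMDiffAt.mdifferentiableAt (by simp)
  have h3 := mfderiv_comp (pr z) h2 h1
  have h4 : pr ∘ σ =ᶠ[𝓝 (pr z)] id := by
    filter_upwards [hU.mem_nhds hz] with x hx using hpr x hx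
  rw [h4.mfderiv_eq, mfderiv_id, hσz] at h3
  exact ⟨mfderiv (𝓡 n) (𝓡 (2 * n)) σ (pr z) v, (DFunLike.congr_fun h3 v).symm⟩

variable [IsManifold (𝓡 n) ∞ B]

/-- Smooth coordinates on the total space in which the projection is the first component. -/
theorem IsSmoothFibration.exists_chart (hf : IsSmoothFibration (n := n) pr) {x₀ : B} {z₀ : M}
    (hz₀ : pr z₀ ∈ (chartAt (EuclideanSpace ℝ (Fin n)) x₀).source) :
    ∃ φ : OpenPartialHomeomorph M (EuclideanSpace ℝ (Fin n) × EuclideanSpace ℝ (Fin n)),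
      z₀ ∈ φ.source ∧
      (∀ z ∈ φ.source, pr z ∈ (chartAt (EuclideanSpace ℝ (Fin n)) x₀).source ∧
        (φ z).1 = extChartAt (𝓡 n) x₀ (pr z)) ∧
      ContMDiffOn (𝓡 (2 * n)) 𝓘(ℝ, EuclideanSpace ℝ (Fin n) × EuclideanSpace ℝ (Fin n)) ∞
        φ φ.source ∧
      ContMDiffOn 𝓘(ℝ, EuclideanSpace ℝ (Fin n) × EuclideanSpace ℝ (Fin n)) (𝓡 (2 * n)) ∞
        φ.symm φ.target := by
  obtain ⟨-, F, _, _, hF, -, he⟩ := hf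
  obtain ⟨e, hx, he1, he2⟩ := he (pr z₀)
  have hz : z₀ ∈ e.source := e.mem_source.2 hx
  let φ := e.toOpenPartialHomeomorph.trans ((chartAt (EuclideanSpace ℝ (Fin n)) x₀).prod
    (chartAt (EuclideanSpace ℝ (Fin n)) (e z₀).2))
  have hsrc : ∀ z, z ∈ φ.source ↔ z ∈ e.source ∧
      pr z ∈ (chartAt (EuclideanSpace ℝ (Fin n)) x₀).source ∧
      (e z).2 ∈ (chartAt (EuclideanSpace ℝ (Fin n)) (e z₀).2).source := by
    intro z
    simp only [φ, OpenPartialHomeomorph.trans_source, mem_inter_iff, mem_preimage,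
      OpenPartialHomeomorph.prod_source, mem_prod]
    refine and_congr_right fun h => ?_
    rw [← e.coe_fst h]; rfl
  have hsrc' : ∀ z ∈ φ.source, z ∈ e.source := fun z h => ((hsrc z).1 h).1
  refine ⟨φ, (hsrc z₀).2 ⟨hz, hz₀, mem_chart_source _ _⟩, fun z hzs => ?_, ?_, ?_⟩
  · refine ⟨((hsrc z).1 hzs).2.1, ?_⟩
    change extChartAt (𝓡 n) x₀ (e z).1 = _
    rw [e.coe_fst (hsrc' z hzs)]
  · have h1 : ContMDiffOn (𝓡 (2 * n)) ((𝓡 n).prod (𝓡 n)) ∞ e φ.source := he1.mono hsrc'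
    have h2 : ContMDiffOn (𝓡 (2 * n)) (𝓡 n) ∞ (fun z => (e z).1) φ.source :=
      contMDiff_fst.comp_contMDiffOn h1
    have h3 : ContMDiffOn (𝓡 (2 * n)) (𝓡 n) ∞ (fun z => (e z).2) φ.source :=
      contMDiff_snd.comp_contMDiffOn h1
    refine ContMDiffOn.prodMk_space
      (f := fun z => extChartAt (𝓡 n) x₀ (e z).1)
      (g := fun z => extChartAt (𝓡 n) (e z₀).2 (e z).2) ?_ ?_
    · refine (contMDiffOn_extChartAt (n := ∞)).comp h2 fun z hzs => ?_
      have := ((hsrc z).1 hzs).2.1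
      rwa [← e.coe_fst (hsrc' z hzs)] at this
    · exact (contMDiffOn_extChartAt (n := ∞)).comp h3 fun z hzs => ((hsrc z).1 hzs).2.2
  · have ht : ∀ p ∈ φ.target, p.1 ∈ (extChartAt (𝓡 n) x₀).target ∧
        p.2 ∈ (extChartAt (𝓡 n) (e z₀).2).target ∧
        ((extChartAt (𝓡 n) x₀).symm p.1, (extChartAt (𝓡 n) (e z₀).2).symm p.2) ∈ e.target := by
      intro p hp
      simp only [φ, OpenPartialHomeomorph.trans_target, mem_inter_iff, mem_preimage,
        OpenPartialHomeomorph.prod_target, mem_prod] at hp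
      refine ⟨by simpa using hp.1.1, by simpa using hp.1.2, hp.2⟩
    refine ContMDiffOn.comp (g := e.toOpenPartialHomeomorph.symm) (t := e.target)
      (f := fun p : EuclideanSpace ℝ (Fin n) × EuclideanSpace ℝ (Fin n) =>
        ((extChartAt (𝓡 n) x₀).symm p.1, (extChartAt (𝓡 n) (e z₀).2).symm p.2)) he2 ?_
      fun p hp => (ht p hp).2.2
    refine ContMDiffOn.prodMk ?_ ?_
    · exact (contMDiffOn_extChartAt_symm (n := ∞) x₀).comp contDiff_fst.contMDiff.contMDiffOn
        fun p hp => (ht p hp).1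
    · exact (contMDiffOn_extChartAt_symm (n := ∞) (e z₀).2).comp
        contDiff_snd.contMDiff.contMDiffOn fun p hp => (ht p hp).2.1

end Fibration

/-! ### The Poincaré lemma with parameters -/

section TwoForms

variable {V : Type*} [AddCommGroup V] [Module ℝ V] [TopologicalSpace V]

theorem two_swap (Ω : V [⋀^Fin 2]→L[ℝ] ℝ) (a b : V) : Ω ![b, a] = -Ω ![a, b] := by
  have h := Ω.toAlternatingMap.map_swap ![a, b] (i := 0) (j := 1) (by simp)
  have e : (![a, b] ∘ Equiv.swap (0 : Fin 2) 1) = ![b, a] := by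
    ext i; fin_cases i <;> simp
  rw [e] at h
  exact h

theorem two_add_left (Ω : V [⋀^Fin 2]→L[ℝ] ℝ) (a b c : V) :
    Ω ![a + b, c] = Ω ![a, c] + Ω ![b, c] :=
  Ω.toMultilinearMap.cons_add ![c] a b

theorem two_smul_left (Ω : V [⋀^Fin 2]→L[ℝ] ℝ) (r : ℝ) (a c : V) :
    Ω ![r • a, c] = r * Ω ![a, c] :=
  Ω.toMultilinearMap.cons_smul ![c] r a

theorem two_add_right (Ω : V [⋀^Fin 2]→L[ℝ] ℝ) (a b c : V) :
    Ω ![a, b + c] = Ω ![a, b] + Ω ![a, c] := by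
  rw [two_swap, two_add_left, two_swap Ω a b, two_swap Ω a c]; ring

theorem two_smul_right (Ω : V [⋀^Fin 2]→L[ℝ] ℝ) (r : ℝ) (a c : V) :
    Ω ![a, r • c] = r * Ω ![a, c] := by
  rw [two_swap, two_smul_left, two_swap Ω a c]; ring

/-- An alternating 2-form as a bilinear map. -/
def bilin (Ω : V [⋀^Fin 2]→L[ℝ] ℝ) : V →ₗ[ℝ] V →ₗ[ℝ] ℝ :=
  LinearMap.mk₂ ℝ (fun a b => Ω ![a, b]) (two_add_left Ω) (two_smul_left Ω)
    (two_add_right Ω) (two_smul_right Ω)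

theorem two_ext {Ω Ω' : V [⋀^Fin 2]→L[ℝ] ℝ} (h : ∀ a b, Ω ![a, b] = Ω' ![a, b]) : Ω = Ω' := by
  ext v
  have : v = ![v 0, v 1] := by ext i; fin_cases i <;> rfl
  rw [this]; exact h _ _

end TwoForms

section ParametricIntegral

theorem hasFDerivAt_parametric_integral {H G : Type*} [NormedAddCommGroup H] [NormedSpace ℝ H]
    [FiniteDimensional ℝ H] [NormedAddCommGroup G] [NormedSpace ℝ G] [CompleteSpace G]
    {F : H × ℝ → G} (hF : ContDiff ℝ 1 F) (x₀ : H) :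
    HasFDerivAt (fun x => ∫ t in (0 : ℝ)..1, F (x, t))
      (∫ t in (0 : ℝ)..1, (fderiv ℝ F (x₀, t)).comp (ContinuousLinearMap.inl ℝ H ℝ)) x₀ := by
  have := FiniteDimensional.proper_real H
  have hD : Continuous fun p : H × ℝ => (fderiv ℝ F p).comp (ContinuousLinearMap.inl ℝ H ℝ) :=
    (hF.continuous_fderiv (by simp)).clm_comp continuous_const
  obtain ⟨C, hC⟩ := ((isCompact_closedBall x₀ 1).prod (isCompact_Icc (a := (0 : ℝ)) (b := 1))
    ).exists_bound_of_continuousOn hD.continuousOn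
  refine (intervalIntegral.hasFDerivAt_integral_of_dominated_of_fderiv_le
    (F := fun x t => F (x, t))
    (F' := fun x t => (fderiv ℝ F (x, t)).comp (ContinuousLinearMap.inl ℝ H ℝ))
    (bound := fun _ => C) (closedBall_mem_nhds x₀ one_pos) ?_ ?_ ?_ ?_ ?_ ?_)
  · exact Eventually.of_forall fun x =>
      (hF.continuous.comp (by fun_prop : Continuous fun t : ℝ => (x, t))).aestronglyMeasurable
  · exact (hF.continuous.comp
      (by fun_prop : Continuous fun t : ℝ => (x₀, t))).intervalIntegrable _ _
  · exact (hD.comp (by fun_prop : Continuous fun t : ℝ => (x₀, t))).aestronglyMeasurable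
  · refine Eventually.of_forall fun t ht x hx => ?_
    rw [uIoc_of_le zero_le_one] at ht
    exact hC (x, t) ⟨hx, Ioc_subset_Icc_self ht⟩
  · exact intervalIntegrable_const
  · refine Eventually.of_forall fun t _ x _ => ?_
    have h1 := (hF.differentiable (by simp) (x, t)).hasFDerivAt
    exact h1.comp x (hasFDerivAt_prodMk_left x t)

/-- Differentiation under the integral sign, iterated. The target varies in the induction, since the
derivative takes its values in a space of linear maps. -/
theorem contDiff_parametric_integral_nat {H : Type} [NormedAddCommGroup H] [NormedSpace ℝ H]
    [FiniteDimensional ℝ H] (k : ℕ) : ∀ {G : Type} [NormedAddCommGroup G] [NormedSpace ℝ G]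
    [CompleteSpace G] {F : H × ℝ → G}, ContDiff ℝ k F →
      ContDiff ℝ k (fun x => ∫ t in (0 : ℝ)..1, F (x, t)) := by
  induction k with
  | zero =>
    intro G _ _ _ F hF
    rw [CharP.cast_eq_zero, contDiff_zero] at hF ⊢
    exact intervalIntegral.continuous_parametric_intervalIntegral_of_continuous' (by exact hF) 0 1
  | succ k ih =>
    intro G _ _ _ F hF
    have h1 : ContDiff ℝ 1 F := hF.of_le (by norm_cast; omega)
    have hd := fun x => hasFDerivAt_parametric_integral h1 x
    rw [Nat.cast_succ, contDiff_succ_iff_fderiv]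
    refine ⟨fun x => (hd x).differentiableAt, by simp, ?_⟩
    have : fderiv ℝ (fun x => ∫ t in (0 : ℝ)..1, F (x, t)) = fun x =>
        ∫ t in (0 : ℝ)..1, (fderiv ℝ F (x, t)).comp (ContinuousLinearMap.inl ℝ H ℝ) :=
      funext fun x => (hd x).fderiv
    rw [this]
    refine ih (F := fun p => (fderiv ℝ F p).comp (ContinuousLinearMap.inl ℝ H ℝ)) ?_
    exact (hF.fderiv_right (by norm_cast)).clm_comp contDiff_const

/-- Smooth dependence of an integral over the unit interval on parameters. -/
theorem contDiff_parametric_integral {H G : Type} [NormedAddCommGroup H] [NormedSpace ℝ H]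
    [FiniteDimensional ℝ H] [NormedAddCommGroup G] [NormedSpace ℝ G]
    [CompleteSpace G] {F : H × ℝ → G} (hF : ContDiff ℝ ∞ F) :
    ContDiff ℝ ∞ (fun x => ∫ t in (0 : ℝ)..1, F (x, t)) :=
  contDiff_infty.2 fun k => contDiff_parametric_integral_nat k (contDiff_infty.1 hF k)

/-- The Poincaré lemma for 1-forms depending smoothly on parameters: a family of closed 1-forms
`A (x, ·)` has a family of primitives that is smooth in all variables. -/
theorem exists_primitive_with_parameter {E G : Type} [NormedAddCommGroup E] [NormedSpace ℝ E]
    [FiniteDimensional ℝ E] [NormedAddCommGroup G] [NormedSpace ℝ G] [CompleteSpace G]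
    {A : E × E → E →L[ℝ] G} {T : Set (E × E)} (hT : IsOpen T) (hA : ContDiffOn ℝ ∞ A T)
    (hcl : ∀ p ∈ T, ∀ u v : E, fderiv ℝ A p (0, u) v = fderiv ℝ A p (0, v) u)
    {p₀ : E × E} (hp₀ : p₀ ∈ T) :
    ∃ r > 0, ball p₀ r ⊆ T ∧ ∃ g : E × E → G, ContDiff ℝ ∞ g ∧
      ∀ p ∈ ball p₀ r, ∀ v : E, fderiv ℝ g p (0, v) = A p v := by
  obtain ⟨R, hR, hRT⟩ := nhds_basis_closedBall.mem_iff.1 (hT.mem_nhds hp₀)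
  -- a cutoff makes the family globally defined without changing it near `p₀`
  let b : ContDiffBump p₀ := ⟨R / 2, R, half_pos hR, half_lt_self hR⟩
  let A' : E × E → E →L[ℝ] G := fun p => b p • A p
  have hA' : ContDiff ℝ ∞ A' := by
    rw [contDiff_iff_contDiffAt]
    intro p
    by_cases hp : p ∈ T
    · exact b.contDiff.contDiffAt.smul (hA.contDiffAt (hT.mem_nhds hp))
    · have : p ∉ tsupport b := by
        rw [b.tsupport_eq]; exact fun h => hp (hRT h)
      have h0 : A' =ᶠ[𝓝 p] fun _ => 0 := by
        filter_upwards [notMem_tsupport_iff_eventuallyEq.1 this] with q hq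
        simp [A', hq]
      exact contDiffAt_const.congr_of_eventuallyEq h0
  have hball : ∀ p ∈ ball p₀ (R / 2), A' =ᶠ[𝓝 p] A := by
    intro p hp
    filter_upwards [isOpen_ball.mem_nhds hp] with q hq
    simp [A', b.one_of_mem_closedBall (ball_subset_closedBall hq)]
  let g : E × E → G := fun p => ∫ t in (0 : ℝ)..1,
    A' (p.1, AffineMap.lineMap p₀.2 p.2 t) (p.2 - p₀.2)
  have hgs : ContDiff ℝ ∞ g := by
    refine contDiff_parametric_integral
      (F := fun q : (E × E) × ℝ => A' (q.1.1, AffineMap.lineMap p₀.2 q.1.2 q.2) (q.1.2 - p₀.2)) ?_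
    refine ContDiff.clm_apply (hA'.comp ?_) (by fun_prop)
    simp only [AffineMap.lineMap_apply_module]
    fun_prop
  refine ⟨R / 2, half_pos hR, fun p hp => hRT (closedBall_subset_closedBall
    (by linarith) (ball_subset_closedBall hp)), g, hgs, ?_⟩
  · intro p hp v
    have hp2 : p.1 ∈ ball p₀.1 (R / 2) ∧ p.2 ∈ ball p₀.2 (R / 2) := by
      have : p ∈ ball p₀.1 (R / 2) ×ˢ ball p₀.2 (R / 2) := by rw [ball_prod_same]; exact hp
      exact this
    have hline : ∀ y : E, HasFDerivAt (fun y' => A' (p.1, y'))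
        ((fderiv ℝ A' (p.1, y)).comp (ContinuousLinearMap.inr ℝ E E)) y := fun y =>
      ((hA'.differentiable (by simp) (p.1, y)).hasFDerivAt).comp y (hasFDerivAt_prodMk_right p.1 y)
    -- the Poincaré lemma in the second variable, for a fixed value of the parameter
    have h1 := (convex_ball p₀.2
      (R / 2)).hasFDerivWithinAt_curveIntegral_segment_of_hasFDerivWithinAt_symmetric
      (fun y _ => (hline y).hasFDerivWithinAt) ?_ (mem_ball_self (half_pos hR)) hp2.2
    · have h2 : HasFDerivAt (fun y => g (p.1, y)) (A' p) p.2 := by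
        have := h1.hasFDerivAt (isOpen_ball.mem_nhds hp2.2)
        refine this.congr_of_eventuallyEq (Eventually.of_forall fun y => ?_)
        simp only [curveIntegral_segment]
        rfl
      have h3 : HasFDerivAt (fun y => g (p.1, y))
          ((fderiv ℝ g p).comp (ContinuousLinearMap.inr ℝ E E)) p.2 :=
        HasFDerivAt.comp (g := g) (f := fun y => (p.1, y)) p.2
          (hgs.differentiable (by simp) p).hasFDerivAt (hasFDerivAt_prodMk_right p.1 p.2)
      have h4 := DFunLike.congr_fun (h3.unique h2) v
      rw [← (hball p hp).eq_of_nhds]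
      simpa using h4
    · intro y hy u _ w _
      have hyp : (p.1, y) ∈ ball p₀ (R / 2) := by
        have : (p.1, y) ∈ ball p₀.1 (R / 2) ×ˢ ball p₀.2 (R / 2) := ⟨hp2.1, hy⟩
        rwa [ball_prod_same] at this
      simp only [ContinuousLinearMap.comp_apply, ContinuousLinearMap.inr_apply,
        (hball _ hyp).fderiv_eq]
      exact hcl _ (hRT (closedBall_subset_closedBall
        (by linarith) (ball_subset_closedBall hyp))) u w

end ParametricIntegral

/-! ### Charts linearizing the shiftings -/

/-- The model space of the base. -/
abbrev Vec (n : ℕ) : Type := EuclideanSpace ℝ (Fin n)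

/-- The dual of the model space of the base. -/
abbrev Cov (n : ℕ) : Type := EuclideanSpace ℝ (Fin n) →L[ℝ] ℝ

theorem finrank_cov (n : ℕ) : Module.finrank ℝ (Cov n) = n := by
  rw [← (LinearMap.toContinuousLinearMap (𝕜 := ℝ) (E := Vec n) (F' := ℝ)).finrank_eq]
  simp

section LocalDiffeo

variable {V : Type*} [NormedAddCommGroup V] [NormedSpace ℝ V] {m : ℕ} {M : Type*}
  [TopologicalSpace M] [ChartedSpace (EuclideanSpace ℝ (Fin m)) M]
  {e : OpenPartialHomeomorph M V}

theorem mfderiv_apply_symm (h1 : ContMDiffOn (𝓡 m) 𝓘(ℝ, V) ∞ e e.source)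
    (h2 : ContMDiffOn 𝓘(ℝ, V) (𝓡 m) ∞ e.symm e.target) {p : V} (hp : p ∈ e.target) (v : V) :
    (mfderiv (𝓡 m) 𝓘(ℝ, V) e (e.symm p) (mfderiv 𝓘(ℝ, V) (𝓡 m) e.symm p v) : V) = v := by
  have d1 := (h1.contMDiffAt (e.open_source.mem_nhds (e.map_target hp))).mdifferentiableAt (by simp)
  have d2 := (h2.contMDiffAt (e.open_target.mem_nhds hp)).mdifferentiableAt (by simp)
  have h := mfderiv_comp p d1 d2
  have he : e ∘ e.symm =ᶠ[𝓝 p] id := by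
    filter_upwards [e.open_target.mem_nhds hp] with q hq using e.right_inv hq
  rw [he.mfderiv_eq, mfderiv_id] at h
  exact (DFunLike.congr_fun h v).symm

theorem mfderiv_symm_apply (h1 : ContMDiffOn (𝓡 m) 𝓘(ℝ, V) ∞ e e.source)
    (h2 : ContMDiffOn 𝓘(ℝ, V) (𝓡 m) ∞ e.symm e.target) {p : V} (hp : p ∈ e.target)
    (w : TangentSpace (𝓡 m) (e.symm p)) :
    mfderiv 𝓘(ℝ, V) (𝓡 m) e.symm p (mfderiv (𝓡 m) 𝓘(ℝ, V) e (e.symm p) w) = w := by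
  have hs := e.map_target hp
  have d1 := (h1.contMDiffAt (e.open_source.mem_nhds hs)).mdifferentiableAt (by simp)
  have d2 := (h2.contMDiffAt (e.open_target.mem_nhds hp)).mdifferentiableAt (by simp)
  have d2' : MDifferentiableAt 𝓘(ℝ, V) (𝓡 m) e.symm (e (e.symm p)) := by rwa [e.right_inv hp]
  have h := mfderiv_comp (e.symm p) d2' d1
  have he : e.symm ∘ e =ᶠ[𝓝 (e.symm p)] id := by
    filter_upwards [e.open_source.mem_nhds hs] with q hq using e.left_inv hq
  rw [he.mfderiv_eq, mfderiv_id, e.right_inv hp] at h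
  exact (DFunLike.congr_fun h w).symm

end LocalDiffeo

section Adapted

universe uM uB
variable {n : ℕ} {B : Type uB} [TopologicalSpace B] [ChartedSpace (EuclideanSpace ℝ (Fin n)) B]
  {M : Type uM} [TopologicalSpace M] [ChartedSpace (EuclideanSpace ℝ (Fin (2 * n))) M]
  {pr : M → B} {η : Form (2 * n) M 2}

/-- The differential of the projection, expressed in the chart of the base around `x₀`. -/
def baseDeriv (x₀ : B) (pr : M → B) (z : M) : TangentSpace (𝓡 (2 * n)) z →L[ℝ] Vec n :=
  (mfderiv (𝓡 n) 𝓘(ℝ, EuclideanSpace ℝ (Fin n)) (extChartAt (𝓡 n) x₀) (pr z)).comp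
    (mfderiv (𝓡 (2 * n)) (𝓡 n) pr z)

theorem isShifting_cov_iff' {x₀ x : B} {ξ : Cov n} {z : M}
    {h : pr z = x} {v : TangentSpace (𝓡 (2 * n)) z} :
    IsShifting pr η (cov x₀ x ξ) z h v ↔ ∀ w : TangentSpace (𝓡 (2 * n)) z,
      η z ![v, w] = ξ (baseDeriv x₀ pr z w) := isShifting_cov_iff

variable [IsManifold (𝓡 n) ∞ B]

theorem baseDeriv_eq_zero_iff {x₀ : B} {z : M} (hz : pr z ∈ (chartAt (Vec n) x₀).source)
    {v : TangentSpace (𝓡 (2 * n)) z} :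
    baseDeriv x₀ pr z v = 0 ↔ mfderiv (𝓡 (2 * n)) (𝓡 n) pr z v = 0 := by
  constructor
  · intro h
    have h1 := mfderiv_symm_extChartAt_apply hz (mfderiv (𝓡 (2 * n)) (𝓡 n) pr z v)
    have h2 : mfderiv (𝓡 n) 𝓘(ℝ, EuclideanSpace ℝ (Fin n)) (extChartAt (𝓡 n) x₀) (pr z)
        (mfderiv (𝓡 (2 * n)) (𝓡 n) pr z v) = 0 := h
    rw [h2] at h1
    exact h1.symm.trans (map_zero _)
  · intro h
    have : baseDeriv x₀ pr z v = mfderiv (𝓡 n) 𝓘(ℝ, EuclideanSpace ℝ (Fin n))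
      (extChartAt (𝓡 n) x₀) (pr z) (mfderiv (𝓡 (2 * n)) (𝓡 n) pr z v) := rfl
    rw [this, h]
    exact map_zero _

theorem baseDeriv_surjective (hf : IsSmoothFibration (n := n) pr) {x₀ : B} {z : M}
    (hz : pr z ∈ (chartAt (Vec n) x₀).source) : Surjective (baseDeriv (n := n) x₀ pr z) := by
  intro w
  obtain ⟨v, hv⟩ := hf.mfderiv_surjective z (mfderiv 𝓘(ℝ, EuclideanSpace ℝ (Fin n)) (𝓡 n)
    (extChartAt (𝓡 n) x₀).symm (extChartAt (𝓡 n) x₀ (pr z)) w)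
  refine ⟨v, ?_⟩
  have : baseDeriv x₀ pr z v = mfderiv (𝓡 n) 𝓘(ℝ, EuclideanSpace ℝ (Fin n))
      (extChartAt (𝓡 n) x₀) (pr z) (mfderiv (𝓡 (2 * n)) (𝓡 n) pr z v) := rfl
  rw [this, hv]
  exact mfderiv_extChartAt_symm_apply hz w

theorem baseDeriv_mfderiv {V : Type*} [NormedAddCommGroup V] [NormedSpace ℝ V]
    (hf : ContMDiff (𝓡 (2 * n)) (𝓡 n) ∞ pr) {x₀ : B} {g : V → M} {p : V} {f : V → Vec n}
    (hg : MDifferentiableAt 𝓘(ℝ, V) (𝓡 (2 * n)) g p)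
    (hz : pr (g p) ∈ (chartAt (Vec n) x₀).source)
    (hgf : ∀ᶠ q in 𝓝 p, extChartAt (𝓡 n) x₀ (pr (g q)) = f q) (v : V) :
    baseDeriv x₀ pr (g p) (mfderiv 𝓘(ℝ, V) (𝓡 (2 * n)) g p v) = fderiv ℝ f p v := by
  have d1 : MDifferentiableAt (𝓡 n) 𝓘(ℝ, EuclideanSpace ℝ (Fin n)) (extChartAt (𝓡 n) x₀)
      (pr (g p)) := (contMDiffAt_extChartAt' (n := ∞) hz).mdifferentiableAt (by simp)
  have d2 : MDifferentiableAt (𝓡 (2 * n)) (𝓡 n) pr (g p) :=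
    hf.contMDiffAt.mdifferentiableAt (by simp)
  have h1 := mfderiv_comp p d1 (d2.comp p hg)
  have h2 := mfderiv_comp p d2 hg
  have h3 : extChartAt (𝓡 n) x₀ ∘ pr ∘ g =ᶠ[𝓝 p] f := hgf
  rw [h3.mfderiv_eq, h2, mfderiv_eq_fderiv] at h1
  exact (DFunLike.congr_fun h1 v).symm

/-- A chart of the total space adapted to `η`: its first component is the projection to the base and
its second component linearizes the shiftings: that of the covector with components `ξ` becomes the
constant vector field `(0, ξ)`. -/
structure IsAdaptedChart (pr : M → B) (η : Form (2 * n) M 2) (x₀ : B)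
    (χ : OpenPartialHomeomorph M (Vec n × Cov n)) : Prop where
  fst_eq : ∀ z ∈ χ.source, (χ z).1 = extChartAt (𝓡 n) x₀ (pr z)
  contMDiffOn : ContMDiffOn (𝓡 (2 * n)) 𝓘(ℝ, Vec n × Cov n) ∞ χ χ.source
  contMDiffOn_symm : ContMDiffOn 𝓘(ℝ, Vec n × Cov n) (𝓡 (2 * n)) ∞ χ.symm χ.target
  shift : ∀ p ∈ χ.target, ∀ (ξ : Cov n) (w : TangentSpace (𝓡 (2 * n)) (χ.symm p)),
    η (χ.symm p) ![mfderiv 𝓘(ℝ, Vec n × Cov n) (𝓡 (2 * n)) χ.symm p (0, ξ), w] =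
      ξ (baseDeriv x₀ pr (χ.symm p) w)

/-- The matrix of a 2-form on `E × E` pairing the second factor with the first one. -/
def mixedPart {E : Type*} [NormedAddCommGroup E] [NormedSpace ℝ E] [FiniteDimensional ℝ E]
    (Ω : (E × E) [⋀^Fin 2]→L[ℝ] ℝ) : E →L[ℝ] E →L[ℝ] ℝ :=
  LinearMap.toContinuousLinearMap
    ((LinearMap.toContinuousLinearMap (𝕜 := ℝ) (E := E) (F' := ℝ)).toLinearMap ∘ₗ
      (bilin Ω).compl₁₂ (LinearMap.inr ℝ E E) (LinearMap.inl ℝ E E))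

theorem mixedPart_apply {E : Type*} [NormedAddCommGroup E] [NormedSpace ℝ E]
    [FiniteDimensional ℝ E] (Ω : (E × E) [⋀^Fin 2]→L[ℝ] ℝ) (v w : E) :
    mixedPart Ω v w = Ω ![(0, v), (w, 0)] := rfl

theorem fderiv_apply_apply {V E F G : Type*} [NormedAddCommGroup V] [NormedSpace ℝ V]
    [NormedAddCommGroup E] [NormedSpace ℝ E] [NormedAddCommGroup F] [NormedSpace ℝ F]
    [NormedAddCommGroup G] [NormedSpace ℝ G]
    {A : V → E →L[ℝ] F →L[ℝ] G} {p : V} (hA : DifferentiableAt ℝ A p) (a : V) (v : E) (w : F) :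
    fderiv ℝ A p a v w = fderiv ℝ (fun q => A q v w) p a := by
  have h := (((hA.hasFDerivAt).clm_apply (hasFDerivAt_const v p)).clm_apply
    (hasFDerivAt_const w p)).fderiv
  rw [h]
  simp

variable [IsManifold (𝓡 (2 * n)) ∞ M]

/-- Adapted charts exist around every point. In a chart `(y, u)` in which the projection is `y`,
the form `η` pairs the vectors `∂/∂u` with the vectors `∂/∂y` by a matrix `A (y, u)`, so that each
`∂/∂y` defines a 1-form on the fibres. These 1-forms are closed since `η` vanishes on the fibres
and `dη` comes from the base, and `A` is invertible since `η` is non-degenerate. Primitives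
`g (y, u)` of them which are smooth in all variables are the second component of an adapted chart.
-/
theorem IsAlmostLagrangianFibration.exists_adaptedChart (h : IsAlmostLagrangianFibration pr η)
    {x₀ : B} {z₀ : M} (hz₀ : pr z₀ ∈ (chartAt (Vec n) x₀).source) :
    ∃ χ : OpenPartialHomeomorph M (Vec n × Cov n), z₀ ∈ χ.source ∧ IsAdaptedChart pr η x₀ χ := by
  have hf := h.fibration
  obtain ⟨φ, hφz, hφ, hs, hs'⟩ := hf.exists_chart hz₀
  set T := φ.target with hT
  have hTo : IsOpen T := φ.open_target
  have hct : ∀ p ∈ T, ContMDiffAt 𝓘(ℝ, Vec n × Vec n) (𝓡 (2 * n)) ∞ φ.symm p := fun p hp =>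
    hs'.contMDiffAt (hTo.mem_nhds hp)
  have hηs := Form.isSmooth_iff.1 h.smooth
  let Ω := η.pull φ.symm
  have hΩ : ∀ p ∈ T, ContDiffAt ℝ ∞ Ω p := fun p hp => (hηs _).pull (hct p hp)
  have hbase : ∀ p ∈ T, ∀ v : Vec n × Vec n, baseDeriv x₀ pr (φ.symm p)
      (mfderiv 𝓘(ℝ, Vec n × Vec n) (𝓡 (2 * n)) φ.symm p v) = v.1 := by
    intro p hp v
    have h1 : ∀ᶠ q in 𝓝 p, extChartAt (𝓡 n) x₀ (pr (φ.symm q)) = q.1 := by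
      filter_upwards [hTo.mem_nhds hp] with q hq
      rw [← (hφ _ (φ.map_target hq)).2, φ.right_inv hq]
    rw [baseDeriv_mfderiv hf.1 ((hct p hp).mdifferentiableAt (by simp))
      (hφ _ (φ.map_target hp)).1 h1, fderiv_fst]
    rfl
  have hpr0 : ∀ p ∈ T, ∀ v : Vec n, mfderiv (𝓡 (2 * n)) (𝓡 n) pr (φ.symm p)
      (mfderiv 𝓘(ℝ, Vec n × Vec n) (𝓡 (2 * n)) φ.symm p (0, v)) = 0 := fun p hp v =>
    (baseDeriv_eq_zero_iff (hφ _ (φ.map_target hp)).1).1 (hbase p hp (0, v))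
  have two_pull : ∀ p (a b : Vec n × Vec n), Ω p ![a, b] = η (φ.symm p)
      ![mfderiv 𝓘(ℝ, Vec n × Vec n) (𝓡 (2 * n)) φ.symm p a,
        mfderiv 𝓘(ℝ, Vec n × Vec n) (𝓡 (2 * n)) φ.symm p b] := by
    intro p a b
    refine (Form.pull_apply _ _ _ _).trans (congrArg (η (φ.symm p)) ?_)
    ext i : 1
    fin_cases i <;> rfl
  have hiso : ∀ p ∈ T, ∀ u v : Vec n, Ω p ![(0, u), (0, v)] = 0 := fun p hp u v => by
    rw [two_pull]
    exact h.isotropic _ _ _ (hpr0 p hp u) (hpr0 p hp v)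
  -- `dη` vanishes if one of the arguments is tangent to a fibre
  have hd : ∀ p ∈ T, ∀ (u : Vec n) (b c : Vec n × Vec n), extDeriv Ω p ![(0, u), b, c] = 0 := by
    intro p hp u b c
    obtain ⟨ψ, -, hψ⟩ := h.basic
    rw [extDeriv_pull (hηs _) (hct p hp), hψ]
    exact (ψ (pr (φ.symm p))).map_coord_zero 0 (hpr0 p hp u)
  let A : Vec n × Vec n → Vec n →L[ℝ] Cov n := fun p => mixedPart (Ω p)
  have hA : ContDiffOn ℝ ∞ A T := by
    refine contDiffOn_clm_apply.2 fun v => contDiffOn_clm_apply.2 fun w => fun p hp => ?_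
    refine ContDiffAt.contDiffWithinAt ?_
    exact ((ContinuousAlternatingMap.apply ℝ (Vec n × Vec n) ℝ
      ![(0, v), (w, 0)]).contDiff).contDiffAt.comp p (hΩ p hp)
  -- `dη` on two vectors tangent to the fibre and one from the base is the derivative of `A` along
  -- the fibre, skew-symmetrized
  have hcl : ∀ p ∈ T, ∀ u v : Vec n, fderiv ℝ A p (0, u) v = fderiv ℝ A p (0, v) u := by
    intro p hp u v
    ext1 w
    have hAd : DifferentiableAt ℝ A p :=
      (hA.contDiffAt (hTo.mem_nhds hp)).differentiableAt (by simp)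
    have h1 := hd p hp u (0, v) (w, 0)
    rw [extDeriv_two_apply ((hΩ p hp).differentiableAt (by simp))] at h1
    have h2 : (fun q => Ω q ![(0, u), (0, v)]) =ᶠ[𝓝 p] fun _ => 0 := by
      filter_upwards [hTo.mem_nhds hp] with q hq using hiso q hq u v
    rw [h2.fderiv_eq, fderiv_fun_const] at h1
    rw [fderiv_apply_apply hAd, fderiv_apply_apply hAd]
    simp only [A, mixedPart_apply]
    simpa [sub_eq_zero] using h1
  have hAinj : ∀ p ∈ T, ∀ v, A p v = 0 → v = 0 := by
    intro p hp v hv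
    have h0 : mfderiv 𝓘(ℝ, Vec n × Vec n) (𝓡 (2 * n)) φ.symm p (0, v) = 0 := by
      refine h.nondegenerate _ _ fun w => ?_
      rw [← mfderiv_symm_apply hs hs' hp w]
      set w' : Vec n × Vec n := mfderiv (𝓡 (2 * n)) 𝓘(ℝ, Vec n × Vec n) φ (φ.symm p) w
      have e1 := two_pull p (0, v) w'
      refine e1.symm.trans ?_
      have e2 : w' = (w'.1, 0) + (0, w'.2) := by simp
      rw [e2, two_add_right, hiso p hp, add_zero, ← mixedPart_apply]
      exact DFunLike.congr_fun hv _
    have h1 := mfderiv_apply_symm hs hs' hp (0, v)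
    rw [h0] at h1
    have h2 : ((0, v) : Vec n × Vec n) = 0 := h1.symm.trans (map_zero _)
    exact (Prod.mk.inj h2).2
  obtain ⟨r, hr, hrT, g, hg, hgA⟩ := exists_primitive_with_parameter hTo hA hcl
    (φ.map_source hφz)
  let f : Vec n × Vec n → Vec n × Cov n := fun p => (p.1, g p)
  have hfs : ContDiff ℝ ∞ f := contDiff_fst.prodMk hg
  have hfd : ∀ p v, fderiv ℝ f p v = (v.1, fderiv ℝ g p v) := by
    intro p v
    have := (hasFDerivAt_fst (𝕜 := ℝ) (p := p)).prodMk
      ((hg.differentiable (by simp) p).hasFDerivAt)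
    rw [this.fderiv]
    rfl
  have hfinj : Injective (fderiv ℝ f (φ z₀)) := by
    rw [injective_iff_map_eq_zero]
    rintro ⟨w, v⟩ hwv
    rw [hfd] at hwv
    obtain ⟨h1, h2⟩ := Prod.mk.inj hwv
    simp only at h1
    subst h1
    rw [hgA _ (mem_ball_self hr)] at h2
    rw [hAinj _ (φ.map_source hφz) v h2]
    rfl
  obtain ⟨e, hpe, heb, hef, hes⟩ := exists_smooth_localInverse isOpen_ball hfs.contDiffOn
    (mem_ball_self (x := φ z₀) hr) hfinj (by
      rw [Module.finrank_prod, Module.finrank_prod, finrank_cov]; simp)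
  have het : ∀ p ∈ (φ.trans e).target, p ∈ e.target ∧ e.symm p ∈ T ∧ e.symm p ∈ ball (φ z₀) r := by
    intro p hp
    rw [OpenPartialHomeomorph.trans_target] at hp
    exact ⟨hp.1, hp.2, heb (e.map_target hp.1)⟩
  have hesrc : ∀ z ∈ (φ.trans e).source, z ∈ φ.source ∧ φ z ∈ e.source := by
    intro z hz
    rw [OpenPartialHomeomorph.trans_source] at hz
    exact hz
  refine ⟨φ.trans e, ?_, ?_, ?_, ?_, ?_⟩
  · rw [OpenPartialHomeomorph.trans_source]
    exact ⟨hφz, hpe⟩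
  · intro z hz
    rw [← (hφ z (hesrc z hz).1).2]
    simp [hef, f]
  · rw [OpenPartialHomeomorph.coe_trans, hef]
    exact hfs.contMDiff.comp_contMDiffOn (hs.mono fun z hz => (hesrc z hz).1)
  · rw [OpenPartialHomeomorph.coe_trans_symm]
    exact hs'.comp (hes.contMDiffOn.mono fun p hp => (het p hp).1) fun p hp => (het p hp).2.1
  · intro p hp ξ w
    obtain ⟨hpe', hpT, hpb⟩ := het p hp
    set q := e.symm p with hq
    have d2 : DifferentiableAt ℝ e.symm p :=
      (hes.contDiffAt (e.open_target.mem_nhds hpe')).differentiableAt (by simp)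
    -- the vector `u` corresponding to `(0, ξ)` in the old chart satisfies `A u.2 = dg u.2 = ξ`
    set u : Vec n × Vec n := fderiv ℝ e.symm p (0, ξ) with hu
    have hfu : fderiv ℝ f q u = (0, ξ) := by
      have he : f ∘ e.symm =ᶠ[𝓝 p] id := by
        filter_upwards [e.open_target.mem_nhds hpe'] with y hy
        rw [← hef]; exact e.right_inv hy
      have hc := fderiv_comp p (hfs.differentiable (by simp) (e.symm p)) d2
      rw [he.fderiv_eq, fderiv_id] at hc
      exact (DFunLike.congr_fun hc (0, ξ)).symm
    rw [hfd] at hfu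
    obtain ⟨h1, h2⟩ := Prod.mk.inj hfu
    have hu' : u = (0, u.2) := Prod.ext h1 rfl
    rw [hu', hgA q hpb] at h2
    have hder : mfderiv 𝓘(ℝ, Vec n × Cov n) (𝓡 (2 * n)) (φ.trans e).symm p (0, ξ) =
        mfderiv 𝓘(ℝ, Vec n × Vec n) (𝓡 (2 * n)) φ.symm q u := by
      rw [OpenPartialHomeomorph.coe_trans_symm]
      have := mfderiv_comp p ((hct q hpT).mdifferentiableAt (by simp)) d2.mdifferentiableAt
      rw [mfderiv_eq_fderiv] at this
      exact DFunLike.congr_fun this (0, ξ)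
    rw [hder]
    change TangentSpace (𝓡 (2 * n)) (φ.symm q) at w
    change η (φ.symm q) ![_, w] = ξ (baseDeriv x₀ pr (φ.symm q) w)
    rw [← mfderiv_symm_apply hs hs' hpT w]
    set w' : Vec n × Vec n := mfderiv (𝓡 (2 * n)) 𝓘(ℝ, Vec n × Vec n) φ (φ.symm q) w
    have e3 : baseDeriv x₀ pr (φ.symm q)
      (mfderiv 𝓘(ℝ, Vec n × Vec n) (𝓡 (2 * n)) φ.symm q w') = w'.1 := hbase q hpT w'
    refine ((two_pull q u w').symm.trans ?_).trans (congrArg ξ e3).symm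
    have e4 : Ω q ![(0, u.2), w'] = A q u.2 w'.1 := by
      have e2 : w' = (w'.1, 0) + (0, w'.2) := by simp
      conv_lhs => rw [e2, two_add_right, hiso q hpT, add_zero]
      rfl
    rw [hu']
    exact e4.trans (DFunLike.congr_fun h2 w'.1)

end Adapted

/-! ### Trajectories of the shiftings -/

section LocalFlows

/-- A locally constant property of real numbers holds everywhere if it holds at one point. -/
theorem forall_real_of_locally {Q : ℝ → Prop} {t₀ : ℝ} (h0 : Q t₀)
    (h : ∀ t, ∀ᶠ s in 𝓝 t, Q s ↔ Q t) (t : ℝ) : Q t := by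
  have := isPreconnected_univ.induction₂ (fun s t => Q s ↔ Q t)
    (fun x _ => by
      rw [nhdsWithin_univ]; exact (h x).mono fun _ hs => hs.symm)
    (fun x y z _ _ _ h1 h2 => h1.trans h2) (fun x y _ _ h1 => h1.symm) (mem_univ t₀) (mem_univ t)
  exact this.1 h0

/-- A family of one-parameter flows `t ↦ S (t • ξ)` that is additive in `ξ` near every point for
small `ξ` is additive. -/
theorem flow_add_of_locally_add {N V : Type*} [TopologicalSpace N] [NormedAddCommGroup V]
    [NormedSpace ℝ V] {S : V → N → N}
    (h0 : ∀ z, S 0 z = z)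
    (ha : ∀ ξ z (s t : ℝ), S ((s + t) • ξ) z = S (s • ξ) (S (t • ξ) z))
    (hb : ∀ ξ z, Continuous fun t : ℝ => S (t • ξ) z)
    (hc : ∀ w, ∃ W ∈ 𝓝 w, ∃ δ > 0, ∀ z ∈ W, ∀ ξ ζ, ‖ξ‖ < δ → ‖ζ‖ < δ →
      S ξ (S ζ z) = S (ξ + ζ) z) (ξ ζ : V) (z : N) : S (ξ + ζ) z = S ζ (S ξ z) := by
  -- additivity of a small increment along a fixed trajectory, propagated from time zero
  have key : ∀ (ξ : V) (z : N) (t : ℝ), ∀ᶠ k in 𝓝 (0 : V),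
      S (t • (ξ + k)) z = S (t • k) (S (t • ξ) z) := by
    intro ξ z
    refine forall_real_of_locally (t₀ := 0) (Eventually.of_forall fun k => by simp [h0]) ?_
    intro t
    obtain ⟨W, hW, δ, hδ, hadd⟩ := hc (S (t • ξ) z)
    have hU : ∀ᶠ s in 𝓝 t, S (s • ξ) z ∈ W ∧ |s - t| * (‖ξ‖ + 1) < δ / 2 := by
      refine ((hb ξ z).continuousAt.eventually hW).and ?_
      have : Tendsto (fun s : ℝ => |s - t| * (‖ξ‖ + 1)) (𝓝 t) (𝓝 (|t - t| * (‖ξ‖ + 1))) :=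
        Continuous.tendsto (by fun_prop) t
      exact this.eventually (gt_mem_nhds (by simpa using half_pos hδ))
    have step : ∀ s r : ℝ, (S (s • ξ) z ∈ W ∧ |s - t| * (‖ξ‖ + 1) < δ / 2) →
        (S (r • ξ) z ∈ W ∧ |r - t| * (‖ξ‖ + 1) < δ / 2) →
        (∀ᶠ k in 𝓝 (0 : V), S (s • (ξ + k)) z = S (s • k) (S (s • ξ) z)) →
        ∀ᶠ k in 𝓝 (0 : V), S (r • (ξ + k)) z = S (r • k) (S (r • ξ) z) := by
      rintro s r ⟨hs, hs'⟩ ⟨-, hr'⟩ hQ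
      have small : ∀ c : ℝ, ∀ᶠ k in 𝓝 (0 : V), ‖c • k‖ < δ := by
        intro c
        have : Tendsto (fun k : V => ‖c • k‖) (𝓝 0) (𝓝 ‖c • (0 : V)‖) :=
          Continuous.tendsto (by fun_prop) 0
        exact this.eventually (gt_mem_nhds (by simpa using hδ))
      have hrs : |r - s| * (‖ξ‖ + 1) < δ := by
        have h1 : |r - s| ≤ |r - t| + |s - t| := by
          have := abs_sub_abs_le_abs_sub (r - t) (s - t)
          calc |r - s| = |(r - t) - (s - t)| := by ring_nf
            _ ≤ _ := abs_sub _ _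
        nlinarith [norm_nonneg ξ]
      filter_upwards [hQ, small r, small s, ball_mem_nhds (0 : V) one_pos] with k hk hkr hks hk1
      rw [mem_ball_zero_iff] at hk1
      have hn1 : ‖(r - s) • (ξ + k)‖ < δ := by
        rw [norm_smul, Real.norm_eq_abs]
        refine lt_of_le_of_lt ?_ hrs
        gcongr
        exact (norm_add_le _ _).trans (by linarith)
      have hn2 : ‖(r - s) • ξ‖ < δ := by
        rw [norm_smul, Real.norm_eq_abs]
        refine lt_of_le_of_lt ?_ hrs
        gcongr
        linarith
      calc S (r • (ξ + k)) z = S ((r - s) • (ξ + k)) (S (s • (ξ + k)) z) := by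
            rw [← ha]; congr 2; ring
        _ = S ((r - s) • (ξ + k) + s • k) (S (s • ξ) z) := by rw [hk, hadd _ hs _ _ hn1 hks]
        _ = S (r • k + (r - s) • ξ) (S (s • ξ) z) := by congr 1; module
        _ = S (r • k) (S ((r - s) • ξ) (S (s • ξ) z)) := (hadd _ hs _ _ hkr hn2).symm
        _ = S (r • k) (S (r • ξ) z) := by rw [← ha]; congr 3; ring
    filter_upwards [hU] with s hs
    exact ⟨step s t hs hU.self_of_nhds, step t s hU.self_of_nhds hs⟩
  -- `S (-t • ζ) ∘ S (ξ + t • ζ)` does not depend on `t`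
  have hloc : ∀ t : ℝ, ∀ᶠ s in 𝓝 t, S (-s • ζ) (S (ξ + s • ζ) z) =
      S (-t • ζ) (S (ξ + t • ζ) z) := by
    intro t
    have h1 := key (ξ + t • ζ) z 1
    have h2 : Tendsto (fun s : ℝ => (s - t) • ζ) (𝓝 t) (𝓝 0) := by
      have : Tendsto (fun s : ℝ => (s - t) • ζ) (𝓝 t) (𝓝 ((t - t) • ζ)) :=
        Continuous.tendsto (by fun_prop) t
      simpa using this
    filter_upwards [h2.eventually h1] with s hs
    simp only [one_smul] at hs
    rw [show ξ + s • ζ = ξ + t • ζ + (s - t) • ζ by module, hs, ← ha]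
    congr 2; ring
  have hconst : S (-(1 : ℝ) • ζ) (S (ξ + (1 : ℝ) • ζ) z) = S ξ z := by
    refine forall_real_of_locally (Q := fun t => S (-t • ζ) (S (ξ + t • ζ) z) = S ξ z) (t₀ := 0)
      (by simp [h0]) (fun t => ?_) 1
    filter_upwards [hloc t] with s hs
    rw [hs]
  rw [← hconst]
  have := ha ζ (S (ξ + (1 : ℝ) • ζ) z) 1 (-1)
  simp only [one_smul] at this ⊢
  rw [← this]
  simp [h0]

end LocalFlows

theorem eq_add_smul_of_hasFDerivAt {W : Type*} [NormedAddCommGroup W] [NormedSpace ℝ W]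
    {c : ℝ → W} {w : W} {t₀ ε : ℝ}
    (hc : ∀ t ∈ ball t₀ ε, HasFDerivAt c ((1 : ℝ →L[ℝ] ℝ).smulRight w) t) {t : ℝ}
    (ht : t ∈ ball t₀ ε) : c t = c t₀ + (t - t₀) • w := by
  have hε : 0 < ε := pos_of_mem_ball ht
  have hd : ∀ t ∈ ball t₀ ε, HasDerivAt (fun t => c t - (t - t₀) • w) 0 t := by
    intro t ht
    have h4 : HasDerivAt c w t := by simpa using (hc t ht).hasDerivAt
    have h5 := h4.sub (((hasDerivAt_id t).sub_const t₀).smul_const w)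
    rw [one_smul, sub_self] at h5
    exact h5
  have h6 := isOpen_ball.is_const_of_deriv_eq_zero (convex_ball t₀ ε).isPreconnected
    (fun s hs => (hd s hs).differentiableAt.differentiableWithinAt) (fun s hs => (hd s hs).deriv)
    ht (mem_ball_self hε)
  simp only [sub_self, zero_smul, sub_zero] at h6
  rw [← h6]
  abel

section Trajectories

universe uM uB
variable {n : ℕ} {B : Type uB} [TopologicalSpace B] [ChartedSpace (EuclideanSpace ℝ (Fin n)) B]
  {M : Type uM} [TopologicalSpace M] [ChartedSpace (EuclideanSpace ℝ (Fin (2 * n))) M]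
  {pr : M → B} {η : Form (2 * n) M 2}

theorem IsShiftingTrajectory.pr_eq {x : B} {α : CotangentSpace n x} {γ : ℝ → M}
    (hγ : IsShiftingTrajectory pr η α γ) (t : ℝ) : pr (γ t) = x := (hγ t).1

theorem IsShiftingTrajectory.continuous {x : B} {α : CotangentSpace n x} {γ : ℝ → M}
    (hγ : IsShiftingTrajectory pr η α γ) : Continuous γ :=
  continuous_iff_continuousAt.2 fun t => by
    obtain ⟨_, _, _, h⟩ := hγ t
    exact h.continuousAt

theorem IsShifting.smul {x : B} {α : CotangentSpace n x} {z : M} {h : pr z = x}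
    {v : TangentSpace (𝓡 (2 * n)) z} (hv : IsShifting pr η α z h v) (c : ℝ) :
    IsShifting pr η (c • α) z h (c • v) := by
  subst h
  intro w
  rw [two_smul_left, hv w]
  rfl

theorem IsShiftingTrajectory.comp_affine {x : B} {α : CotangentSpace n x} {γ : ℝ → M}
    (hγ : IsShiftingTrajectory pr η α γ) (c s : ℝ) :
    IsShiftingTrajectory pr η (c • α) (fun t => γ (c * t + s)) := by
  intro t
  obtain ⟨h, v, hv, hd⟩ := hγ (c * t + s)
  refine ⟨h, c • v, hv.smul c, ?_⟩
  have h1 : HasDerivAt (fun t : ℝ => c * t + s) c t := by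
    simpa using ((hasDerivAt_id t).const_mul c).add_const s
  have h2 := HasMFDerivAt.comp t hd h1.hasFDerivAt.hasMFDerivAt
  refine h2.congr_mfderiv ?_
  refine ContinuousLinearMap.ext fun r => ?_
  let r' : ℝ := r
  change (r' * c) • v = r' • c • v
  rw [smul_smul]

/-- The time-one shift `s_α` of the fibre over `x`, along any choice of trajectories (they are
unique by `trajectory_unique`). -/
def timeShift (hc : ShiftingsComplete pr η) {x : B} (α : CotangentSpace n x) (z : pr ⁻¹' {x}) :
    pr ⁻¹' {x} :=
  ⟨(hc x α z z.2).choose 1, (hc x α z z.2).choose_spec.2.pr_eq 1⟩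

theorem isTimeOneShift_timeShift (hc : ShiftingsComplete pr η) {x : B} (α : CotangentSpace n x)
    (z : pr ⁻¹' {x}) : IsTimeOneShift pr η α (z : M) (timeShift hc α z : M) :=
  ⟨_, (hc x α z z.2).choose_spec.2, (hc x α z z.2).choose_spec.1, rfl⟩

/-- The time-one shift of a point by the covector with given components in a chart. -/
def chartShift (hc : ShiftingsComplete pr η) (x₀ : B) (ξ : Cov n) (z : M) : M :=
  (timeShift hc (cov x₀ (pr z) ξ) ⟨z, rfl⟩ : M)

theorem chartShift_eq (hc : ShiftingsComplete pr η) (x₀ : B) (ξ : Cov n) {x : B}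
    (z : pr ⁻¹' {x}) : chartShift hc x₀ ξ z = (timeShift hc (cov x₀ x ξ) z : M) := by
  obtain ⟨z, rfl⟩ := z
  rfl

theorem pr_chartShift (hc : ShiftingsComplete pr η) (x₀ : B) (ξ : Cov n) (z : M) :
    pr (chartShift hc x₀ ξ z) = pr z :=
  (timeShift hc (cov x₀ (pr z) ξ) ⟨z, rfl⟩).2

theorem IsAdaptedChart.mfderiv_shifting (h : IsMaximalIsotropicFibration pr η) {x₀ x : B}
    {χ : OpenPartialHomeomorph M (Vec n × Cov n)} (hχ : IsAdaptedChart pr η x₀ χ) {z : M}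
    (hz : z ∈ χ.source) {ξ : Cov n} {hx : pr z = x} {v : TangentSpace (𝓡 (2 * n)) z}
    (hv : IsShifting pr η (cov x₀ x ξ) z hx v) :
    (mfderiv (𝓡 (2 * n)) 𝓘(ℝ, Vec n × Cov n) χ z v : Vec n × Cov n) = (0, ξ) := by
  obtain ⟨p, hp, rfl⟩ : ∃ p ∈ χ.target, χ.symm p = z := ⟨χ z, χ.map_source hz, χ.left_inv hz⟩
  rw [isShifting_cov_iff'] at hv
  have : v - mfderiv 𝓘(ℝ, Vec n × Cov n) (𝓡 (2 * n)) χ.symm p (0, ξ) = 0 := by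
    refine h.nondegenerate _ _ fun w => ?_
    rw [sub_eq_add_neg, ← neg_one_smul ℝ, two_add_left, two_smul_left, hv w, hχ.shift p hp]
    ring
  rw [sub_eq_zero.1 this]
  exact mfderiv_apply_symm hχ.contMDiffOn hχ.contMDiffOn_symm hp (0, ξ)

/-- In an adapted chart the trajectories of the shiftings are straight lines. -/
theorem IsAdaptedChart.eventually_trajectory (h : IsMaximalIsotropicFibration pr η) {x₀ x : B}
    {χ : OpenPartialHomeomorph M (Vec n × Cov n)} (hχ : IsAdaptedChart pr η x₀ χ) {ξ : Cov n}
    {γ : ℝ → M} (hγ : IsShiftingTrajectory pr η (cov x₀ x ξ) γ) {t₀ : ℝ}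
    (ht₀ : γ t₀ ∈ χ.source) :
    ∀ᶠ t in 𝓝 t₀, γ t ∈ χ.source ∧ χ (γ t) = χ (γ t₀) + (t - t₀) • ((0, ξ) : Vec n × Cov n) := by
  obtain ⟨ε, hε, hball⟩ := Metric.mem_nhds_iff.1
    (hγ.continuous.continuousAt.preimage_mem_nhds (χ.open_source.mem_nhds ht₀))
  filter_upwards [ball_mem_nhds t₀ hε] with t ht
  refine ⟨hball ht, eq_add_smul_of_hasFDerivAt (c := fun t => χ (γ t)) (fun s hs => ?_) ht⟩
  obtain ⟨hx, v, hv, hdv⟩ := hγ s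
  have hs : γ s ∈ χ.source := hball hs
  have h1 := hχ.mfderiv_shifting h hs hv
  have h2 : HasMFDerivAt (𝓡 (2 * n)) 𝓘(ℝ, Vec n × Cov n) χ (γ s)
      (mfderiv (𝓡 (2 * n)) 𝓘(ℝ, Vec n × Cov n) χ (γ s)) :=
    ((hχ.contMDiffOn.contMDiffAt (χ.open_source.mem_nhds hs)).mdifferentiableAt
      (by simp)).hasMFDerivAt
  have h3 := (HasMFDerivAt.comp s h2 hdv).hasFDerivAt
  refine h3.congr_fderiv (ContinuousLinearMap.ext fun r => ?_)
  let r' : ℝ := r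
  refine (map_smul (mfderiv (𝓡 (2 * n)) 𝓘(ℝ, Vec n × Cov n) χ (γ s)) r' v).trans ?_
  exact congrArg (fun y : Vec n × Cov n => r' • y) h1

variable [IsManifold (𝓡 n) ∞ B] [IsManifold (𝓡 (2 * n)) ∞ M] [T2Space M]

/-- Trajectories of shiftings are unique, being straight lines in adapted charts. -/
theorem trajectory_unique (h : IsAlmostLagrangianFibration pr η) {x : B} {α : CotangentSpace n x}
    {γ₁ γ₂ : ℝ → M} (h₁ : IsShiftingTrajectory pr η α γ₁) (h₂ : IsShiftingTrajectory pr η α γ₂)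
    {t₀ : ℝ} (h0 : γ₁ t₀ = γ₂ t₀) : γ₁ = γ₂ := by
  rw [← cov_components (mem_chart_source (Vec n) x) α] at h₁ h₂
  have hcl : IsClosed {t | γ₁ t = γ₂ t} := isClosed_eq h₁.continuous h₂.continuous
  have hop : IsOpen {t | γ₁ t = γ₂ t} := by
    rw [isOpen_iff_mem_nhds]
    intro t ht
    have ht' : γ₁ t = γ₂ t := ht
    obtain ⟨χ, hz, hχ⟩ := h.exists_adaptedChart (x₀ := x) (z₀ := γ₁ t)
      (by rw [h₁.pr_eq]; exact mem_chart_source (Vec n) x)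
    filter_upwards [hχ.eventually_trajectory h.toIsMaximalIsotropicFibration h₁ hz,
      hχ.eventually_trajectory h.toIsMaximalIsotropicFibration h₂ (ht' ▸ hz)] with s hs1 hs2
    refine χ.injOn hs1.1 hs2.1 ?_
    rw [hs1.2, hs2.2, ht']
  have := IsClopen.eq_univ ⟨hcl, hop⟩ ⟨t₀, h0⟩
  funext t
  exact this.symm.subset (mem_univ t)

theorem timeShift_smul_eq (h : IsAlmostLagrangianFibration pr η) {x : B} {α : CotangentSpace n x}
    {γ : ℝ → M} (hγ : IsShiftingTrajectory pr η α γ) (s t : ℝ) (z : pr ⁻¹' {x}) (hz : γ s = z) :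
    (timeShift h.complete (t • α) z : M) = γ (t + s) := by
  have h1 := (h.complete x (t • α) z z.2).choose_spec
  have h2 := trajectory_unique h h1.2 (hγ.comp_affine t s) (t₀ := 0) (by
    rw [h1.1]; simp [hz])
  have h3 := congrFun h2 1
  simp only [mul_one] at h3
  exact h3

theorem isShiftingTrajectory_timeShift (h : IsAlmostLagrangianFibration pr η) {x : B}
    (α : CotangentSpace n x) (z : pr ⁻¹' {x}) :
    IsShiftingTrajectory pr η α (fun t => (timeShift h.complete (t • α) z : M)) := by
  have h1 := (h.complete x α z z.2).choose_spec
  have : (fun t => (timeShift h.complete (t • α) z : M)) = (h.complete x α z z.2).choose := by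
    funext t
    rw [timeShift_smul_eq h h1.2 0 t z h1.1, add_zero]
  rw [this]
  exact h1.2

theorem timeShift_zero (h : IsAlmostLagrangianFibration pr η) {x : B} (z : pr ⁻¹' {x}) :
    timeShift h.complete (0 : CotangentSpace n x) z = z := by
  have h1 := (h.complete x 0 z z.2).choose_spec
  refine Subtype.ext ?_
  have := timeShift_smul_eq h h1.2 0 0 z h1.1
  rw [zero_smul] at this
  rw [this, add_zero, h1.1]

theorem timeShift_add_smul (h : IsAlmostLagrangianFibration pr η) {x : B}
    (α : CotangentSpace n x) (z : pr ⁻¹' {x}) (s t : ℝ) :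
    timeShift h.complete ((s + t) • α) z =
      timeShift h.complete (s • α) (timeShift h.complete (t • α) z) := by
  have h1 := isShiftingTrajectory_timeShift h α z
  refine Subtype.ext ?_
  rw [timeShift_smul_eq h h1 t s (timeShift h.complete (t • α) z) rfl]

theorem chartShift_add_smul (h : IsAlmostLagrangianFibration pr η) (x₀ : B) (ξ : Cov n) (z : M)
    (s t : ℝ) : chartShift h.complete x₀ ((s + t) • ξ) z =
      chartShift h.complete x₀ (s • ξ) (chartShift h.complete x₀ (t • ξ) z) := by
  have : chartShift h.complete x₀ (s • ξ) (chartShift h.complete x₀ (t • ξ) z) = _ :=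
    chartShift_eq h.complete x₀ (s • ξ) (timeShift h.complete (cov x₀ (pr z) (t • ξ)) ⟨z, rfl⟩)
  rw [this, chartShift]
  simp only [map_smul]
  rw [timeShift_add_smul h]

omit [IsManifold (𝓡 n) ∞ B] [IsManifold (𝓡 (2 * n)) ∞ M] in
/-- In an adapted chart small shifts are translations. -/
theorem IsAdaptedChart.chartShift_eq (h : IsAlmostLagrangianFibration pr η) {x₀ : B}
    {χ : OpenPartialHomeomorph M (Vec n × Cov n)} (hχ : IsAdaptedChart pr η x₀ χ) {z₀ : M}
    (hz₀ : z₀ ∈ χ.source) :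
    ∃ W ∈ 𝓝 z₀, ∃ δ > 0, ∀ z ∈ W, ∀ ξ : Cov n, ‖ξ‖ < δ → z ∈ χ.source ∧
      χ z + (0, ξ) ∈ χ.target ∧ chartShift h.complete x₀ ξ z = χ.symm (χ z + (0, ξ)) := by
  obtain ⟨ρ, hρ, hball⟩ := Metric.isOpen_iff.1 χ.open_target (χ z₀) (χ.map_source hz₀)
  refine ⟨χ.source ∩ χ ⁻¹' ball (χ z₀) (ρ / 2), ?_, ρ / 2, half_pos hρ, ?_⟩
  · exact (χ.continuousOn.isOpen_inter_preimage χ.open_source isOpen_ball).mem_nhds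
      ⟨hz₀, mem_ball_self (half_pos hρ)⟩
  rintro z ⟨hz, hzb⟩ ξ hξ
  have hline : ∀ t ∈ Icc (0 : ℝ) 1, χ z + t • ((0, ξ) : Vec n × Cov n) ∈ χ.target := by
    intro t ht
    refine hball ?_
    rw [mem_preimage, mem_ball] at hzb
    rw [mem_ball]
    have h1 : dist (χ z + t • ((0, ξ) : Vec n × Cov n)) (χ z) < ρ / 2 := by
      rw [dist_eq_norm, add_sub_cancel_left, norm_smul, Real.norm_eq_abs, abs_of_nonneg ht.1]
      have h2 : ‖((0, ξ) : Vec n × Cov n)‖ = ‖ξ‖ := by simp [Prod.norm_def]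
      rw [h2]
      nlinarith [ht.2, norm_nonneg ξ]
    linarith [dist_triangle (χ z + t • ((0, ξ) : Vec n × Cov n)) (χ z) (χ z₀)]
  have h1 := hline 1 ⟨zero_le_one, le_rfl⟩
  rw [one_smul] at h1
  refine ⟨hz, h1, ?_⟩
  have hspec := (h.complete (pr z) (cov x₀ (pr z) ξ) z rfl).choose_spec
  set γ := (h.complete (pr z) (cov x₀ (pr z) ξ) z rfl).choose
  -- the trajectory `γ` cannot leave the straight line `ℓ`
  let ℓ : ℝ → M := fun t => χ.symm (χ z + t • ((0, ξ) : Vec n × Cov n))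
  have hℓ : ContinuousOn ℓ (Icc 0 1) :=
    χ.continuousOn_symm.comp (by fun_prop) hline
  have hcl : IsClosed ({t | γ t = ℓ t} ∩ Icc 0 1) := by
    rw [inter_comm]
    exact (hspec.2.continuous.continuousOn.prodMk hℓ).preimage_isClosed_of_isClosed isClosed_Icc
      isClosed_diagonal
  have hsub : Icc (0 : ℝ) 1 ⊆ {t | γ t = ℓ t} := by
    refine hcl.Icc_subset_of_forall_mem_nhdsWithin ?_ ?_
    · change γ 0 = ℓ 0
      rw [hspec.1]
      simp only [ℓ, zero_smul, add_zero]
      exact (χ.left_inv hz).symm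
    · rintro t ⟨ht, ht'⟩
      have htt : γ t = ℓ t := ht
      have hmem := hline t (Ico_subset_Icc_self ht')
      have hs : γ t ∈ χ.source := by rw [htt]; exact χ.map_target hmem
      refine mem_nhdsWithin_of_mem_nhds ?_
      filter_upwards [hχ.eventually_trajectory h.toIsMaximalIsotropicFibration hspec.2 hs]
        with s hs'
      rw [← χ.left_inv hs'.1, hs'.2, htt]
      simp only [ℓ]
      rw [χ.right_inv hmem]
      congr 1
      module
  have := hsub (⟨zero_le_one, le_rfl⟩ : (1 : ℝ) ∈ Icc (0 : ℝ) 1)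
  change γ 1 = ℓ 1 at this
  simp only [ℓ, one_smul] at this
  exact this

end Trajectories

/-! ### The action given by the shifts -/

section InducedAction

universe uM uB
variable {n : ℕ} {B : Type uB} [TopologicalSpace B] [ChartedSpace (EuclideanSpace ℝ (Fin n)) B]
  {M : Type uM} [TopologicalSpace M] [ChartedSpace (EuclideanSpace ℝ (Fin (2 * n))) M]
  {pr : M → B} {η : Form (2 * n) M 2}
  [IsManifold (𝓡 n) ∞ B] [IsManifold (𝓡 (2 * n)) ∞ M] [T2Space M]

omit [IsManifold (𝓡 n) ∞ B] [IsManifold (𝓡 (2 * n)) ∞ M] in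
theorem IsAdaptedChart.chartShift_add (h : IsAlmostLagrangianFibration pr η) {x₀ : B}
    {χ : OpenPartialHomeomorph M (Vec n × Cov n)} (hχ : IsAdaptedChart pr η x₀ χ) {z₀ : M}
    (hz₀ : z₀ ∈ χ.source) :
    ∃ W ∈ 𝓝 z₀, ∃ δ > 0, ∀ z ∈ W, ∀ ξ ζ : Cov n, ‖ξ‖ < δ → ‖ζ‖ < δ →
      chartShift h.complete x₀ ξ (chartShift h.complete x₀ ζ z) =
        chartShift h.complete x₀ (ξ + ζ) z := by
  obtain ⟨W, hW, δ, hδ, hloc⟩ := hχ.chartShift_eq h hz₀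
  -- points close to `z₀` stay in `W` under small shifts
  have hcont : ContinuousAt (fun q : M × Cov n => χ.symm (χ q.1 + (0, q.2))) (z₀, 0) := by
    have h1 : ContinuousAt (fun q : M × Cov n => χ q.1 + (0, q.2)) (z₀, 0) :=
      ((χ.continuousAt hz₀).comp continuousAt_fst).add
        (continuousAt_const.prodMk continuousAt_snd)
    refine ContinuousAt.comp (g := χ.symm) ?_ h1
    refine χ.continuousAt_symm ?_
    change χ z₀ + (0, (0 : Cov n)) ∈ χ.target
    rw [Prod.mk_zero_zero, add_zero]
    exact χ.map_source hz₀
  have hz0 : χ.symm (χ z₀ + (0, (0 : Cov n))) = z₀ := by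
    rw [Prod.mk_zero_zero, add_zero, χ.left_inv hz₀]
  have hev : ∀ᶠ q : M × Cov n in 𝓝 (z₀, 0), χ.symm (χ q.1 + (0, q.2)) ∈ W := by
    refine hcont.eventually_mem ?_
    simpa [hz0] using hW
  rw [nhds_prod_eq] at hev
  obtain ⟨W', hW', D, hD, hWD⟩ := eventually_prod_iff.1 hev
  obtain ⟨ε, hε, hεD⟩ := Metric.eventually_nhds_iff.1 hD
  refine ⟨W ∩ {z | W' z}, inter_mem hW hW', min (δ / 2) ε, by positivity, ?_⟩
  rintro z ⟨hz, hz'⟩ ξ ζ hξ hζ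
  have hξ' := hξ.trans_le (min_le_left _ _)
  have hζ' := hζ.trans_le (min_le_left _ _)
  obtain ⟨h1, h2, h3⟩ := hloc z hz ζ (by linarith)
  obtain ⟨-, h5, h6⟩ := hloc z hz (ξ + ζ) ((norm_add_le _ _).trans_lt (by linarith))
  have hmem : chartShift h.complete x₀ ζ z ∈ W := by
    rw [h3]
    exact hWD hz' (hεD (by simpa using hζ.trans_le (min_le_right _ _)))
  obtain ⟨-, -, h9⟩ := hloc _ hmem ξ (by linarith)
  have hsum : χ z + ((0, ζ) : Vec n × Cov n) + (0, ξ) = χ z + (0, ξ + ζ) := by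
    refine Prod.ext ?_ ?_
    · simp
    · simp only [Prod.snd_add]; abel
  rw [h9, h6, h3, χ.right_inv h2, hsum]

/-- The shifts of a fibre commute and are additive in the covector: this holds locally, where they
are translations of an adapted chart, and so for the flows. -/
theorem timeShift_add (h : IsAlmostLagrangianFibration pr η) {x : B} (α β : CotangentSpace n x)
    (z : pr ⁻¹' {x}) : timeShift h.complete (α + β) z =
      timeShift h.complete β (timeShift h.complete α z) := by
  have hx := mem_chart_source (Vec n) x
  have hcoe : ∀ (ξ : Cov n) (z : pr ⁻¹' {x}),
      (timeShift h.complete (cov x x ξ) z : M) = chartShift h.complete x ξ z :=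
    fun ξ z => (chartShift_eq h.complete x ξ z).symm
  have key := flow_add_of_locally_add (N := pr ⁻¹' {x}) (V := Cov n)
    (S := fun ξ z => timeShift h.complete (cov x x ξ) z) ?_ ?_ ?_ ?_
    (components x x α) (components x x β) z
  · simpa only [map_add, cov_components hx] using key
  · intro z
    simp only [map_zero]
    exact timeShift_zero h z
  · intro ξ z s t
    simp only [map_smul]
    exact timeShift_add_smul h _ z s t
  · intro ξ z
    simp only [map_smul]
    exact (isShiftingTrajectory_timeShift h (cov x x ξ) z).continuous.subtype_mk _
  · intro w
    obtain ⟨χ, hz, hχ⟩ := h.exists_adaptedChart (x₀ := x) (z₀ := (w : M))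
      (by rw [w.2]; exact hx)
    obtain ⟨W, hW, δ, hδ, hadd⟩ := hχ.chartShift_add h hz
    refine ⟨Subtype.val ⁻¹' W, continuous_subtype_val.continuousAt.preimage_mem_nhds hW, δ, hδ,
      fun z hz ξ ζ hξ hζ => Subtype.ext ?_⟩
    rw [hcoe, hcoe, hcoe]
    exact hadd z hz ξ ζ hξ hζ

theorem chartShift_add (h : IsAlmostLagrangianFibration pr η) (x₀ : B) (ξ ζ : Cov n) (z : M) :
    chartShift h.complete x₀ (ξ + ζ) z =
      chartShift h.complete x₀ ζ (chartShift h.complete x₀ ξ z) := by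
  have : chartShift h.complete x₀ ζ (chartShift h.complete x₀ ξ z) = _ :=
    chartShift_eq h.complete x₀ ζ (timeShift h.complete (cov x₀ (pr z) ξ) ⟨z, rfl⟩)
  rw [this, chartShift, map_add, timeShift_add h]

/-- The shifts act transitively on a fibre: their orbits are open, as is seen in adapted charts, and
the fibre is connected. -/
theorem timeShift_transitive (h : IsAlmostLagrangianFibration pr η) {x : B}
    (z z' : pr ⁻¹' {x}) : ∃ α : CotangentSpace n x, timeShift h.complete α z = z' := by
  have hx := mem_chart_source (Vec n) x
  have hneg : ∀ (α : CotangentSpace n x) (z : pr ⁻¹' {x}),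
      timeShift h.complete (-α) (timeShift h.complete α z) = z := fun α z => by
    rw [← timeShift_add h, add_neg_cancel, timeShift_zero h]
  have := isPreconnected_iff_preconnectedSpace.1 (h.connected x).isPreconnected
  refine isPreconnected_univ.induction₂
    (fun z z' : pr ⁻¹' {x} => ∃ α : CotangentSpace n x, timeShift h.complete α z = z')
    (fun z _ => ?_) ?_ ?_ (mem_univ z) (mem_univ z')
  · rw [nhdsWithin_univ]
    obtain ⟨χ, hz, hχ⟩ := h.exists_adaptedChart (x₀ := x) (z₀ := (z : M))
      (by rw [z.2]; exact hx)
    obtain ⟨W, hW, δ, hδ, hloc⟩ := hχ.chartShift_eq h hz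
    have hc : ContinuousAt (fun z' : pr ⁻¹' {x} => (χ z').2 - (χ z).2) z := by
      have : ContinuousAt (fun z' : pr ⁻¹' {x} => χ (z' : M)) z :=
        ContinuousAt.comp (χ.continuousAt hz) continuous_subtype_val.continuousAt
      exact (continuousAt_snd.comp this).sub continuousAt_const
    have e1 : ∀ᶠ z' : pr ⁻¹' {x} in 𝓝 z, ‖(χ z').2 - (χ z).2‖ < δ := by
      have h0 : ‖(χ (z : M)).2 - (χ (z : M)).2‖ < δ := by simpa using hδ
      exact hc.norm.eventually (gt_mem_nhds h0)
    have e2 : ∀ᶠ z' : pr ⁻¹' {x} in 𝓝 z, (z' : M) ∈ χ.source :=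
      continuous_subtype_val.continuousAt.preimage_mem_nhds (χ.open_source.mem_nhds hz)
    filter_upwards [e1, e2] with z' hz1 hz2
    refine ⟨cov x x ((χ z').2 - (χ z).2), Subtype.ext ?_⟩
    rw [← chartShift_eq]
    obtain ⟨-, -, h3⟩ := hloc z (mem_of_mem_nhds hW) _ hz1
    rw [h3]
    have h4 : χ z + (0, (χ z').2 - (χ z).2) = χ z' := by
      refine Prod.ext ?_ (by simp)
      rw [Prod.fst_add, add_zero, hχ.fst_eq _ hz, hχ.fst_eq _ hz2, z.2, z'.2]
    rw [h4, χ.left_inv hz2]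
  · rintro a b c - - - ⟨α, rfl⟩ ⟨β, rfl⟩
    exact ⟨α + β, timeShift_add h _ _ _⟩
  · rintro a b - - ⟨α, rfl⟩
    exact ⟨-α, hneg _ _⟩

theorem eventually_contMDiffAt_chartShift (h : IsAlmostLagrangianFibration pr η) {x₀ : B} {z₀ : M}
    (hz₀ : pr z₀ ∈ (chartAt (Vec n) x₀).source) :
    ∀ᶠ p : Cov n × M in 𝓝 (0, z₀), ContMDiffAt (𝓘(ℝ, Cov n).prod (𝓡 (2 * n))) (𝓡 (2 * n)) ∞
      (fun q : Cov n × M => chartShift h.complete x₀ q.1 q.2) p := by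
  obtain ⟨χ, hz, hχ⟩ := h.exists_adaptedChart hz₀
  obtain ⟨W, hW, δ, hδ, hloc⟩ := hχ.chartShift_eq h hz
  have h1 : ∀ p : Cov n × M, p.2 ∈ χ.source → χ p.2 + (0, p.1) ∈ χ.target →
      ContMDiffAt (𝓘(ℝ, Cov n).prod (𝓡 (2 * n))) (𝓡 (2 * n)) ∞
        (χ.symm ∘ fun q : Cov n × M => χ q.2 + (0, q.1)) p := by
    intro p hp hp'
    have a1 : ContMDiffAt (𝓘(ℝ, Cov n).prod (𝓡 (2 * n))) 𝓘(ℝ, Vec n × Cov n) ∞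
        (fun q : Cov n × M => χ q.2) p :=
      (hχ.contMDiffOn.contMDiffAt (χ.open_source.mem_nhds hp)).comp p contMDiffAt_snd
    have a2 : ContMDiffAt (𝓘(ℝ, Cov n).prod (𝓡 (2 * n))) 𝓘(ℝ, Vec n × Cov n) ∞
        (fun q : Cov n × M => ((0, q.1) : Vec n × Cov n)) p :=
      ContMDiffAt.prodMk_space contMDiffAt_const contMDiffAt_fst
    exact ContMDiffAt.comp p (hχ.contMDiffOn_symm.contMDiffAt (χ.open_target.mem_nhds hp'))
      (a1.add a2)
  have e1 : ∀ᶠ q : Cov n × M in 𝓝 (0, z₀), ‖q.1‖ < δ ∧ q.2 ∈ W := by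
    rw [nhds_prod_eq]
    refine Eventually.and ?_ ?_
    · have : ∀ᶠ ξ : Cov n in 𝓝 0, ‖ξ‖ < δ := by
        filter_upwards [ball_mem_nhds (0 : Cov n) hδ] with ξ hξ using by simpa using hξ
      exact this.prod_inl _
    · exact Eventually.prod_inr (p := fun z => z ∈ W) hW _
  filter_upwards [eventually_eventually_nhds.2 e1] with p hp
  obtain ⟨hp1, hp2⟩ := hp.self_of_nhds
  obtain ⟨h3, h4, -⟩ := hloc _ hp2 _ hp1
  refine (h1 p h3 h4).congr_of_eventuallyEq ?_
  filter_upwards [hp] with q hq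
  exact (hloc q.2 hq.2 q.1 hq.1).2.2

theorem chartShift_zero (h : IsAlmostLagrangianFibration pr η) (x₀ : B) (z : M) :
    chartShift h.complete x₀ 0 z = z := by
  rw [chartShift, map_zero, timeShift_zero h]

theorem continuous_chartShift_smul (h : IsAlmostLagrangianFibration pr η) (x₀ : B) (ξ : Cov n)
    (z : M) : Continuous fun t : ℝ => chartShift h.complete x₀ (t • ξ) z := by
  simp only [chartShift, map_smul]
  exact (isShiftingTrajectory_timeShift h (cov x₀ (pr z) ξ) ⟨z, rfl⟩).continuous

/-- A shift by a fixed covector is smooth: it is a composition of short shifts, which are smooth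
near every point of the trajectory. -/
theorem contMDiffAt_chartShift_const (h : IsAlmostLagrangianFibration pr η) {x₀ : B} {z₀ : M}
    (hz₀ : pr z₀ ∈ (chartAt (Vec n) x₀).source) (ξ : Cov n) :
    ContMDiffAt (𝓡 (2 * n)) (𝓡 (2 * n)) ∞ (chartShift h.complete x₀ ξ) z₀ := by
  have key := forall_real_of_locally
    (Q := fun t => ContMDiffAt (𝓡 (2 * n)) (𝓡 (2 * n)) ∞ (chartShift h.complete x₀ (t • ξ)) z₀)
    (t₀ := 0) ?_ ?_ 1
  · simpa using key
  · have : chartShift h.complete x₀ ((0 : ℝ) • ξ) = id := by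
      funext z; rw [zero_smul, chartShift_zero h]; rfl
    rw [this]; exact contMDiffAt_id
  · intro t
    have hw : pr (chartShift h.complete x₀ (t • ξ) z₀) ∈ (chartAt (Vec n) x₀).source := by
      rwa [pr_chartShift h.complete]
    -- near the point reached at time `t` all short shifts are smooth
    have h2 : ∀ᶠ q : Cov n × M in 𝓝 (0, chartShift h.complete x₀ (t • ξ) z₀),
        ContMDiffAt (𝓡 (2 * n)) (𝓡 (2 * n)) ∞ (chartShift h.complete x₀ q.1) q.2 := by
      filter_upwards [eventually_contMDiffAt_chartShift h hw] with q hq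
      exact ContMDiffAt.comp (f := fun z : M => (q.1, z)) q.2 hq
        (contMDiffAt_const.prodMk contMDiffAt_id)
    have hcur : Tendsto (fun s : ℝ => chartShift h.complete x₀ (s • ξ) z₀) (𝓝 t)
        (𝓝 (chartShift h.complete x₀ (t • ξ) z₀)) :=
      (continuous_chartShift_smul h x₀ ξ z₀).tendsto t
    have hlin : Tendsto (fun s : ℝ => (s - t) • ξ) (𝓝 t) (𝓝 0) := by
      have : Tendsto (fun s : ℝ => (s - t) • ξ) (𝓝 t) (𝓝 ((t - t) • ξ)) :=
        Continuous.tendsto (by fun_prop) t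
      simpa using this
    have hlin' : Tendsto (fun s : ℝ => (t - s) • ξ) (𝓝 t) (𝓝 0) := by
      have : Tendsto (fun s : ℝ => (t - s) • ξ) (𝓝 t) (𝓝 ((t - t) • ξ)) :=
        Continuous.tendsto (by fun_prop) t
      simpa using this
    have step : ∀ s r : ℝ, ContMDiffAt (𝓡 (2 * n)) (𝓡 (2 * n)) ∞
        (chartShift h.complete x₀ ((r - s) • ξ)) (chartShift h.complete x₀ (s • ξ) z₀) →
        ContMDiffAt (𝓡 (2 * n)) (𝓡 (2 * n)) ∞ (chartShift h.complete x₀ (s • ξ)) z₀ →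
        ContMDiffAt (𝓡 (2 * n)) (𝓡 (2 * n)) ∞ (chartShift h.complete x₀ (r • ξ)) z₀ := by
      intro s r h3 h4
      have : chartShift h.complete x₀ (r • ξ) = chartShift h.complete x₀ ((r - s) • ξ) ∘
          chartShift h.complete x₀ (s • ξ) := by
        funext z
        rw [comp_apply, ← chartShift_add_smul h, sub_add_cancel]
      rw [this]
      exact h3.comp z₀ h4
    have e1 := (hlin.prodMk_nhds (tendsto_const_nhds
      (x := chartShift h.complete x₀ (t • ξ) z₀))).eventually h2
    have e2 := (hlin'.prodMk_nhds hcur).eventually h2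
    filter_upwards [e1, e2] with s hs1 hs2
    exact ⟨step s t hs2, step t s hs1⟩

/-- The shift is smooth in the covector and the point jointly, since `s_ξ = s_{ξ - ξ₀} ∘ s_{ξ₀}`
where `ξ - ξ₀` is small. -/
theorem contMDiffAt_chartShift (h : IsAlmostLagrangianFibration pr η) {x₀ : B} {z₀ : M}
    (hz₀ : pr z₀ ∈ (chartAt (Vec n) x₀).source) (ξ₀ : Cov n) :
    ContMDiffAt (𝓘(ℝ, Cov n).prod (𝓡 (2 * n))) (𝓡 (2 * n)) ∞
      (fun q : Cov n × M => chartShift h.complete x₀ q.1 q.2) (ξ₀, z₀) := by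
  have hw : pr (chartShift h.complete x₀ ξ₀ z₀) ∈ (chartAt (Vec n) x₀).source := by
    rwa [pr_chartShift h.complete]
  have h1 := (eventually_contMDiffAt_chartShift h hw).self_of_nhds
  have h2 : (fun q : Cov n × M => chartShift h.complete x₀ q.1 q.2) =
      (fun q : Cov n × M => chartShift h.complete x₀ q.1 q.2) ∘
        fun q : Cov n × M => (q.1 - ξ₀, chartShift h.complete x₀ ξ₀ q.2) := by
    funext q
    rw [comp_apply, ← chartShift_add h, add_sub_cancel]
  rw [h2]
  have h3 : ContMDiffAt (𝓘(ℝ, Cov n).prod (𝓡 (2 * n))) (𝓘(ℝ, Cov n).prod (𝓡 (2 * n))) ∞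
      (fun q : Cov n × M => (q.1 - ξ₀, chartShift h.complete x₀ ξ₀ q.2)) (ξ₀, z₀) := by
    have h4 : ContMDiffAt (𝓘(ℝ, Cov n).prod (𝓡 (2 * n))) 𝓘(ℝ, Cov n) ∞
        (fun q : Cov n × M => q.1 - ξ₀) (ξ₀, z₀) :=
      ContMDiffAt.sub (f := fun q : Cov n × M => q.1) (g := fun _ => ξ₀)
        contMDiffAt_fst contMDiffAt_const
    refine ContMDiffAt.prodMk h4 ?_
    have h5 : ContMDiffAt (𝓘(ℝ, Cov n).prod (𝓡 (2 * n))) (𝓡 (2 * n)) ∞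
        (fun q : Cov n × M => q.2) (ξ₀, z₀) := contMDiffAt_snd
    exact ContMDiffAt.comp (f := fun q : Cov n × M => q.2) (ξ₀, z₀)
      (contMDiffAt_chartShift_const h hz₀ ξ₀) h5
  refine ContMDiffAt.comp ((ξ₀, z₀) : Cov n × M) ?_ h3
  simpa using h1

/-- The covectors whose shift is the identity of the fibre. -/
def periodGroup (h : IsAlmostLagrangianFibration pr η) (x : B) :
    AddSubgroup (CotangentSpace n x) where
  carrier := {α | ∀ z : pr ⁻¹' {x}, timeShift h.complete α z = z}
  zero_mem' := fun z => timeShift_zero h z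
  add_mem' := fun {α β} hα hβ z => by rw [timeShift_add h, hα, hβ]
  neg_mem' := fun {α} hα z => by
    conv_lhs => rw [← hα z]
    rw [← timeShift_add h, add_neg_cancel, timeShift_zero h]

/-- The action of the quotient by the period group on a fibre. -/
@[reducible] def shiftAction (h : IsAlmostLagrangianFibration pr η) (x : B) :
    AddAction (CotangentSpace n x ⧸ periodGroup h x) (pr ⁻¹' {x}) where
  vadd q z := Quotient.liftOn' q (fun α => timeShift h.complete α z) fun α β hαβ => by
    rw [QuotientAddGroup.leftRel_apply] at hαβ
    have h1 : β = (-α + β) + α := by abel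
    rw [h1, timeShift_add h, hαβ z]
  zero_vadd z := timeShift_zero h z
  add_vadd q r z := by
    induction q using QuotientAddGroup.induction_on with | H α =>
    induction r using QuotientAddGroup.induction_on with | H β =>
    change timeShift h.complete (α + β) z = timeShift h.complete α (timeShift h.complete β z)
    rw [add_comm, timeShift_add h]

/-- The affine fibration corresponding to an almost Lagrangian fibration. -/
def inducedAffineFibration (h : IsAlmostLagrangianFibration pr η) :
    AffineFibration pr (periodGroup h) where
  fibration := h.fibration
  action := shiftAction h
  regular x z z' := by
    obtain ⟨α, hα⟩ := timeShift_transitive h z z'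
    refine ⟨QuotientAddGroup.mk α, hα, fun w hw => ?_⟩
    induction w using QuotientAddGroup.induction_on with | H β =>
    have hβ : timeShift h.complete β z = z' := hw
    refine QuotientAddGroup.eq.2 fun z'' => ?_
    obtain ⟨γ, rfl⟩ := timeShift_transitive h z z''
    rw [← timeShift_add h, show γ + (-β + α) = (α + -β) + γ by abel, timeShift_add h,
      timeShift_add h, hα, ← hβ, ← timeShift_add h β (-β), add_neg_cancel, timeShift_zero h]
  smooth := by
    intro q hmem
    obtain ⟨a₀, z₀⟩ := q
    have hx : a₀.proj ∈ (chartAt (Vec n) a₀.proj).source := mem_chart_source (Vec n) a₀.proj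
    have hmem' : pr z₀ = a₀.proj := hmem
    have h1 := (contMDiffWithinAt_cotangentBundle_iff (n := n) (B := B)
      (f := fun p : CotangentBundle n B × M => p.1) (y := (a₀, z₀))
      (I := ((𝓡 n).prod 𝓘(ℝ, EuclideanSpace ℝ (Fin n) →L[ℝ] ℝ)).prod (𝓡 (2 * n)))
      (s := {p | pr p.2 = p.1.proj}) hx).1 contMDiffWithinAt_fst
    have hsnd : ContMDiffWithinAt
        (((𝓡 n).prod 𝓘(ℝ, EuclideanSpace ℝ (Fin n) →L[ℝ] ℝ)).prod (𝓡 (2 * n)))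
        (𝓡 (2 * n)) ∞ (fun p : CotangentBundle n B × M => p.2)
        {p | pr p.2 = p.1.proj} (a₀, z₀) := contMDiffWithinAt_snd
    have h2 : ContMDiffWithinAt
        (((𝓡 n).prod 𝓘(ℝ, EuclideanSpace ℝ (Fin n) →L[ℝ] ℝ)).prod (𝓡 (2 * n)))
        (𝓘(ℝ, Cov n).prod (𝓡 (2 * n))) ∞
        (fun p : CotangentBundle n B × M => (components a₀.proj p.1.proj p.1.2, p.2))
        {p | pr p.2 = p.1.proj} (a₀, z₀) := h1.2.prodMk hsnd
    have h3 := (contMDiffAt_chartShift h (x₀ := a₀.proj) (z₀ := z₀) (by rwa [hmem'])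
      (components a₀.proj a₀.proj a₀.2)).comp_contMDiffWithinAt
        ((a₀, z₀) : CotangentBundle n B × M) h2
    have key : ∀ p : CotangentBundle n B × M, pr p.2 = p.1.proj →
        p.1.proj ∈ (chartAt (Vec n) a₀.proj).source →
        fibrewiseAct pr (periodGroup h) (shiftAction h) p.1 p.2 =
          chartShift h.complete a₀.proj (components a₀.proj p.1.proj p.1.2) p.2 := by
      rintro ⟨⟨x, α⟩, z⟩ hz hxs
      change pr z = x at hz
      subst hz
      rw [fibrewiseAct, dif_pos rfl]
      change (timeShift h.complete α ⟨z, rfl⟩ : M) = _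
      rw [chartShift]
      exact congrArg (fun β => (timeShift h.complete β ⟨z, rfl⟩ : M)) (cov_components hxs α).symm
    refine h3.congr_of_eventuallyEq ?_ (key _ hmem hx)
    have e1 : ∀ᶠ p : CotangentBundle n B × M in 𝓝[{p | pr p.2 = p.1.proj}] (a₀, z₀),
        p.1.proj ∈ (chartAt (Vec n) a₀.proj).source :=
      h1.1.continuousWithinAt.preimage_mem_nhdsWithin
        ((chartAt (Vec n) a₀.proj).open_source.mem_nhds hx)
    filter_upwards [e1, self_mem_nhdsWithin] with p hp1 hp2
    exact key p hp2 hp1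

theorem inducedAffineFibration_isInducedBy (h : IsAlmostLagrangianFibration pr η) :
    (inducedAffineFibration h).IsInducedBy η := fun _ α z =>
  isTimeOneShift_timeShift h.complete α z

end InducedAction

/-! ### Coordinates on an affine fibration given by the action -/

section OrbitMap

universe uM uB
variable {n : ℕ} {B : Type uB} [TopologicalSpace B] [ChartedSpace (EuclideanSpace ℝ (Fin n)) B]
  {M : Type uM} [TopologicalSpace M] [ChartedSpace (EuclideanSpace ℝ (Fin (2 * n))) M]
  {pr : M → B} {P : ∀ x : B, AddSubgroup (CotangentSpace n x)}

theorem eq_of_hasMFDerivAt_zero {m : ℕ} {N : Type*} [TopologicalSpace N]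
    [ChartedSpace (EuclideanSpace ℝ (Fin m)) N] [IsManifold (𝓡 m) ∞ N] {c : ℝ → N}
    (hc : ∀ t, HasMFDerivAt 𝓘(ℝ, ℝ) (𝓡 m) c t 0) (t : ℝ) : c t = c 0 := by
  have hloc : ∀ t, ∀ᶠ s in 𝓝 t, c s = c t := by
    intro t
    have hsrc : ∀ᶠ s in 𝓝 t, c s ∈ (extChartAt (𝓡 m) (c t)).source :=
      (hc t).continuousAt.preimage_mem_nhds (extChartAt_source_mem_nhds (c t))
    obtain ⟨ε, hε, hball⟩ := Metric.eventually_nhds_iff_ball.1 hsrc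
    have hder : ∀ s ∈ ball t ε, HasFDerivAt (extChartAt (𝓡 m) (c t) ∘ c)
        ((1 : ℝ →L[ℝ] ℝ).smulRight (0 : EuclideanSpace ℝ (Fin m))) s := by
      intro s hs
      have h1 : MDifferentiableAt (𝓡 m) 𝓘(ℝ, EuclideanSpace ℝ (Fin m))
          (extChartAt (𝓡 m) (c t)) (c s) := by
        have := IsManifold.of_le (I := 𝓡 m) (M := N) (m := 1) (n := ∞) (by simp)
        exact mdifferentiableAt_extChartAt (by simpa using hball s hs)
      have h2 := (h1.hasMFDerivAt.comp s (hc s)).hasFDerivAt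
      refine h2.congr_fderiv (ContinuousLinearMap.ext fun r => ?_)
      exact (map_zero (mfderiv (𝓡 m) 𝓘(ℝ, EuclideanSpace ℝ (Fin m))
        (extChartAt (𝓡 m) (c t)) (c s))).trans
        (smul_zero (A := EuclideanSpace ℝ (Fin m)) (M := ℝ) r).symm
    filter_upwards [ball_mem_nhds t hε] with s hs
    have h3 := eq_add_smul_of_hasFDerivAt hder hs
    rw [smul_zero, add_zero] at h3
    exact (extChartAt (𝓡 m) (c t)).injOn (hball s hs) (mem_extChartAt_source (c t)) h3
  refine forall_real_of_locally (Q := fun s => c s = c 0) (t₀ := 0) rfl (fun t => ?_) t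
  filter_upwards [hloc t] with s hs
  rw [hs]

/-- The groups `P x` contain no line. For the groups underlying an affine fibration this is enough
to make them discrete (see `AffineFibration.discreteTopology_periods`). -/
def HasNoLines (P : ∀ x : B, AddSubgroup (CotangentSpace n x)) : Prop :=
  ∀ (x : B) (α : CotangentSpace n x), (∀ t : ℝ, t • α ∈ P x) → α = 0

/-- A smooth local section of `pr` over an open set `U` contained in the chart around `x₀`. -/
structure IsSectionOver (pr : M → B) (x₀ : B) (U : Set B) (σ : B → M) : Prop where
  isOpen : IsOpen U
  subset : U ⊆ (chartAt (Vec n) x₀).source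
  smooth : ContMDiffOn (𝓡 n) (𝓡 (2 * n)) ∞ σ U
  pr_eq : ∀ x ∈ U, pr (σ x) = x

/-- The image of the part of `U` in the domain of the chart around `x₀`, in that chart. -/
def chartImage (x₀ : B) (U : Set B) : Set (Vec n) :=
  (extChartAt (𝓡 n) x₀).target ∩ (extChartAt (𝓡 n) x₀).symm ⁻¹' U

theorem isOpen_chartImage (x₀ : B) {U : Set B} (hU : IsOpen U) :
    IsOpen (chartImage (n := n) x₀ U) :=
  (continuousOn_extChartAt_symm x₀).isOpen_inter_preimage (isOpen_extChartAt_target x₀) hU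

theorem extChartAt_mem_chartImage {x₀ : B} {U : Set B} (hU : U ⊆ (chartAt (Vec n) x₀).source)
    {x : B} (hx : x ∈ U) : extChartAt (𝓡 n) x₀ x ∈ chartImage (n := n) x₀ U := by
  have hs : x ∈ (extChartAt (𝓡 n) x₀).source := by rw [extChartAt_source]; exact hU hx
  refine ⟨(extChartAt (𝓡 n) x₀).map_source hs, ?_⟩
  rwa [mem_preimage, (extChartAt (𝓡 n) x₀).left_inv hs]

theorem IsSmoothFibration.exists_isSectionOver (hf : IsSmoothFibration (n := n) pr) (z : M)
    {x₀ : B} (hz : pr z ∈ (chartAt (Vec n) x₀).source) :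
    ∃ (U : Set B) (σ : B → M), IsSectionOver (n := n) pr x₀ U σ ∧ pr z ∈ U ∧ σ (pr z) = z := by
  obtain ⟨U, σ, hU, hzU, hσ, hpr, hσz⟩ := hf.exists_section z
  exact ⟨U ∩ (chartAt (Vec n) x₀).source, σ, ⟨hU.inter (chartAt (Vec n) x₀).open_source,
    inter_subset_right, hσ.mono inter_subset_left, fun x hx => hpr x hx.1⟩, ⟨hzU, hz⟩, hσz⟩

theorem IsSmoothFibration.exists_pr_eq (hf : IsSmoothFibration (n := n) pr) (x : B) :
    ∃ z, pr z = x := by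
  obtain ⟨-, F, _, _, -, ⟨f₀⟩, he⟩ := hf
  obtain ⟨e, hxe, -⟩ := he x
  exact ⟨e.toOpenPartialHomeomorph.symm (x, f₀), e.proj_symm_apply (e.mem_target.2 hxe)⟩

theorem IsSmoothFibration.exists_isSectionOver_mem (hf : IsSmoothFibration (n := n) pr) (x : B) :
    ∃ (U : Set B) (σ : B → M), IsSectionOver (n := n) pr x U σ ∧ x ∈ U := by
  obtain ⟨z, rfl⟩ := hf.exists_pr_eq x
  obtain ⟨U, σ, hσ, hU, -⟩ := hf.exists_isSectionOver z (mem_chart_source _ _)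
  exact ⟨U, σ, hσ, hU⟩

variable [IsManifold (𝓡 n) ∞ B]

namespace AffineFibration

variable (A : AffineFibration pr P)

/-- The action of a covector on a point of the fibre. -/
def act {x : B} (α : CotangentSpace n x) (z : pr ⁻¹' {x}) : pr ⁻¹' {x} :=
  (A.action x).vadd (QuotientAddGroup.mk α) z

theorem act_zero {x : B} (z : pr ⁻¹' {x}) : A.act (0 : CotangentSpace n x) z = z :=
  (A.action x).zero_vadd z

theorem act_add {x : B} (α β : CotangentSpace n x) (z : pr ⁻¹' {x}) :
    A.act (α + β) z = A.act α (A.act β z) :=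
  (A.action x).add_vadd (QuotientAddGroup.mk α) (QuotientAddGroup.mk β) z

theorem act_eq_act_iff {x : B} {α β : CotangentSpace n x} {z : pr ⁻¹' {x}} :
    A.act α z = A.act β z ↔ β - α ∈ P x := by
  have key : A.act α z = A.act β z ↔
      (QuotientAddGroup.mk α : CotangentSpace n x ⧸ P x) = QuotientAddGroup.mk β :=
    ⟨fun h => (A.regular x z (A.act β z)).unique h rfl,
      fun h => congrArg (fun w => (A.action x).vadd w z) h⟩
  rw [key, QuotientAddGroup.eq, sub_eq_neg_add]

theorem exists_act_eq {x : B} (z z' : pr ⁻¹' {x}) : ∃ α : CotangentSpace n x, A.act α z = z' := by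
  obtain ⟨w, hw, -⟩ := A.regular x z z'
  induction w using QuotientAddGroup.induction_on with | H α => exact ⟨α, hw⟩

theorem fibrewiseAct_eq {x : B} (α : CotangentSpace n x) (z : pr ⁻¹' {x}) :
    fibrewiseAct pr P A.action ⟨x, α⟩ z = (A.act α z : M) := by
  rw [fibrewiseAct, dif_pos (show pr (z : M) = x from z.2)]
  rfl

/-- The action of the covector with components `ξ` in the chart around `x₀` (meaningful for points
over the domain of that chart). -/
def shift (x₀ : B) (ξ : Cov n) (z : M) : M := A.act (cov x₀ (pr z) ξ) ⟨z, rfl⟩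

theorem shift_eq (x₀ : B) (ξ : Cov n) {x : B} (z : pr ⁻¹' {x}) :
    A.shift x₀ ξ z = (A.act (cov x₀ x ξ) z : M) := by
  obtain ⟨z, hz⟩ := z
  have hz' : pr z = x := hz
  subst hz'
  rfl

theorem pr_shift (x₀ : B) (ξ : Cov n) (z : M) : pr (A.shift x₀ ξ z) = pr z :=
  (A.act (cov x₀ (pr z) ξ) ⟨z, rfl⟩).2

theorem shift_zero (x₀ : B) (z : M) : A.shift x₀ 0 z = z := by
  rw [shift, map_zero, act_zero]

theorem shift_add (x₀ : B) (ξ ζ : Cov n) (z : M) :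
    A.shift x₀ (ξ + ζ) z = A.shift x₀ ξ (A.shift x₀ ζ z) := by
  have : A.shift x₀ ξ (A.shift x₀ ζ z) = _ :=
    A.shift_eq x₀ ξ (A.act (cov x₀ (pr z) ζ) ⟨z, rfl⟩)
  rw [this, shift, map_add, act_add]

theorem shift_eq_shift_iff {x₀ : B} {ξ ζ : Cov n} {z : M} :
    A.shift x₀ ξ z = A.shift x₀ ζ z ↔ cov x₀ (pr z) (ζ - ξ) ∈ P (pr z) := by
  rw [map_sub, ← A.act_eq_act_iff (z := ⟨z, rfl⟩), ← Subtype.coe_inj]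
  rfl

theorem exists_shift_eq {x₀ : B} {z z' : M} (hz : pr z ∈ (chartAt (Vec n) x₀).source)
    (h : pr z' = pr z) : ∃ ξ : Cov n, A.shift x₀ ξ z = z' := by
  obtain ⟨α, hα⟩ := A.exists_act_eq (x := pr z) ⟨z, rfl⟩ ⟨z', h⟩
  refine ⟨components x₀ (pr z) α, ?_⟩
  rw [shift]
  exact (congrArg (fun β => (A.act β ⟨z, rfl⟩ : M)) (cov_components hz α)).trans
    (congrArg Subtype.val hα)

theorem contMDiffAt_shift [IsManifold (𝓡 (2 * n)) ∞ M] {x₀ : B} {z₀ : M}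
    (hz₀ : pr z₀ ∈ (chartAt (Vec n) x₀).source) (ξ₀ : Cov n) :
    ContMDiffAt (𝓘(ℝ, Cov n).prod (𝓡 (2 * n))) (𝓡 (2 * n)) ∞
      (fun q : Cov n × M => A.shift x₀ q.1 q.2) (ξ₀, z₀) := by
  have hsnd : ContMDiffAt (𝓘(ℝ, Cov n).prod (𝓡 (2 * n))) (𝓡 (2 * n)) ∞
      (fun q : Cov n × M => q.2) (ξ₀, z₀) := contMDiffAt_snd
  have hfst : ContMDiffAt (𝓘(ℝ, Cov n).prod (𝓡 (2 * n))) 𝓘(ℝ, Cov n) ∞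
      (fun q : Cov n × M => q.1) (ξ₀, z₀) := contMDiffAt_fst
  have hpr : ContMDiffAt (𝓘(ℝ, Cov n).prod (𝓡 (2 * n))) (𝓡 n) ∞
      (fun q : Cov n × M => pr q.2) (ξ₀, z₀) :=
    A.fibration.1.contMDiffAt.comp ((ξ₀, z₀) : Cov n × M) hsnd
  have hev : ∀ᶠ q : Cov n × M in 𝓝 (ξ₀, z₀), pr q.2 ∈ (chartAt (Vec n) x₀).source :=
    hpr.continuousAt.preimage_mem_nhds ((chartAt (Vec n) x₀).open_source.mem_nhds hz₀)
  have h1 : ContMDiffAt (𝓘(ℝ, Cov n).prod (𝓡 (2 * n)))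
      ((𝓡 n).prod 𝓘(ℝ, EuclideanSpace ℝ (Fin n) →L[ℝ] ℝ)) ∞
      (fun q : Cov n × M => (⟨pr q.2, cov x₀ (pr q.2) q.1⟩ : CotangentBundle n B)) (ξ₀, z₀) := by
    rw [← contMDiffWithinAt_univ]
    refine (contMDiffWithinAt_cotangentBundle_iff (x₀ := x₀) hz₀).2 ⟨?_, ?_⟩
    · exact hpr.contMDiffWithinAt
    · rw [contMDiffWithinAt_univ]
      refine hfst.congr_of_eventuallyEq ?_
      filter_upwards [hev] with q hq using components_cov hq q.1
  have h2 := h1.prodMk hsnd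
  have h3 := A.smooth (⟨pr z₀, cov x₀ (pr z₀) ξ₀⟩, z₀) rfl
  have h4 := ContMDiffWithinAt.comp_of_eq (s := univ) (x := ((ξ₀, z₀) : Cov n × M)) h3
    h2.contMDiffWithinAt (fun q _ => rfl) rfl
  rw [contMDiffWithinAt_univ] at h4
  refine h4.congr_of_eventuallyEq (Eventually.of_forall fun q => ?_)
  exact (A.fibrewiseAct_eq (cov x₀ (pr q.2) q.1) ⟨q.2, rfl⟩).symm

/-- The parametrization `(y, ξ) ↦ [ξ] ∘ σ (y)` of the total space obtained by moving a section `σ`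
by the action, where `y` is a point of the base and `ξ` a covector, both in the chart around `x₀`.
-/
def orbitMap (x₀ : B) (σ : B → M) (p : Vec n × Cov n) : M :=
  A.shift x₀ p.2 (σ ((extChartAt (𝓡 n) x₀).symm p.1))

variable {A} {x₀ : B} {U : Set B} {σ : B → M}

theorem pr_orbitMap (hσ : IsSectionOver (n := n) pr x₀ U σ) {p : Vec n × Cov n}
    (hp : p.1 ∈ chartImage x₀ U) : pr (A.orbitMap x₀ σ p) = (extChartAt (𝓡 n) x₀).symm p.1 := by
  exact (A.pr_shift x₀ p.2 _).trans (hσ.pr_eq _ hp.2)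

theorem extChartAt_pr_orbitMap (hσ : IsSectionOver (n := n) pr x₀ U σ) {p : Vec n × Cov n}
    (hp : p.1 ∈ chartImage x₀ U) : extChartAt (𝓡 n) x₀ (pr (A.orbitMap x₀ σ p)) = p.1 := by
  rw [pr_orbitMap hσ hp, (extChartAt (𝓡 n) x₀).right_inv hp.1]

theorem pr_orbitMap_mem (hσ : IsSectionOver (n := n) pr x₀ U σ) {p : Vec n × Cov n}
    (hp : p.1 ∈ chartImage x₀ U) : pr (A.orbitMap x₀ σ p) ∈ (chartAt (Vec n) x₀).source := by
  rw [pr_orbitMap hσ hp]; exact hσ.subset hp.2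

theorem orbitMap_add (x₀ : B) (σ : B → M) (y : Vec n) (ξ ζ : Cov n) :
    A.orbitMap x₀ σ (y, ξ + ζ) = A.shift x₀ ζ (A.orbitMap x₀ σ (y, ξ)) := by
  rw [orbitMap, add_comm, shift_add]; rfl

theorem orbitMap_eq_iff (hσ : IsSectionOver (n := n) pr x₀ U σ) {y : Vec n}
    (hy : y ∈ chartImage x₀ U) {ξ ζ : Cov n} : A.orbitMap x₀ σ (y, ξ) = A.orbitMap x₀ σ (y, ζ) ↔
      cov x₀ ((extChartAt (𝓡 n) x₀).symm y) (ζ - ξ) ∈ P ((extChartAt (𝓡 n) x₀).symm y) := by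
  rw [orbitMap, orbitMap, shift_eq_shift_iff]
  dsimp only
  rw [hσ.pr_eq _ hy.2]

theorem exists_orbitMap_eq (hσ : IsSectionOver (n := n) pr x₀ U σ) {z : M} (hz : pr z ∈ U) :
    ∃ ξ : Cov n, A.orbitMap x₀ σ (extChartAt (𝓡 n) x₀ (pr z), ξ) = z := by
  have hs : pr z ∈ (extChartAt (𝓡 n) x₀).source := by
    rw [extChartAt_source]; exact hσ.subset hz
  obtain ⟨ξ, hξ⟩ := A.exists_shift_eq (x₀ := x₀) (z := σ (pr z)) (z' := z)
    (by rw [hσ.pr_eq _ hz]; exact hσ.subset hz) (hσ.pr_eq _ hz).symm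
  refine ⟨ξ, ?_⟩
  rw [orbitMap]
  dsimp only
  rwa [(extChartAt (𝓡 n) x₀).left_inv hs]

variable [IsManifold (𝓡 (2 * n)) ∞ M]

theorem contMDiffAt_orbitMap (hσ : IsSectionOver (n := n) pr x₀ U σ) {p : Vec n × Cov n}
    (hp : p.1 ∈ chartImage x₀ U) :
    ContMDiffAt 𝓘(ℝ, Vec n × Cov n) (𝓡 (2 * n)) ∞ (A.orbitMap x₀ σ) p := by
  have h1 : ContMDiffAt 𝓘(ℝ, Vec n × Cov n) (𝓡 n) ∞
      (fun q : Vec n × Cov n => (extChartAt (𝓡 n) x₀).symm q.1) p :=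
    (contMDiffAt_extChartAt_symm_of_mem hp.1).comp p contDiff_fst.contMDiff.contMDiffAt
  have h2 : ContMDiffAt 𝓘(ℝ, Vec n × Cov n) (𝓡 (2 * n)) ∞
      (fun q : Vec n × Cov n => σ ((extChartAt (𝓡 n) x₀).symm q.1)) p :=
    (hσ.smooth.contMDiffAt (hσ.isOpen.mem_nhds hp.2)).comp p h1
  have h3 : ContMDiffAt 𝓘(ℝ, Vec n × Cov n) 𝓘(ℝ, Cov n) ∞
      (fun q : Vec n × Cov n => q.2) p := contDiff_snd.contMDiff.contMDiffAt
  have h4 := A.contMDiffAt_shift (x₀ := x₀) (z₀ := σ ((extChartAt (𝓡 n) x₀).symm p.1))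
    (by rw [hσ.pr_eq _ hp.2]; exact hσ.subset hp.2) p.2
  exact ContMDiffAt.comp p h4 (h3.prodMk h2)

theorem baseDeriv_orbitMap (hσ : IsSectionOver (n := n) pr x₀ U σ) {p : Vec n × Cov n}
    (hp : p.1 ∈ chartImage x₀ U) (v : Vec n × Cov n) :
    baseDeriv x₀ pr (A.orbitMap x₀ σ p)
      (mfderiv 𝓘(ℝ, Vec n × Cov n) (𝓡 (2 * n)) (A.orbitMap x₀ σ) p v) = v.1 := by
  rw [baseDeriv_mfderiv (f := Prod.fst) A.fibration.1
    ((contMDiffAt_orbitMap hσ hp).mdifferentiableAt (by simp)) (pr_orbitMap_mem hσ hp)]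
  · rw [fderiv_fst]; rfl
  · filter_upwards [((isOpen_chartImage x₀ hσ.isOpen).preimage continuous_fst).mem_nhds hp]
      with q hq using extChartAt_pr_orbitMap hσ hq

/-- The velocity of a line in the fibre direction. -/
theorem hasMFDerivAt_orbitMap_line (hσ : IsSectionOver (n := n) pr x₀ U σ) {y : Vec n}
    (hy : y ∈ chartImage x₀ U) (ξ a : Cov n) (t : ℝ) :
    HasMFDerivAt 𝓘(ℝ, ℝ) (𝓡 (2 * n)) (fun s : ℝ => A.orbitMap x₀ σ (y, ξ + s • a)) t
      ((1 : ℝ →L[ℝ] ℝ).smulRight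
        (mfderiv 𝓘(ℝ, Vec n × Cov n) (𝓡 (2 * n)) (A.orbitMap x₀ σ) (y, ξ + t • a)
          ((0, a) : Vec n × Cov n))) := by
  have h1 := ((contMDiffAt_orbitMap (A := A) hσ (p := (y, ξ + t • a)) hy).mdifferentiableAt
    (by simp)).hasMFDerivAt
  have h2 : HasFDerivAt (fun s : ℝ => ((y, ξ + s • a) : Vec n × Cov n))
      ((1 : ℝ →L[ℝ] ℝ).smulRight ((0, a) : Vec n × Cov n)) t := by
    have h3 : HasFDerivAt (fun s : ℝ => ξ + s • a) ((1 : ℝ →L[ℝ] ℝ).smulRight a) t :=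
      ((hasFDerivAt_id t).smul_const a).const_add ξ
    exact ((hasFDerivAt_const y t).prodMk h3).congr_fderiv (by ext <;> simp)
  have h4 := HasMFDerivAt.comp t h1 h2.hasMFDerivAt
  refine HasMFDerivAt.congr_mfderiv h4 (ContinuousLinearMap.ext fun (s : ℝ) => ?_)
  exact map_smul (mfderiv 𝓘(ℝ, Vec n × Cov n) (𝓡 (2 * n)) (A.orbitMap x₀ σ) (y, ξ + t • a)) s
    ((0, a) : Vec n × Cov n)

/-- If the derivative of `t ↦ [t a] ∘ z` is zero at time `0`, then it is zero at all times, so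
that the line spanned by `a` acts trivially. -/
theorem injective_mfderiv_orbitMap (hP : HasNoLines P) (hσ : IsSectionOver (n := n) pr x₀ U σ)
    {p : Vec n × Cov n} (hp : p.1 ∈ chartImage x₀ U) :
    Injective (mfderiv 𝓘(ℝ, Vec n × Cov n) (𝓡 (2 * n)) (A.orbitMap x₀ σ) p) := by
  refine (injective_iff_map_eq_zero _).2 fun v hv => ?_
  obtain ⟨y, ξ⟩ := p
  have hw : (v : Vec n × Cov n).1 = 0 := by
    rw [← baseDeriv_orbitMap (A := A) hσ hp v, hv, map_zero]
  obtain ⟨w, a⟩ := v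
  change w = 0 at hw
  subst hw
  have hv' : mfderiv 𝓘(ℝ, Vec n × Cov n) (𝓡 (2 * n)) (A.orbitMap x₀ σ) (y, ξ)
      ((0, a) : Vec n × Cov n) = 0 := hv
  suffices a = 0 by rw [this]; rfl
  have h0 : HasMFDerivAt 𝓘(ℝ, ℝ) (𝓡 (2 * n)) (fun s : ℝ => A.orbitMap x₀ σ (y, ξ + s • a)) 0
      0 := by
    refine HasMFDerivAt.congr_mfderiv (hasMFDerivAt_orbitMap_line (A := A) hσ hp ξ a 0)
      (ContinuousLinearMap.ext fun s => ?_)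
    change s • mfderiv 𝓘(ℝ, Vec n × Cov n) (𝓡 (2 * n)) (A.orbitMap x₀ σ)
      (y, ξ + (0 : ℝ) • a) ((0, a) : Vec n × Cov n) = (0 : EuclideanSpace ℝ (Fin (2 * n)))
    rw [zero_smul, add_zero]
    exact (congrArg (s • ·) hv').trans (smul_zero s)
  -- the velocity at time `t` is the image of the velocity at time `0` under a shift
  have hline : ∀ t : ℝ, HasMFDerivAt 𝓘(ℝ, ℝ) (𝓡 (2 * n))
      (fun s : ℝ => A.orbitMap x₀ σ (y, ξ + s • a)) t 0 := by
    intro t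
    have hz : pr (A.orbitMap x₀ σ (y, ξ)) ∈ (chartAt (Vec n) x₀).source :=
      pr_orbitMap_mem hσ (p := (y, ξ)) hp
    have h1 : ContMDiffAt (𝓡 (2 * n)) (𝓡 (2 * n)) ∞ (A.shift x₀ (t • a))
        (A.orbitMap x₀ σ (y, ξ)) :=
      ContMDiffAt.comp (f := fun z : M => (t • a, z)) (A.orbitMap x₀ σ (y, ξ))
        (A.contMDiffAt_shift hz (t • a)) (contMDiffAt_const.prodMk contMDiffAt_id)
    have h2 : HasMFDerivAt 𝓘(ℝ, ℝ) 𝓘(ℝ, ℝ) (fun s : ℝ => s - t) t (ContinuousLinearMap.id ℝ ℝ) :=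
      ((hasFDerivAt_id t).sub_const t).hasMFDerivAt
    have h3 : HasMFDerivAt 𝓘(ℝ, ℝ) (𝓡 (2 * n))
        (fun s : ℝ => A.orbitMap x₀ σ (y, ξ + s • a)) (t - t) 0 := by rwa [sub_self]
    have h4 := HasMFDerivAt.comp (f := fun s : ℝ => s - t) t h3 h2
    have h5 : HasMFDerivAt (𝓡 (2 * n)) (𝓡 (2 * n)) (A.shift x₀ (t • a))
        (((fun s : ℝ => A.orbitMap x₀ σ (y, ξ + s • a)) ∘ fun s : ℝ => s - t) t)
        (mfderiv (𝓡 (2 * n)) (𝓡 (2 * n)) (A.shift x₀ (t • a))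
          (((fun s : ℝ => A.orbitMap x₀ σ (y, ξ + s • a)) ∘ fun s : ℝ => s - t) t)) := by
      refine MDifferentiableAt.hasMFDerivAt ?_
      simp only [comp_apply, sub_self, zero_smul, add_zero]
      exact h1.mdifferentiableAt (by simp)
    have h6 := HasMFDerivAt.comp t h5 h4
    have h7 : (fun s : ℝ => A.orbitMap x₀ σ (y, ξ + s • a)) = A.shift x₀ (t • a) ∘
        (fun s : ℝ => A.orbitMap x₀ σ (y, ξ + s • a)) ∘ fun s : ℝ => s - t := by
      funext s
      simp only [comp_apply]
      rw [← orbitMap_add, add_assoc, ← add_smul, sub_add_cancel]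
    rw [h7]
    refine HasMFDerivAt.congr_mfderiv h6 (ContinuousLinearMap.ext fun s => ?_)
    exact (map_zero (mfderiv (𝓡 (2 * n)) (𝓡 (2 * n)) (A.shift x₀ (t • a)) _))
  have hx := hσ.subset hp.2
  have hconst : ∀ t : ℝ, t • cov x₀ ((extChartAt (𝓡 n) x₀).symm y) a ∈
      P ((extChartAt (𝓡 n) x₀).symm y) := by
    intro t
    have h1 := eq_of_hasMFDerivAt_zero hline t
    have h2 := (orbitMap_eq_iff hσ hp).1 h1.symm
    rw [zero_smul, add_zero, add_sub_cancel_left, map_smul] at h2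
    exact h2
  have h1 := congrArg (components x₀ _) (hP _ _ hconst)
  rwa [components_cov hx, map_zero] at h1

/-- The maps `orbitMap` are local diffeomorphisms: their local inverses are charts of the total
space. -/
theorem exists_orbitChart (hP : HasNoLines P) (hσ : IsSectionOver (n := n) pr x₀ U σ)
    {p : Vec n × Cov n} (hp : p.1 ∈ chartImage x₀ U) :
    ∃ χ : OpenPartialHomeomorph M (Vec n × Cov n), p ∈ χ.target ∧
      (∀ q ∈ χ.target, q.1 ∈ chartImage x₀ U) ∧ EqOn χ.symm (A.orbitMap x₀ σ) χ.target ∧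
      ContMDiffOn (𝓡 (2 * n)) 𝓘(ℝ, Vec n × Cov n) ∞ χ χ.source ∧
      ContMDiffOn 𝓘(ℝ, Vec n × Cov n) (𝓡 (2 * n)) ∞ χ.symm χ.target := by
  let Φ := A.orbitMap x₀ σ
  let ψ := chartAt (EuclideanSpace ℝ (Fin (2 * n))) (Φ p)
  let D : Set (Vec n × Cov n) := {q | q.1 ∈ chartImage x₀ U}
  have hD : IsOpen D := (isOpen_chartImage x₀ hσ.isOpen).preimage continuous_fst
  have hΦ : ContMDiffOn 𝓘(ℝ, Vec n × Cov n) (𝓡 (2 * n)) ∞ Φ D := fun q hq =>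
    (contMDiffAt_orbitMap hσ hq).contMDiffWithinAt
  let O : Set (Vec n × Cov n) := D ∩ Φ ⁻¹' ψ.source
  have hO : IsOpen O := hΦ.continuousOn.isOpen_inter_preimage hD ψ.open_source
  have hpO : p ∈ O := ⟨hp, mem_chart_source _ _⟩
  have hsm : ContDiffOn ℝ ∞ (extChartAt (𝓡 (2 * n)) (Φ p) ∘ Φ) O := by
    rw [← contMDiffOn_iff_contDiffOn]
    exact (contMDiffOn_extChartAt (n := ∞)).comp (hΦ.mono inter_subset_left) fun q hq => hq.2
  have hinj : Injective (fderiv ℝ (extChartAt (𝓡 (2 * n)) (Φ p) ∘ Φ) p) := by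
    have : IsManifold (𝓡 (2 * n)) 1 M := IsManifold.of_le (n := ∞) (by simp)
    have h1 : MDifferentiableAt (𝓡 (2 * n)) 𝓘(ℝ, EuclideanSpace ℝ (Fin (2 * n)))
        (extChartAt (𝓡 (2 * n)) (Φ p)) (Φ p) := mdifferentiableAt_extChartAt (mem_chart_source _ _)
    have h2 := mfderiv_comp p h1 ((contMDiffAt_orbitMap (A := A) hσ hp).mdifferentiableAt (by simp))
    rw [mfderiv_eq_fderiv] at h2
    intro v w hvw
    have h3 := (DFunLike.congr_fun h2 v).symm.trans (hvw.trans (DFunLike.congr_fun h2 w))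
    have h4 := mfderiv_symm_extChartAt_apply (n := 2 * n) (B := M) (x₀ := Φ p) (x := Φ p)
      (mem_chart_source _ _)
    have h5 := congrArg (fun u => (mfderiv 𝓘(ℝ, EuclideanSpace ℝ (Fin (2 * n))) (𝓡 (2 * n))
      (extChartAt (𝓡 (2 * n)) (Φ p)).symm (extChartAt (𝓡 (2 * n)) (Φ p) (Φ p)) u :
        EuclideanSpace ℝ (Fin (2 * n)))) h3
    refine injective_mfderiv_orbitMap (A := A) hP hσ hp ?_
    exact (h4 _).symm.trans (h5.trans (h4 _))
  have hdim : Module.finrank ℝ (Vec n × Cov n) =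
      Module.finrank ℝ (EuclideanSpace ℝ (Fin (2 * n))) := by
    rw [Module.finrank_prod, finrank_cov, finrank_euclideanSpace_fin, finrank_euclideanSpace_fin,
      two_mul]
  obtain ⟨e, hpe, heO, hcoe, hes⟩ := exists_smooth_localInverse hO hsm hpO hinj hdim
  have hval : ∀ q ∈ O, ψ (Φ q) = extChartAt (𝓡 (2 * n)) (Φ p) (Φ q) := fun q _ => by
    simp [ψ]
  have hsymm : ∀ u : EuclideanSpace ℝ (Fin (2 * n)),
      ψ.symm u = (extChartAt (𝓡 (2 * n)) (Φ p)).symm u := fun u => by simp [ψ]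
  have heq : ∀ q ∈ e.source, ψ.symm (e q) = Φ q := by
    intro q hq
    rw [hcoe, comp_apply, ← hval q (heO hq), ψ.left_inv (heO hq).2]
  have htgt : ∀ q ∈ e.source, e q ∈ ψ.target := by
    intro q hq
    rw [hcoe, comp_apply, ← hval q (heO hq)]
    exact ψ.map_source (heO hq).2
  refine ⟨ψ.trans e.symm, ?_, ?_, ?_, ?_, ?_⟩
  · simp only [OpenPartialHomeomorph.trans_target, OpenPartialHomeomorph.symm_target,
      OpenPartialHomeomorph.symm_symm]
    exact ⟨hpe, htgt p hpe⟩
  · rintro q ⟨hq, -⟩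
    exact (heO hq).1
  · rintro q ⟨hq, -⟩
    exact heq q hq
  · rw [OpenPartialHomeomorph.coe_trans]
    refine ContMDiffOn.comp (t := e.target) hes.contMDiffOn ?_ ?_
    · have h1 : ContMDiffOn (𝓡 (2 * n)) 𝓘(ℝ, EuclideanSpace ℝ (Fin (2 * n))) ∞
          (extChartAt (𝓡 (2 * n)) (Φ p)) ψ.source := contMDiffOn_extChartAt
      refine (h1.mono (fun z hz => hz.1)).congr fun z _ => ?_
      simp [ψ]
    · rintro z ⟨-, hz⟩
      exact hz
  · have hsub : (ψ.trans e.symm).target ⊆ D := fun q hq => (heO hq.1).1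
    exact (hΦ.mono hsub).congr fun q hq => heq q hq.1

end AffineFibration

end OrbitMap

/-! ### The fibres as quotients by the periods -/

section PeriodMaps

variable {V F : Type*} [NormedAddCommGroup V] [TopologicalSpace F]

/-- `p` identifies `F` with the quotient of `V` by a discrete subgroup. -/
structure IsPeriodMap (p : V → F) (Λ : AddSubgroup V) : Prop where
  isQuotientMap : Topology.IsQuotientMap p
  eq_iff : ∀ {v w : V}, p v = p w ↔ w - v ∈ Λ
  discrete : DiscreteTopology Λ

theorem IsPeriodMap.isCoveringMap {p : V → F} {Λ : AddSubgroup V} (hp : IsPeriodMap p Λ) :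
    IsCoveringMap p := by
  have : IsAddQuotientCoveringMap p Λ :=
    hp.isQuotientMap.isAddQuotientCoveringMap_of_addSubgroup Λ ⟨hp.discrete⟩
      (by intro v w; rw [← sub_eq_add_neg]; exact hp.eq_iff)
  exact this.isCoveringMap

theorem IsPeriodMap.apply_eq_apply_zero_iff {p : V → F} {Λ : AddSubgroup V}
    (hp : IsPeriodMap p Λ) {v : V} : p v = p 0 ↔ v ∈ Λ := by
  rw [eq_comm, hp.eq_iff, sub_zero]

theorem IsPeriodMap.apply_add {p : V → F} {Λ : AddSubgroup V}
    (hp : IsPeriodMap p Λ) {v a : V} (ha : a ∈ Λ) : p (v + a) = p v := by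
  rw [eq_comm, hp.eq_iff]; simpa using ha

/-- `b` is a basis of the abelian group `Λ`. -/
def IsGroupBasis {k : ℕ} (b : Fin k → V) (Λ : AddSubgroup V) : Prop :=
  LinearIndependent ℤ b ∧ AddSubgroup.closure (range b) = Λ

theorem IsGroupBasis.map {W : Type*} [NormedAddCommGroup W] {k : ℕ}
    {b : Fin k → V} {Λ : AddSubgroup V} (hb : IsGroupBasis b Λ) {H : Λ →+ W} (hH : Injective H)
    {c : Fin k → W} (hc : ∀ i (h : b i ∈ Λ), H ⟨b i, h⟩ = c i) : IsGroupBasis c H.range := by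
  have hmem : ∀ i, b i ∈ Λ := fun i => hb.2 ▸ AddSubgroup.subset_closure (mem_range_self i)
  let b' : Fin k → Λ := fun i => ⟨b i, hmem i⟩
  have h1 : LinearIndependent ℤ b' :=
    LinearIndependent.of_comp (Λ.subtype.toIntLinearMap) hb.1
  have h2 : AddSubgroup.closure (range b') = ⊤ := by
    apply AddSubgroup.map_injective Λ.subtype_injective
    rw [AddMonoidHom.map_closure, ← range_comp, ← AddMonoidHom.range_eq_map,
      AddSubgroup.range_subtype]
    exact hb.2
  have h3 : H ∘ b' = c := funext fun i => hc i (hmem i)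
  refine ⟨?_, ?_⟩
  · rw [← h3]
    exact h1.map' H.toIntLinearMap (LinearMap.ker_eq_bot.2 hH)
  · rw [← h3, range_comp, ← AddMonoidHom.map_closure, h2, AddMonoidHom.range_eq_map]

variable [NormedSpace ℝ V]

/-- Two presentations of a space as the quotient of a vector space by a discrete subgroup have
isomorphic groups: the isomorphism is a lift of one projection through the other one. -/
theorem IsPeriodMap.exists_lift {p q : V → F} {Λ Λ' : AddSubgroup V} (hp : IsPeriodMap p Λ)
    (hq : IsPeriodMap q Λ') (h0 : p 0 = q 0) :
    ∃ h : V → V, Continuous h ∧ h 0 = 0 ∧ (∀ v, q (h v) = p v) ∧ ∃ H : Λ →+ V,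
      (∀ a : Λ, H a = h a) ∧ Injective H ∧ H.range = Λ' := by
  have cp := hp.isCoveringMap
  have cq := hq.isCoveringMap
  obtain ⟨h, ⟨hh0, hh⟩, huniq⟩ := cq.existsUnique_continuousMap_lifts
    ⟨p, hp.isQuotientMap.continuous⟩ 0 0 h0.symm
  obtain ⟨k, ⟨hk0, hk⟩, -⟩ := cp.existsUnique_continuousMap_lifts
    ⟨q, hq.isQuotientMap.continuous⟩ 0 0 h0
  have hh' : ∀ v, q (h v) = p v := fun v => congrFun hh v
  have hk' : ∀ v, p (k v) = q v := fun v => congrFun hk v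
  have hkh : ∀ v, k (h v) = v := by
    have huniq := (cp.existsUnique_continuousMap_lifts
      ⟨p, hp.isQuotientMap.continuous⟩ 0 0 rfl).unique (y₁ := k.comp h)
      (y₂ := ContinuousMap.id V) ⟨by simp [hh0, hk0], by funext v; simp [hk', hh']⟩
      ⟨rfl, rfl⟩
    exact fun v => DFunLike.congr_fun huniq v
  have hhk : ∀ v, h (k v) = v := by
    have huniq := (cq.existsUnique_continuousMap_lifts
      ⟨q, hq.isQuotientMap.continuous⟩ 0 0 rfl).unique (y₁ := h.comp k)
      (y₂ := ContinuousMap.id V) ⟨by simp [hh0, hk0], by funext v; simp [hk', hh']⟩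
      ⟨rfl, rfl⟩
    exact fun v => DFunLike.congr_fun huniq v
  have hmem : ∀ a ∈ Λ, h a ∈ Λ' := fun a ha => by
    rw [← hq.apply_eq_apply_zero_iff, hh', ← h0]
    exact hp.apply_eq_apply_zero_iff.2 ha
  -- `v ↦ h (v + a) - h a` is another lift of `p`
  have hadd : ∀ a ∈ Λ, ∀ v, h (v + a) = h v + h a := by
    intro a ha v
    have := huniq (⟨fun v => h (v + a) - h a, by fun_prop⟩ : C(V, V)) ⟨by simp, by
      funext v
      change q (h (v + a) - h a) = p v
      rw [sub_eq_add_neg, hq.apply_add (neg_mem (hmem a ha)), hh', hp.apply_add ha]⟩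
    have := DFunLike.congr_fun this v
    exact sub_eq_iff_eq_add.1 this
  refine ⟨h, h.continuous, hh0, hh',
    { toFun := fun a => h a, map_zero' := hh0, map_add' := fun a b => hadd b b.2 a },
    fun _ => rfl, fun a b hab => ?_, ?_⟩
  · have : h a = h b := hab
    exact Subtype.ext (by rw [← hkh a, this, hkh])
  · ext v
    refine ⟨?_, fun hv => ?_⟩
    · rintro ⟨a, rfl⟩
      exact hmem a a.2
    · refine ⟨⟨k v, ?_⟩, hhk v⟩
      rw [← hp.apply_eq_apply_zero_iff, hk', h0]
      exact hq.apply_eq_apply_zero_iff.2 hv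

theorem exists_isGroupBasis [FiniteDimensional ℝ V] (Λ : AddSubgroup V) [DiscreteTopology Λ] :
    ∃ (k : ℕ) (b : Fin k → V), IsGroupBasis b Λ := by
  let L : Submodule ℤ V := AddSubgroup.toIntSubmodule Λ
  have : DiscreteTopology L := ‹DiscreteTopology Λ›
  let b := Module.finBasis ℤ L
  refine ⟨_, fun i => (b i : V), ?_, ?_⟩
  · exact b.linearIndependent.map' L.subtype (Submodule.ker_subtype L)
  · have h1 : Submodule.span ℤ (range fun i => (b i : V)) = L := by
      have : (range fun i => (b i : V)) = L.subtype '' range b := by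
        rw [← range_comp]; rfl
      rw [this, ← Submodule.map_span, b.span_eq, Submodule.map_top, Submodule.range_subtype]
    have h2 := congrArg Submodule.toAddSubgroup h1
    rw [Submodule.span_int_eq_addSubgroupClosure] at h2
    exact h2

/-- A basis of a discrete subgroup of a vector space is linearly independent over the reals. -/
theorem IsGroupBasis.linearIndependent [FiniteDimensional ℝ V] {k : ℕ} {b : Fin k → V}
    {Λ : AddSubgroup V} (hb : IsGroupBasis b Λ) (hΛ : DiscreteTopology Λ) :
    LinearIndependent ℝ b := by
  have h1 : Submodule.span ℤ (range b) = AddSubgroup.toIntSubmodule Λ := by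
    apply (AddSubgroup.toIntSubmodule (M := V)).symm.injective
    rw [OrderIso.symm_apply_apply, ← hb.2]
    exact Submodule.span_int_eq_addSubgroupClosure _
  have h2 : DiscreteTopology (Submodule.span ℤ (range b)) := by rw [h1]; exact hΛ
  rw [linearIndependent_iff_card_eq_finrank_span, Real.finrank_eq_int_finrank_of_discrete h2]
  exact linearIndependent_iff_card_eq_finrank_span.1 hb.1

end PeriodMaps

section Lattice

universe uM uB
variable {n : ℕ} {B : Type uB} [TopologicalSpace B] [ChartedSpace (EuclideanSpace ℝ (Fin n)) B]
  {M : Type uM} [TopologicalSpace M] [ChartedSpace (EuclideanSpace ℝ (Fin (2 * n))) M]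
  {pr : M → B} {P : ∀ x : B, AddSubgroup (CotangentSpace n x)}

/-- The group `P x`, in components in the chart around `x₀`. -/
def periods (P : ∀ x : B, AddSubgroup (CotangentSpace n x)) (x₀ x : B) : AddSubgroup (Cov n) :=
  (P x).comap (cov x₀ x).toAddMonoidHom

variable [IsManifold (𝓡 n) ∞ B]

theorem map_cov_periods {x₀ x : B} (hx : x ∈ (chartAt (Vec n) x₀).source) :
    (periods P x₀ x).map (cov x₀ x).toAddMonoidHom = P x :=
  AddSubgroup.map_comap_eq_self_of_surjective
    (fun α => ⟨components x₀ x α, cov_components hx α⟩) _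

variable [IsManifold (𝓡 (2 * n)) ∞ M] {x₀ : B} {U : Set B} {σ : B → M}

namespace AffineFibration

/-- The period groups are discrete, since the parametrization by the action is locally injective. -/
theorem discreteTopology_periods (A : AffineFibration pr P) (hP : HasNoLines P)
    (hσ : IsSectionOver (n := n) pr x₀ U σ)
    {x : B} (hx : x ∈ U) : DiscreteTopology (periods P x₀ x) := by
  have hy := extChartAt_mem_chartImage (n := n) hσ.subset hx
  have hκ : (extChartAt (𝓡 n) x₀).symm (extChartAt (𝓡 n) x₀ x) = x :=
    (extChartAt (𝓡 n) x₀).left_inv (by rw [extChartAt_source]; exact hσ.subset hx)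
  obtain ⟨χ, hp, hD, hχ, -, -⟩ := exists_orbitChart (A := A) hP hσ
    (p := (extChartAt (𝓡 n) x₀ x, 0)) hy
  refine discreteTopology_of_isOpen_singleton_zero ?_
  have hc : Continuous fun a : periods P x₀ x => ((extChartAt (𝓡 n) x₀ x, (a : Cov n)) :
      Vec n × Cov n) := by fun_prop
  have hopen := χ.open_target.preimage hc
  convert hopen using 1
  ext a
  refine ⟨?_, fun ha => ?_⟩
  · rintro rfl
    exact hp
  · have h1 : A.orbitMap x₀ σ (extChartAt (𝓡 n) x₀ x, 0) =
        A.orbitMap x₀ σ (extChartAt (𝓡 n) x₀ x, (a : Cov n)) := by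
      rw [orbitMap_eq_iff hσ hy, sub_zero, hκ]
      exact a.2
    rw [← hχ hp, ← hχ ha] at h1
    have h2 := χ.symm.injOn hp ha h1
    exact Subtype.ext (congrArg Prod.snd h2).symm

/-- The fibres of an affine fibration, presented as quotients of the space of covectors by
identifying them with a fixed fibre `F` by a local trivialization `τ`. -/
theorem exists_periodMaps (A : AffineFibration pr P) (hP : HasNoLines P) :
    ∃ (F : Type uM) (_ : TopologicalSpace F) (f₀ : F), ∀ x₀ : B,
      ∃ (U : Set B) (σ : B → M) (τ : B × F → M) (p : B → Cov n → F),
        x₀ ∈ U ∧ IsSectionOver (n := n) pr x₀ U σ ∧ ContinuousOn τ (U ×ˢ univ) ∧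
        ∀ x ∈ U, IsPeriodMap (p x) (periods P x₀ x) ∧ p x 0 = f₀ ∧
          ∀ ξ, τ (x, p x ξ) = A.orbitMap x₀ σ (extChartAt (𝓡 n) x₀ x, ξ) := by
  obtain ⟨-, F, tF, cF, mF, ⟨f₀⟩, he⟩ := A.fibration
  refine ⟨F, tF, f₀, fun x₀ => ?_⟩
  obtain ⟨e, hx₀, he1, he2⟩ := he x₀
  let U := e.baseSet ∩ (chartAt (Vec n) x₀).source
  let σ : B → M := fun x => e.toOpenPartialHomeomorph.symm (x, f₀)
  have hσ : IsSectionOver (n := n) pr x₀ U σ := by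
    refine ⟨e.open_baseSet.inter (chartAt (Vec n) x₀).open_source, inter_subset_right, ?_, ?_⟩
    · exact he2.comp (contMDiffOn_id.prodMk contMDiffOn_const) fun x hx => e.mem_target.2 hx.1
    · exact fun x hx => e.proj_symm_apply (e.mem_target.2 hx.1)
  let p : B → Cov n → F := fun x ξ => (e (A.orbitMap x₀ σ (extChartAt (𝓡 n) x₀ x, ξ))).2
  refine ⟨U, σ, e.toOpenPartialHomeomorph.symm, p, ⟨hx₀, mem_chart_source _ _⟩, hσ, ?_, ?_⟩
  · exact e.toOpenPartialHomeomorph.symm.continuousOn.mono fun q hq => e.mem_target.2 hq.1.1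
  intro x hx
  have hy := extChartAt_mem_chartImage (n := n) hσ.subset hx
  have hκ : (extChartAt (𝓡 n) x₀).symm (extChartAt (𝓡 n) x₀ x) = x :=
    (extChartAt (𝓡 n) x₀).left_inv (by rw [extChartAt_source]; exact hx.2)
  have hpr : ∀ ξ, pr (A.orbitMap x₀ σ (extChartAt (𝓡 n) x₀ x, ξ)) = x := fun ξ =>
    (pr_orbitMap hσ hy).trans hκ
  have hsrc : ∀ ξ, A.orbitMap x₀ σ (extChartAt (𝓡 n) x₀ x, ξ) ∈ e.source := fun ξ => by
    rw [e.mem_source, hpr]; exact hx.1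
  have hτ : ∀ ξ, e.toOpenPartialHomeomorph.symm (x, p x ξ) =
      A.orbitMap x₀ σ (extChartAt (𝓡 n) x₀ x, ξ) := by
    intro ξ
    have h1 : (x, p x ξ) = e (A.orbitMap x₀ σ (extChartAt (𝓡 n) x₀ x, ξ)) :=
      Prod.ext (by rw [e.coe_fst (hsrc ξ), hpr]) rfl
    rw [h1]
    exact e.toOpenPartialHomeomorph.left_inv (hsrc ξ)
  have hcont : Continuous (p x) := by
    refine continuous_iff_continuousAt.2 fun ξ => ?_
    have h1 : ContinuousAt (fun ξ : Cov n => A.orbitMap x₀ σ (extChartAt (𝓡 n) x₀ x, ξ)) ξ :=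
      ContinuousAt.comp (contMDiffAt_orbitMap (A := A) hσ
        (p := (extChartAt (𝓡 n) x₀ x, ξ)) hy).continuousAt (by fun_prop)
    exact continuousAt_snd.comp (ContinuousAt.comp
      (e.toOpenPartialHomeomorph.continuousAt (hsrc ξ)) h1)
  have hopen : IsOpenMap (p x) := by
    refine isOpenMap_iff_nhds_le.2 fun ξ => ?_
    intro S hS
    obtain ⟨χ, hpt, hD, hχ, -, -⟩ := exists_orbitChart (A := A) hP hσ
      (p := (extChartAt (𝓡 n) x₀ x, ξ)) hy
    have h0 : χ.symm (extChartAt (𝓡 n) x₀ x, ξ) =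
        A.orbitMap x₀ σ (extChartAt (𝓡 n) x₀ x, ξ) := hχ hpt
    have hzs : A.orbitMap x₀ σ (extChartAt (𝓡 n) x₀ x, ξ) ∈ χ.source := by
      rw [← h0]; exact χ.map_target hpt
    have hz : χ (A.orbitMap x₀ σ (extChartAt (𝓡 n) x₀ x, ξ)) = (extChartAt (𝓡 n) x₀ x, ξ) := by
      rw [← h0, χ.right_inv hpt]
    -- `f ↦ τ (x, f)` followed by the orbit chart inverts `p x` near `ξ`
    have hc : ContinuousAt (fun f : F => e.toOpenPartialHomeomorph.symm (x, f)) (p x ξ) :=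
      ContinuousAt.comp (f := fun f : F => (x, f))
        (e.toOpenPartialHomeomorph.symm.continuousAt (e.mem_target.2 hx.1))
        (by fun_prop)
    have hc2 : ContinuousAt (fun f : F => (χ (e.toOpenPartialHomeomorph.symm (x, f))).2)
        (p x ξ) := by
      refine continuousAt_snd.comp (ContinuousAt.comp ?_ hc)
      rw [hτ]
      exact χ.continuousAt hzs
    have e1 : ∀ᶠ f in 𝓝 (p x ξ), e.toOpenPartialHomeomorph.symm (x, f) ∈ χ.source := by
      refine hc.preimage_mem_nhds (χ.open_source.mem_nhds ?_)
      rw [hτ]; exact hzs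
    have e2 : ∀ᶠ f in 𝓝 (p x ξ), (χ (e.toOpenPartialHomeomorph.symm (x, f))).2 ∈ p x ⁻¹' S := by
      refine hc2.preimage_mem_nhds ?_
      rw [hτ, hz]
      exact hS
    filter_upwards [e1, e2] with f hf1 hf2
    have hft : (x, f) ∈ e.target := e.mem_target.2 hx.1
    have h3 := hχ (χ.map_source hf1)
    rw [χ.left_inv hf1] at h3
    have h4 : (χ (e.toOpenPartialHomeomorph.symm (x, f))).1 = extChartAt (𝓡 n) x₀ x := by
      rw [← extChartAt_pr_orbitMap (A := A) hσ (hD _ (χ.map_source hf1)), ← h3]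
      exact congrArg _ (e.proj_symm_apply hft)
    have h5 : χ (e.toOpenPartialHomeomorph.symm (x, f)) =
        (extChartAt (𝓡 n) x₀ x, (χ (e.toOpenPartialHomeomorph.symm (x, f))).2) :=
      Prod.ext h4 rfl
    have h6 : p x (χ (e.toOpenPartialHomeomorph.symm (x, f))).2 = f := by
      change (e (A.orbitMap x₀ σ (_, _))).2 = f
      rw [← h5, ← h3]
      exact congrArg Prod.snd (e.toOpenPartialHomeomorph.right_inv hft)
    rw [← h6]
    exact hf2
  have hsurj : Surjective (p x) := by
    intro f
    have hft : (x, f) ∈ e.target := e.mem_target.2 hx.1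
    have hzx : pr (e.toOpenPartialHomeomorph.symm (x, f)) = x := e.proj_symm_apply hft
    obtain ⟨ξ, hξ⟩ := exists_orbitMap_eq (A := A) hσ
      (z := e.toOpenPartialHomeomorph.symm (x, f)) (by rw [hzx]; exact hx)
    rw [hzx] at hξ
    refine ⟨ξ, ?_⟩
    change (e (A.orbitMap x₀ σ (_, ξ))).2 = f
    rw [hξ]
    exact congrArg Prod.snd (e.toOpenPartialHomeomorph.right_inv hft)
  refine ⟨⟨hopen.isQuotientMap hcont hsurj, ?_, A.discreteTopology_periods hP hσ hx⟩, ?_, hτ⟩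
  · intro v w
    have h1 : p x v = p x w ↔ A.orbitMap x₀ σ (extChartAt (𝓡 n) x₀ x, v) =
        A.orbitMap x₀ σ (extChartAt (𝓡 n) x₀ x, w) := by
      refine ⟨fun h => ?_, fun h => congrArg (fun z => (e z).2) h⟩
      rw [← hτ, ← hτ, h]
    rw [h1, orbitMap_eq_iff hσ hy, hκ]
    rfl
  · change (e (A.shift x₀ 0 (σ ((extChartAt (𝓡 n) x₀).symm (extChartAt (𝓡 n) x₀ x))))).2 = f₀
    rw [A.shift_zero, hκ]
    exact congrArg Prod.snd (e.toOpenPartialHomeomorph.right_inv (e.mem_target.2 hx.1))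

end AffineFibration

end Lattice

/-! ### The lattice of periods and the normal form of the 2-form -/

section LatticeOfPeriods

universe uM uB
variable {n : ℕ} {B : Type uB} [TopologicalSpace B] [ChartedSpace (EuclideanSpace ℝ (Fin n)) B]
  {M : Type uM} [TopologicalSpace M] [ChartedSpace (EuclideanSpace ℝ (Fin (2 * n))) M]
  {pr : M → B} {P : ∀ x : B, AddSubgroup (CotangentSpace n x)}
  [IsManifold (𝓡 n) ∞ B]

theorem isSmoothCovectorFieldOn_cov {x₀ : B} {U : Set B} {γ : B → Cov n}
    (hU : U ⊆ (chartAt (Vec n) x₀).source) (hγ : ContMDiffOn (𝓡 n) 𝓘(ℝ, Cov n) ∞ γ U) :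
    IsSmoothCovectorFieldOn (fun x => cov x₀ x (γ x)) U := by
  intro x hx
  refine (contMDiffWithinAt_cotangentBundle_iff (x₀ := x₀) (hU hx)).2 ⟨contMDiffWithinAt_id, ?_⟩
  exact (hγ x hx).congr (fun y hy => components_cov (hU hy) _) (components_cov (hU hx) _)

variable [IsManifold (𝓡 (2 * n)) ∞ M] {x₀ : B} {U : Set B} {σ : B → M}

namespace AffineFibration

theorem isLocalHomeomorph_orbitMap (A : AffineFibration pr P) (hP : HasNoLines P)
    (hσ : IsSectionOver (n := n) pr x₀ U σ) :
    IsLocalHomeomorph fun q : {q : Vec n × Cov n // q.1 ∈ chartImage x₀ U} =>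
      A.orbitMap x₀ σ q := by
  have h1 : IsLocalHomeomorphOn (A.orbitMap x₀ σ) {q | q.1 ∈ chartImage x₀ U} := by
    refine IsLocalHomeomorphOn.mk _ _ fun q hq => ?_
    obtain ⟨χ, hp, -, hχ, -, -⟩ := exists_orbitChart (A := A) hP hσ hq
    exact ⟨χ.symm, hp, fun q hq => (hχ hq).symm⟩
  have h2 : IsOpen {q : Vec n × Cov n | q.1 ∈ chartImage x₀ U} :=
    (isOpen_chartImage x₀ hσ.isOpen).preimage continuous_fst
  have h3 := h2.isOpenEmbedding_subtypeVal.isLocalHomeomorph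
  rw [isLocalHomeomorph_iff_isLocalHomeomorphOn_univ] at h3 ⊢
  exact h1.comp h3 fun q _ => q.2

/-- The lifts `h x` identifying the period groups of nearby fibres depend continuously on the base
point `x`: along with `h x (t • a)`, `0 ≤ t ≤ 1`, they are the lift through the local homeomorphism
`orbitMap` of a map that is continuous in `t` and `x`. -/
theorem continuousOn_lift (A : AffineFibration pr P) (hP : HasNoLines P)
    (hσ : IsSectionOver (n := n) pr x₀ U σ) {F : Type*} [TopologicalSpace F]
    {τ : B × F → M} {q : Cov n → F} {h : B → Cov n → Cov n} (hq : Continuous q)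
    (hτ : ContinuousOn τ (U ×ˢ univ)) (hc : ∀ x ∈ U, Continuous (h x)) (h0 : ∀ x ∈ U, h x 0 = 0)
    (hh : ∀ x ∈ U, ∀ ξ, τ (x, q ξ) = A.orbitMap x₀ σ (extChartAt (𝓡 n) x₀ x, h x ξ))
    (a : Cov n) : ContinuousOn (fun x => h x a) U := by
  let E := {q : Vec n × Cov n // q.1 ∈ chartImage x₀ U}
  have hκ : Continuous fun x : U => extChartAt (𝓡 n) x₀ (x : B) :=
    (continuousOn_extChartAt x₀).comp_continuous continuous_subtype_val fun x => by
      rw [extChartAt_source]; exact hσ.subset x.2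
  let g : unitInterval × U → E := fun s => ⟨(extChartAt (𝓡 n) x₀ (s.2 : B), h s.2 ((s.1 : ℝ) • a)),
    extChartAt_mem_chartImage hσ.subset s.2.2⟩
  let f : C(unitInterval × U, M) := ⟨fun s => τ (s.2, q ((s.1 : ℝ) • a)),
    hτ.comp_continuous (by fun_prop) fun s => ⟨s.2.2, mem_univ _⟩⟩
  have hlift : Continuous g := by
    refine (A.isLocalHomeomorph_orbitMap hP hσ).continuous_lift (T2Space.isSeparatedMap _) f
      ?_ ?_ ?_
    · funext s
      exact (hh s.2 s.2.2 _).symm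
    · refine Continuous.subtype_mk (hκ.prodMk ?_) _
      have : (fun x : U => h x (((0 : unitInterval) : ℝ) • a)) = fun _ => 0 := by
        funext x
        rw [Icc.coe_zero, zero_smul, h0 x x.2]
      rw [this]
      exact continuous_const
    · intro x
      have h1 : Continuous fun t : unitInterval => h x ((t : ℝ) • a) :=
        (hc x x.2).comp (continuous_subtype_val.smul continuous_const)
      have h2 : Continuous fun t : unitInterval =>
          ((extChartAt (𝓡 n) x₀ (x : B), h x ((t : ℝ) • a)) : Vec n × Cov n) :=
        continuous_const.prodMk h1
      exact h2.subtype_mk _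
  rw [continuousOn_iff_continuous_domRestrict]
  have h1 : Continuous fun x : U => (Subtype.val (g (1, x))).2 :=
    continuous_snd.comp (continuous_subtype_val.comp
      (hlift.comp (continuous_const.prodMk continuous_id)))
  convert h1 using 1
  funext x
  simp [g]

/-- The period groups of an affine fibration form a lattice as soon as they contain no line. A
basis of one of them is carried to the nearby ones by the lifts of `IsPeriodMap.exists_lift`. It
varies smoothly, since its elements `ξ` are solutions of `[ξ] ∘ σ (x) = σ (x)`; its length is the
same for all fibres, even over a disconnected base, since they are all homeomorphic to the same
`F`. -/
theorem exists_isLattice (A : AffineFibration pr P) (hP : HasNoLines P) :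
    ∃ k, IsLattice k P := by
  rcases isEmpty_or_nonempty B with hB | ⟨⟨x₁⟩⟩
  · exact ⟨0, fun x => isEmptyElim x⟩
  obtain ⟨F, _, f₀, hF⟩ := A.exists_periodMaps hP
  obtain ⟨U₁, σ₁, τ₁, p₁, hx₁, hσ₁, -, hp₁⟩ := hF x₁
  obtain ⟨hpm₁, hp0₁, -⟩ := hp₁ x₁ hx₁
  have := hpm₁.discrete
  obtain ⟨k, b₁, hb₁⟩ := exists_isGroupBasis (periods P x₁ x₁)
  refine ⟨k, fun x₀ => ?_⟩
  obtain ⟨U, σ, τ, p, hx₀, hσ, hτ, hp⟩ := hF x₀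
  -- a basis of the period group at `x₀` of the same size as at `x₁`
  obtain ⟨b, hb⟩ : ∃ b : Fin k → Cov n, IsGroupBasis b (periods P x₀ x₀) := by
    obtain ⟨h, -, -, -, H, hH, hinj, hrange⟩ :=
      hpm₁.exists_lift (hp x₀ hx₀).1 (hp0₁.trans (hp x₀ hx₀).2.1.symm)
    exact ⟨fun i => h (b₁ i), hrange ▸ hb₁.map hinj fun i _ => hH _⟩
  have hlift := fun x hx => (hp x₀ hx₀).1.exists_lift (hp x hx).1
    ((hp x₀ hx₀).2.1.trans (hp x hx).2.1.symm)
  choose! h hc h0 hh H hH hinj hrange using hlift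
  have hbas : ∀ x ∈ U, IsGroupBasis (fun i => h x (b i)) (periods P x₀ x) := fun x hx =>
    hrange x hx ▸ hb.map (hinj x hx) fun i _ => hH x hx _
  have hbmem : ∀ x ∈ U, ∀ i, h x (b i) ∈ periods P x₀ x := fun x hx i => by
    rw [← (hbas x hx).2]; exact AddSubgroup.subset_closure (mem_range_self i)
  have hcont := A.continuousOn_lift hP hσ (hp x₀ hx₀).1.isQuotientMap.continuous hτ hc h0
    fun x hx ξ => by rw [← hh x hx ξ, (hp x hx).2.2]
  have hσ0 : ∀ x ∈ U, ∀ ξ ∈ periods P x₀ x,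
      A.orbitMap x₀ σ (extChartAt (𝓡 n) x₀ x, ξ) = σ x := by
    intro x hx ξ hξ
    have hκ : (extChartAt (𝓡 n) x₀).symm (extChartAt (𝓡 n) x₀ x) = x :=
      (extChartAt (𝓡 n) x₀).left_inv (by rw [extChartAt_source]; exact hσ.subset hx)
    have h1 : A.orbitMap x₀ σ (extChartAt (𝓡 n) x₀ x, 0) = σ x := by
      rw [orbitMap, A.shift_zero, hκ]
    rw [← h1, eq_comm, orbitMap_eq_iff hσ (extChartAt_mem_chartImage hσ.subset hx), hκ, sub_zero]
    exact hξ
  -- near `x₀` the transported basis elements are smooth functions of the base point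
  have hsmooth : ∀ i, ∃ W : Set B, IsOpen W ∧ x₀ ∈ W ∧ W ⊆ U ∧
      ContMDiffOn (𝓡 n) 𝓘(ℝ, Cov n) ∞ (fun x => h x (b i)) W := by
    intro i
    obtain ⟨χ, hpt, -, hχ, hχs, -⟩ := exists_orbitChart (A := A) hP hσ
      (p := (extChartAt (𝓡 n) x₀ x₀, h x₀ (b i)))
      (extChartAt_mem_chartImage hσ.subset hx₀)
    have hc1 : ContinuousOn (fun x => (extChartAt (𝓡 n) x₀ x, h x (b i))) U := by
      refine ContinuousOn.prodMk ((continuousOn_extChartAt x₀).mono fun x hx => ?_) (hcont (b i))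
      rw [extChartAt_source]; exact hσ.subset hx
    refine ⟨U ∩ (fun x => (extChartAt (𝓡 n) x₀ x, h x (b i))) ⁻¹' χ.target,
      hc1.isOpen_inter_preimage hσ.isOpen χ.open_target, ⟨hx₀, hpt⟩, inter_subset_left, ?_⟩
    have h1 : ∀ x ∈ U ∩ (fun x => (extChartAt (𝓡 n) x₀ x, h x (b i))) ⁻¹' χ.target,
        χ.symm (extChartAt (𝓡 n) x₀ x, h x (b i)) = σ x := fun x hx => by
      rw [hχ hx.2, hσ0 x hx.1 _ (hbmem x hx.1 i)]
    have h2 : ContMDiffOn (𝓡 n) 𝓘(ℝ, Cov n) ∞ (fun x => (χ (σ x)).2)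
        (U ∩ (fun x => (extChartAt (𝓡 n) x₀ x, h x (b i))) ⁻¹' χ.target) := by
      refine contDiff_snd.contMDiff.comp_contMDiffOn
        (hχs.comp (hσ.smooth.mono inter_subset_left) fun x hx => ?_)
      rw [mem_preimage, ← h1 x hx]
      exact χ.map_target hx.2
    refine h2.congr fun x hx => ?_
    rw [← h1 x hx, χ.right_inv hx.2]
  choose W hWo hxW hWU hWs using hsmooth
  have hVU : U ∩ ⋂ i, W i ⊆ (chartAt (Vec n) x₀).source := fun x hx => hσ.subset hx.1
  refine ⟨U ∩ ⋂ i, W i, hσ.isOpen.inter (isOpen_iInter_of_finite hWo),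
    ⟨hx₀, mem_iInter.2 hxW⟩, fun i x => cov x₀ x (h x (b i)), fun i => ?_, fun x hx => ⟨?_, ?_⟩⟩
  · exact isSmoothCovectorFieldOn_cov hVU ((hWs i).mono fun x hx => mem_iInter.1 hx.2 i)
  · have h1 := (hbas x hx.1).linearIndependent (hp x hx.1).1.discrete
    refine h1.map' (cov x₀ x) (LinearMap.ker_eq_bot.2 fun ξ ζ hξ => ?_)
    rw [← components_cov (hVU hx) ξ, hξ, components_cov (hVU hx)]
  · rw [← map_cov_periods (P := P) (hVU hx), ← (hbas x hx.1).2, AddMonoidHom.map_closure,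
      ← range_comp]
    rfl

end AffineFibration

end LatticeOfPeriods

section CovectorFields

variable {n : ℕ} {B : Type*} [TopologicalSpace B] [ChartedSpace (EuclideanSpace ℝ (Fin n)) B]
  {α : ∀ x : B, CotangentSpace n x} {W : Set B}

/-- The components of a covector field in the chart around `x₀`, as functions of the coordinates. -/
def localComponents (x₀ : B) (α : ∀ x : B, CotangentSpace n x) (y : Vec n) : Cov n :=
  components x₀ ((extChartAt (𝓡 n) x₀).symm y) (α ((extChartAt (𝓡 n) x₀).symm y))

theorem inChart_toForm {x₀ : B} {y : Vec n} (hy : y ∈ (extChartAt (𝓡 n) x₀).target) :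
    (toForm α).inChart x₀ y =
      ContinuousAlternatingMap.ofSubsingleton ℝ (Vec n) ℝ (0 : Fin 1) (localComponents x₀ α y) := by
  ext v
  change α _ (mfderiv 𝓘(ℝ, EuclideanSpace ℝ (Fin n)) (𝓡 n) (extChartAt (𝓡 n) x₀).symm y (v 0)) =
    components x₀ _ (α _) (v 0)
  rw [components_apply, (extChartAt (𝓡 n) x₀).right_inv hy]

theorem extDeriv_inChart_toForm {x₀ : B} {y : Vec n} (hy : y ∈ (extChartAt (𝓡 n) x₀).target)
    (h : ContDiffAt ℝ ∞ (localComponents x₀ α) y) (v w : Vec n) :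
    extDeriv ((toForm α).inChart x₀) y ![v, w] =
      fderiv ℝ (localComponents x₀ α) y v w - fderiv ℝ (localComponents x₀ α) y w v := by
  have hchart : (toForm α).inChart x₀ =ᶠ[𝓝 y] fun y =>
      ContinuousAlternatingMap.ofSubsingleton ℝ (Vec n) ℝ (0 : Fin 1) (localComponents x₀ α y) := by
    filter_upwards [(isOpen_extChartAt_target x₀).mem_nhds hy] with y hy using inChart_toForm hy
  have hdiff : DifferentiableAt ℝ (fun y =>
      ContinuousAlternatingMap.ofSubsingleton ℝ (Vec n) ℝ (0 : Fin 1) (localComponents x₀ α y))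
      y := by
    refine (contDiffAt_alternating_of_apply (r := ∞) fun u => ?_).differentiableAt (by simp)
    exact h.clm_apply contDiffAt_const
  have e1 : ∀ u u' : Vec n, fderiv ℝ (fun y =>
      ContinuousAlternatingMap.ofSubsingleton ℝ (Vec n) ℝ (0 : Fin 1) (localComponents x₀ α y)
        ![u]) y u' = fderiv ℝ (localComponents x₀ α) y u' u := by
    intro u u'
    change fderiv ℝ (fun y => localComponents x₀ α y u) y u' = _
    rw [fderiv_clm_apply (h.differentiableAt (by simp)) (differentiableAt_const u)]
    simp
  rw [hchart.extDeriv_eq, extDeriv_one_apply hdiff, e1, e1]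

variable [IsManifold (𝓡 n) ∞ B]

theorem contDiffAt_localComponents (hW : IsOpen W) (hα : IsSmoothCovectorFieldOn α W) {x₀ : B}
    {y : Vec n} (hy : y ∈ (extChartAt (𝓡 n) x₀).target)
    (hyW : (extChartAt (𝓡 n) x₀).symm y ∈ W) : ContDiffAt ℝ ∞ (localComponents x₀ α) y := by
  rw [← contMDiffAt_iff_contDiffAt]
  have hs : (extChartAt (𝓡 n) x₀).symm y ∈ (chartAt (Vec n) x₀).source := by
    rw [← extChartAt_source (𝓡 n)]
    exact (extChartAt (𝓡 n) x₀).map_target hy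
  have h1 := ((contMDiffWithinAt_cotangentBundle_iff (x₀ := x₀) hs).1
    (hα _ hyW)).2.contMDiffAt (hW.mem_nhds hyW)
  exact ContMDiffAt.comp y h1 (contMDiffAt_extChartAt_symm_of_mem hy)

/-- A 1-form is closed if its components have a symmetric derivative. -/
theorem d_toForm_eq_zero_of_symm (hW : IsOpen W) (hα : IsSmoothCovectorFieldOn α W) {x : B}
    (hx : x ∈ W) (h : ∀ v w, fderiv ℝ (localComponents x α) (extChartAt (𝓡 n) x x) v w =
      fderiv ℝ (localComponents x α) (extChartAt (𝓡 n) x x) w v) : (toForm α).d x = 0 := by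
  have hy := mem_extChartAt_target (I := 𝓡 n) x
  have hc := contDiffAt_localComponents hW hα hy (by rwa [extChartAt_to_inv])
  have hzero : extDeriv ((toForm α).inChart x) (extChartAt (𝓡 n) x x) = 0 := by
    refine two_ext fun v w => ?_
    rw [extDeriv_inChart_toForm hy hc, h, sub_self]
    rfl
  rw [Form.d]
  change (extDeriv ((toForm α).inChart x) (extChartAt (𝓡 n) x x)).compContinuousLinearMap _ = 0
  rw [hzero]
  rfl

/-- The components of a closed 1-form in any chart have a symmetric derivative. -/
theorem fderiv_localComponents_symm (hW : IsOpen W) (hα : IsSmoothCovectorFieldOn α W)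
    (hd : ∀ x ∈ W, (toForm α).d x = 0) {x₀ : B} {y : Vec n}
    (hy : y ∈ (extChartAt (𝓡 n) x₀).target) (hyW : (extChartAt (𝓡 n) x₀).symm y ∈ W)
    (v w : Vec n) :
    fderiv ℝ (localComponents x₀ α) y v w = fderiv ℝ (localComponents x₀ α) y w v := by
  obtain ⟨x, hx⟩ : ∃ x, (extChartAt (𝓡 n) x₀).symm y = x := ⟨_, rfl⟩
  have hsm : (toForm α).SmoothAt ((extChartAt (𝓡 n) x₀).symm y) := by
    rw [hx] at hyW ⊢
    have hy' := mem_extChartAt_target (I := 𝓡 n) x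
    have hc := contDiffAt_localComponents hW hα hy' (by rwa [extChartAt_to_inv])
    have h1 : ContDiffAt ℝ ∞ (fun y => ContinuousAlternatingMap.ofSubsingleton ℝ (Vec n) ℝ
        (0 : Fin 1) (localComponents x α y)) (extChartAt (𝓡 n) x x) :=
      contDiffAt_alternating_of_apply fun u => hc.clm_apply contDiffAt_const
    refine h1.congr_of_eventuallyEq ?_
    filter_upwards [(isOpen_extChartAt_target x).mem_nhds hy'] with y hy using inChart_toForm hy
  have h1 := extDeriv_pull hsm (contMDiffAt_extChartAt_symm_of_mem hy)
  have h2 := DFunLike.congr_fun h1 ![v, w]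
  rw [← Form.inChart_eq_pull,
    extDeriv_inChart_toForm hy (contDiffAt_localComponents hW hα hy hyW), Form.pull_apply,
    hd _ hyW] at h2
  exact sub_eq_zero.1 h2

end CovectorFields

section NormalForm

universe uM uB
variable {n : ℕ} {B : Type uB} [TopologicalSpace B] [ChartedSpace (EuclideanSpace ℝ (Fin n)) B]
  {M : Type uM} [TopologicalSpace M] [ChartedSpace (EuclideanSpace ℝ (Fin (2 * n))) M]
  {pr : M → B} {P : ∀ x : B, AddSubgroup (CotangentSpace n x)} {η : Form (2 * n) M 2}
  [IsManifold (𝓡 n) ∞ B]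

namespace AffineFibration

/-- Over `U` the action is given by the flows of the shiftings of `η`. -/
def IsGeneratedBy (A : AffineFibration pr P) (η : Form (2 * n) M 2) (U : Set B) : Prop :=
  ∀ x ∈ U, ∀ (α : CotangentSpace n x) (z : pr ⁻¹' {x}),
    IsShiftingTrajectory pr η α fun t => (A.act (t • α) z : M)

/-- `θ` vanishes if its first argument is tangent to a fibre over `U`. -/
def _root_.LagFib.Form.IsHorizontal {k : ℕ} (θ : Form (2 * n) M (k + 1)) (pr : M → B) (U : Set B) :
    Prop :=
  ∀ z, pr z ∈ U → ∀ v : Fin (k + 1) → TangentSpace (𝓡 (2 * n)) z,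
    mfderiv (𝓡 (2 * n)) (𝓡 n) pr z (v 0) = 0 → θ z v = 0

variable [IsManifold (𝓡 (2 * n)) ∞ M] {x₀ : B} {U : Set B} {σ : B → M}
  {A : AffineFibration pr P}

/-- A form generating the action has the canonical contractions with the vectors tangent to the
fibres. -/
theorem pull_orbitMap_vertical (hσ : IsSectionOver (n := n) pr x₀ U σ)
    (hη : A.IsGeneratedBy η U) {p : Vec n × Cov n} (hp : p.1 ∈ chartImage x₀ U) (a : Cov n)
    (v : Vec n × Cov n) : η.pull (A.orbitMap x₀ σ) p ![(0, a), v] = a v.1 := by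
  obtain ⟨y, ξ⟩ := p
  obtain ⟨x, hx⟩ : ∃ x, (extChartAt (𝓡 n) x₀).symm y = x := ⟨_, rfl⟩
  have hprz : pr (A.orbitMap x₀ σ (y, ξ)) = x := (pr_orbitMap hσ hp).trans hx
  have hγ := hη x (hx ▸ hp.2) (cov x₀ x a) ⟨A.orbitMap x₀ σ (y, ξ), hprz⟩
  have hγ' : (fun t : ℝ => (A.act (t • cov x₀ x a) ⟨A.orbitMap x₀ σ (y, ξ), hprz⟩ : M)) =
      fun t : ℝ => A.orbitMap x₀ σ (y, ξ + t • a) := by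
    funext t
    rw [orbitMap_add, ← map_smul]
    exact (A.shift_eq x₀ (t • a) ⟨A.orbitMap x₀ σ (y, ξ), hprz⟩).symm
  rw [hγ'] at hγ
  have key : ∀ t : ℝ, η.pull (A.orbitMap x₀ σ) (y, ξ + t • a) ![(0, a), v] = a v.1 := by
    intro t
    obtain ⟨hz, w, hw, hd⟩ := hγ t
    have h1 := hasMFDerivAt_unique hd (hasMFDerivAt_orbitMap_line (A := A) hσ hp ξ a t)
    have h2 := DFunLike.congr_fun h1 (1 : ℝ)
    have h3 : w = mfderiv 𝓘(ℝ, Vec n × Cov n) (𝓡 (2 * n)) (A.orbitMap x₀ σ) (y, ξ + t • a)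
        ((0, a) : Vec n × Cov n) :=
      (one_smul ℝ (w : EuclideanSpace ℝ (Fin (2 * n)))).symm.trans (h2.trans (one_smul ℝ _))
    have h4 := isShifting_cov_iff'.1 hw
      (mfderiv 𝓘(ℝ, Vec n × Cov n) (𝓡 (2 * n)) (A.orbitMap x₀ σ) (y, ξ + t • a) v)
    have h5 := baseDeriv_orbitMap (A := A) (p := (y, ξ + t • a)) hσ hp v
    rw [Form.pull_apply]
    refine Eq.trans ?_ (h4.trans (congrArg a h5))
    rw [h3]
    congr 1
    funext i
    fin_cases i <;> rfl
  simpa using key 0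

/-- In the coordinates given by the action, the 2-form is the canonical one plus a form on the base.
The action prescribes the contractions of `η` with the vectors tangent to the fibres; the rest is
constant along the fibres since so is its derivative, `dη` being horizontal. -/
theorem pull_orbitMap_eq (hσ : IsSectionOver (n := n) pr x₀ U σ)
    (hη : A.IsGeneratedBy η U) (hs : ∀ z, pr z ∈ U → η.SmoothAt z)
    (hd : η.d.IsHorizontal pr U) {y : Vec n} (hy : y ∈ chartImage x₀ U) (ξ : Cov n)
    (v w : Vec n × Cov n) :
    η.pull (A.orbitMap x₀ σ) (y, ξ) ![v, w] =
      v.2 w.1 - w.2 v.1 + η.pull (A.orbitMap x₀ σ) (y, 0) ![(v.1, 0), (w.1, 0)] := by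
  have hsm : ∀ ξ : Cov n, ContDiffAt ℝ ∞ (η.pull (A.orbitMap x₀ σ)) (y, ξ) := fun ξ =>
    Form.SmoothAt.pull (hs _ (by
      rw [pr_orbitMap (A := A) hσ (p := (y, ξ)) hy]; exact hy.2))
      (contMDiffAt_orbitMap (A := A) hσ hy)
  have hsm' : ∀ (ξ : Cov n) (b c : Vec n × Cov n), DifferentiableAt ℝ
      (fun q => η.pull (A.orbitMap x₀ σ) q ![b, c]) (y, ξ) := by
    intro ξ b c
    have := contDiffAt_alternating_apply (g := fun i _ => ![b, c] i) (hsm ξ)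
      fun i => contDiffAt_const
    exact this.differentiableAt (by simp)
  -- the coefficients are constant in the direction of the fibre
  have hder : ∀ (ξ a : Cov n) (b c : Vec n × Cov n),
      fderiv ℝ (fun q => η.pull (A.orbitMap x₀ σ) q ![b, c]) (y, ξ) (0, a) = 0 := by
    intro ξ a b c
    have h1 := extDeriv_two_apply ((hsm ξ).differentiableAt (by simp)) (0, a) b c
    have h2 : ∀ b : Vec n × Cov n, (fun q => η.pull (A.orbitMap x₀ σ) q ![(0, a), b])
        =ᶠ[𝓝 (y, ξ)] fun _ => a b.1 := by
      intro b
      filter_upwards [((isOpen_chartImage x₀ hσ.isOpen).preimage continuous_fst).mem_nhds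
        (show (y, ξ) ∈ Prod.fst ⁻¹' chartImage x₀ U from hy)] with q hq
      exact pull_orbitMap_vertical hσ hη hq a b
    rw [(h2 b).fderiv_eq, (h2 c).fderiv_eq, extDeriv_pull (hs _ (by
      rw [pr_orbitMap (A := A) hσ (p := (y, ξ)) hy]; exact hy.2))
      (contMDiffAt_orbitMap (A := A) hσ hy), Form.pull_apply, hd] at h1
    · simpa using h1.symm
    · rw [pr_orbitMap (A := A) hσ (p := (y, ξ)) hy]; exact hy.2
    · rw [← baseDeriv_eq_zero_iff (pr_orbitMap_mem (A := A) hσ (p := (y, ξ)) hy)]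
      exact baseDeriv_orbitMap (A := A) (p := (y, ξ)) hσ hy (0, a)
  have hconst : ∀ (b c : Vec n × Cov n), η.pull (A.orbitMap x₀ σ) (y, ξ) ![b, c] =
      η.pull (A.orbitMap x₀ σ) (y, 0) ![b, c] := by
    intro b c
    have hcomp : ∀ ζ : Cov n, HasFDerivAt
        (fun ζ : Cov n => η.pull (A.orbitMap x₀ σ) (y, ζ) ![b, c]) (0 : Cov n →L[ℝ] ℝ) ζ := by
      intro ζ
      have h0 : HasFDerivAt (fun ζ : Cov n => ((y, ζ) : Vec n × Cov n))
          (ContinuousLinearMap.inr ℝ (Vec n) (Cov n)) ζ := hasFDerivAt_prodMk_right y ζ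
      have h1 := HasFDerivAt.comp (f := fun ζ : Cov n => ((y, ζ) : Vec n × Cov n)) ζ
        (hsm' ζ b c).hasFDerivAt h0
      refine h1.congr_fderiv (ContinuousLinearMap.ext fun a => ?_)
      exact hder ζ a b c
    exact is_const_of_fderiv_eq_zero (𝕜 := ℝ)
      (f := fun ζ : Cov n => η.pull (A.orbitMap x₀ σ) (y, ζ) ![b, c])
      (fun ζ => (hcomp ζ).differentiableAt)
      (fun ζ => (hcomp ζ).fderiv) ξ 0
  obtain ⟨v, a⟩ := v
  obtain ⟨w, b⟩ := w
  have hva : ((v, a) : Vec n × Cov n) = (v, 0) + (0, a) := by simp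
  have hwb : ((w, b) : Vec n × Cov n) = (w, 0) + (0, b) := by simp
  have hp : ((y, ξ) : Vec n × Cov n).1 ∈ chartImage x₀ U := hy
  rw [hva, hwb, two_add_left, two_add_right, two_add_right, pull_orbitMap_vertical hσ hη hp,
    pull_orbitMap_vertical hσ hη hp, two_swap _ (0, b) (v, 0), pull_orbitMap_vertical hσ hη hp,
    hconst]
  simp
  ring

omit [IsManifold (𝓡 n) ∞ B] [IsManifold (𝓡 (2 * n)) ∞ M] in
theorem _root_.LagFib.pull_graph_apply (η : Form (2 * n) M 2) {Φ : Vec n × Cov n → M} {y : Vec n}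
    {γ : Vec n → Cov n} {γ' : Vec n →L[ℝ] Cov n}
    (hΦ : MDifferentiableAt 𝓘(ℝ, Vec n × Cov n) (𝓡 (2 * n)) Φ (y, γ y))
    (hγ : HasFDerivAt γ γ' y) (v w : Vec n) :
    η.pull (Φ ∘ fun y => (y, γ y)) y ![v, w] = η.pull Φ (y, γ y) ![(v, γ' v), (w, γ' w)] := by
  have h1 : HasFDerivAt (fun y => (y, γ y)) ((ContinuousLinearMap.id ℝ (Vec n)).prod γ') y :=
    (hasFDerivAt_id y).prodMk hγ
  rw [Form.pull_comp η (h := fun y => (y, γ y)) hΦ h1.differentiableAt, h1.fderiv,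
    ContinuousAlternatingMap.compContinuousLinearMap_apply]
  congr 1
  funext i
  fin_cases i <;> rfl

/-- Local sections of the period groups are closed 1-forms: in the normal form of `η` the
translation by a section `α` changes `η` by `dα`, but it is the identity. -/
theorem isClosed_section (hη : A.IsGeneratedBy η univ) (hs : η.IsSmooth)
    (hd : η.d.IsHorizontal pr univ) {W : Set B} (hW : IsOpen W) {α : ∀ x : B, CotangentSpace n x}
    (hα : IsSmoothCovectorFieldOn α W) (hαP : ∀ x ∈ W, α x ∈ P x) {x : B} (hx : x ∈ W) :
    (toForm α).d x = 0 := by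
  obtain ⟨U, σ, hσ, hxU⟩ := A.fibration.exists_isSectionOver_mem x
  have hU : A.IsGeneratedBy η U := fun x _ => hη x (mem_univ x)
  have hdU : η.d.IsHorizontal pr U := fun z _ => hd z (mem_univ _)
  let y₀ := extChartAt (𝓡 n) x x
  have hy₀ : y₀ ∈ chartImage (n := n) x (U ∩ W) :=
    extChartAt_mem_chartImage (n := n) (U := U ∩ W) (fun x hx => hσ.subset hx.1) ⟨hxU, hx⟩
  have hsub : ∀ y ∈ chartImage (n := n) x (U ∩ W), y ∈ chartImage x U := fun y hy => ⟨hy.1, hy.2.1⟩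
  have hγd := (contDiffAt_localComponents hW hα hy₀.1 hy₀.2.2).differentiableAt (n := ∞) (by simp)
  -- moving the section by the covector field does not change it
  have heq : (A.orbitMap x σ ∘ fun y => (y, localComponents x α y)) =ᶠ[𝓝 y₀]
      (A.orbitMap x σ ∘ fun y => (y, (0 : Cov n))) := by
    filter_upwards [(isOpen_chartImage (n := n) x (hσ.isOpen.inter hW)).mem_nhds hy₀] with y hy
    refine ((orbitMap_eq_iff (A := A) hσ (hsub y hy)).2 ?_).symm
    rw [sub_zero, localComponents, cov_components (hσ.subset hy.2.1)]
    exact hαP _ hy.2.2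
  refine d_toForm_eq_zero_of_symm hW hα hx fun v w => ?_
  have h1 := DFunLike.congr_fun (η.pull_congr heq).self_of_nhds ![v, w]
  have hΦ : ∀ ξ, MDifferentiableAt 𝓘(ℝ, Vec n × Cov n) (𝓡 (2 * n)) (A.orbitMap x σ) (y₀, ξ) :=
    fun ξ => (contMDiffAt_orbitMap (A := A) hσ (hsub _ hy₀)).mdifferentiableAt (by simp)
  rw [pull_graph_apply η (hΦ _) hγd.hasFDerivAt,
    pull_graph_apply η (hΦ _) (hasFDerivAt_const (0 : Cov n) y₀),
    pull_orbitMap_eq hσ hU (fun z _ => Form.isSmooth_iff.1 hs z) hdU (hsub _ hy₀)] at h1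
  simp only [zero_apply] at h1
  linarith

end AffineFibration

end NormalForm

/-! ### Forms coming from the base -/

section FormCalculus

variable {V : Type*} [NormedAddCommGroup V] [NormedSpace ℝ V] {k : ℕ}
  {m : ℕ} {M : Type*} [TopologicalSpace M] [ChartedSpace (EuclideanSpace ℝ (Fin m)) M]
  {m' : ℕ} {M' : Type*} [TopologicalSpace M'] [ChartedSpace (EuclideanSpace ℝ (Fin m')) M']

theorem Form.pull_pullback (θ : Form m' M' k) {f : M → M'} {g : V → M} {p : V}
    (hf : MDifferentiableAt (𝓡 m) (𝓡 m') f (g p)) (hg : MDifferentiableAt 𝓘(ℝ, V) (𝓡 m) g p) :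
    (Form.pullback f θ : Form m M k).pull g p = θ.pull (f ∘ g) p := by
  ext v
  rw [Form.pull_apply, Form.pull_apply]
  refine congrArg (θ (f (g p))) (funext fun i => ?_)
  exact (DFunLike.congr_fun (mfderiv_comp p hf hg) (v i)).symm

theorem contDiffAt_extDeriv {Ω : V → V [⋀^Fin k]→L[ℝ] ℝ} {p : V} (h : ContDiffAt ℝ ∞ Ω p) :
    ContDiffAt ℝ ∞ (extDeriv Ω) p :=
  (ContinuousAlternatingMap.alternatizeUncurryFinCLM ℝ V ℝ (n := k)).contDiff.contDiffAt.comp p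
    (h.fderiv_right (by simp))

theorem Form.IsSmooth.d [IsManifold (𝓡 m) ∞ M] {θ : Form m M k} (hθ : θ.IsSmooth) :
    θ.d.IsSmooth := by
  refine Form.isSmooth_iff.2 fun x => ?_
  have h1 : θ.d.inChart x =ᶠ[𝓝 (extChartAt (𝓡 m) x x)] extDeriv (θ.inChart x) := by
    filter_upwards [extChartAt_target_mem_nhds x] with y hy
    exact (extDeriv_pull (Form.isSmooth_iff.1 hθ _) (contMDiffAt_extChartAt_symm_of_mem hy)).symm
  exact (contDiffAt_extDeriv (Form.isSmooth_iff.1 hθ x)).congr_of_eventuallyEq h1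

end FormCalculus

section Descent

universe uM uB
variable {n : ℕ} {B : Type uB} [TopologicalSpace B] [ChartedSpace (EuclideanSpace ℝ (Fin n)) B]
  {M : Type uM} [TopologicalSpace M] [ChartedSpace (EuclideanSpace ℝ (Fin (2 * n))) M]
  {pr : M → B} {P : ∀ x : B, AddSubgroup (CotangentSpace n x)} {k : ℕ}
  [IsManifold (𝓡 n) ∞ B] [IsManifold (𝓡 (2 * n)) ∞ M]

/-- If the pullback of a form on the base under a fibration is smooth, then so is the form. -/
theorem IsSmoothFibration.isSmooth_of_pullback (hf : IsSmoothFibration (n := n) pr)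
    {φ : Form n B k} (hφ : (Form.pullback pr φ : Form (2 * n) M k).IsSmooth) : φ.IsSmooth := by
  refine Form.isSmooth_iff.2 fun x => ?_
  obtain ⟨U, σ, hσ, hxU⟩ := hf.exists_isSectionOver_mem x
  have hy := extChartAt_mem_chartImage (n := n) hσ.subset hxU
  have hg : ∀ y ∈ chartImage (n := n) x U, ContMDiffAt 𝓘(ℝ, Vec n) (𝓡 (2 * n)) ∞
      (σ ∘ (extChartAt (𝓡 n) x).symm) y := fun y hy =>
    (hσ.smooth.contMDiffAt (hσ.isOpen.mem_nhds hy.2)).comp y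
      (contMDiffAt_extChartAt_symm_of_mem hy.1)
  have h1 : ContDiffAt ℝ ∞ ((Form.pullback pr φ : Form (2 * n) M k).pull
      (σ ∘ (extChartAt (𝓡 n) x).symm)) (extChartAt (𝓡 n) x x) :=
    (Form.isSmooth_iff.1 hφ _).pull (hg _ hy)
  refine ContDiffAt.congr_of_eventuallyEq h1 ?_
  have hnhds := (isOpen_chartImage (n := n) x hσ.isOpen).mem_nhds hy
  have h2 : (extChartAt (𝓡 n) x).symm =ᶠ[𝓝 (extChartAt (𝓡 n) x x)]
      pr ∘ σ ∘ (extChartAt (𝓡 n) x).symm := by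
    filter_upwards [hnhds] with y hy
    exact (hσ.pr_eq _ hy.2).symm
  rw [Form.inChart_eq_pull]
  refine (Form.pull_congr φ h2).trans ?_
  filter_upwards [hnhds] with y hy
  exact (Form.pull_pullback φ (hf.1.contMDiffAt.mdifferentiableAt (by simp))
    ((hg y hy).mdifferentiableAt (by simp))).symm

namespace AffineFibration

variable {A : AffineFibration pr P} {x₀ : B} {U : Set B} {σ : B → M}

theorem bijective_mfderiv_orbitMap (hP : HasNoLines P) (hσ : IsSectionOver (n := n) pr x₀ U σ)
    {p : Vec n × Cov n} (hp : p.1 ∈ chartImage x₀ U) :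
    Bijective (mfderiv 𝓘(ℝ, Vec n × Cov n) (𝓡 (2 * n)) (A.orbitMap x₀ σ) p) := by
  have hinj := injective_mfderiv_orbitMap (A := A) hP hσ hp
  have hdim : Module.finrank ℝ (Vec n × Cov n) =
      Module.finrank ℝ (EuclideanSpace ℝ (Fin (2 * n))) := by
    rw [Module.finrank_prod, finrank_cov, finrank_euclideanSpace_fin, finrank_euclideanSpace_fin,
      two_mul]
  let f : (Vec n × Cov n) →ₗ[ℝ] EuclideanSpace ℝ (Fin (2 * n)) :=
    (mfderiv 𝓘(ℝ, Vec n × Cov n) (𝓡 (2 * n)) (A.orbitMap x₀ σ) p).toLinearMap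
  exact ⟨hinj, (LinearMap.injective_iff_surjective_of_finrank_eq_finrank (f := f) hdim).1 hinj⟩

/-- A form is basic if in the coordinates given by the action its coefficients do not depend on
the point of the fibre, and it vanishes on vectors tangent to the fibres. -/
theorem exists_eq_pullback (hP : HasNoLines P) {θ : Form (2 * n) M k} (hθ : θ.IsSmooth)
    (h : ∀ x : B, ∃ (x₀ : B) (U : Set B) (σ : B → M), x ∈ U ∧ IsSectionOver (n := n) pr x₀ U σ ∧
      ∀ y ∈ chartImage x₀ U, ∀ (ξ : Cov n) (v : Fin k → Vec n × Cov n),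
        θ.pull (A.orbitMap x₀ σ) (y, ξ) v =
          θ.pull (A.orbitMap x₀ σ) (y, 0) fun i => ((v i).1, 0)) :
    ∃ φ : Form n B k, φ.IsSmooth ∧ θ = Form.pullback pr φ := by
  have key : ∀ x : B, ∃ φ : (Vec n) [⋀^Fin k]→L[ℝ] ℝ, ∀ z : M, pr z = x →
      ∀ v : Fin k → TangentSpace (𝓡 (2 * n)) z, θ z v =
        φ fun i => (mfderiv (𝓡 (2 * n)) (𝓡 n) pr z (v i) : Vec n) := by
    intro x
    obtain ⟨x₀, U, σ, hx, hσ, hθU⟩ := h x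
    have hy := extChartAt_mem_chartImage (n := n) hσ.subset hx
    let κ' : Vec n →L[ℝ] Vec n := mfderiv (𝓡 n) 𝓘(ℝ, Vec n) (extChartAt (𝓡 n) x₀) x
    refine ⟨(θ.pull (A.orbitMap x₀ σ) (extChartAt (𝓡 n) x₀ x, 0)).compContinuousLinearMap
      ((ContinuousLinearMap.inl ℝ (Vec n) (Cov n)).comp κ'), fun z hz v => ?_⟩
    obtain ⟨ξ, hξ⟩ : ∃ ξ : Cov n, A.orbitMap x₀ σ (extChartAt (𝓡 n) x₀ x, ξ) = z := by
      subst hz; exact exists_orbitMap_eq (A := A) hσ hx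
    subst hξ
    have hsurj : ∀ i, ∃ w : Vec n × Cov n, mfderiv 𝓘(ℝ, Vec n × Cov n) (𝓡 (2 * n))
        (A.orbitMap x₀ σ) (extChartAt (𝓡 n) x₀ x, ξ) w = v i := fun i =>
      (bijective_mfderiv_orbitMap (A := A) hP hσ (p := (extChartAt (𝓡 n) x₀ x, ξ)) hy).2 (v i)
    choose w hw using hsurj
    have h1 : θ.pull (A.orbitMap x₀ σ) (extChartAt (𝓡 n) x₀ x, ξ) w =
        θ (A.orbitMap x₀ σ (extChartAt (𝓡 n) x₀ x, ξ)) v :=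
      (Form.pull_apply _ _ _ _).trans (congrArg _ (funext hw))
    have h2 : ∀ i, (w i).1 = κ' (mfderiv (𝓡 (2 * n)) (𝓡 n) pr
        (A.orbitMap x₀ σ (extChartAt (𝓡 n) x₀ x, ξ)) (v i) : Vec n) := by
      intro i
      have h3 := baseDeriv_orbitMap (A := A) (p := (extChartAt (𝓡 n) x₀ x, ξ)) hσ hy (w i)
      rw [hw] at h3
      rw [← h3]
      change (mfderiv (𝓡 n) 𝓘(ℝ, Vec n) (extChartAt (𝓡 n) x₀)
        (pr (A.orbitMap x₀ σ (extChartAt (𝓡 n) x₀ x, ξ))) : Vec n →L[ℝ] Vec n) _ = κ' _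
      rw [hz]
      rfl
    rw [← h1, hθU _ hy]
    refine congrArg (θ.pull (A.orbitMap x₀ σ) (extChartAt (𝓡 n) x₀ x, 0)) (funext fun i => ?_)
    exact Prod.ext (h2 i) rfl
  choose φ hφ using key
  have hpull : θ = Form.pullback pr (fun x => φ x : Form n B k) := by
    funext z
    ext v
    exact hφ (pr z) z rfl v
  exact ⟨fun x => φ x, A.fibration.isSmooth_of_pullback (hpull ▸ hθ), hpull⟩

end AffineFibration

end Descent

section SmoothForms

variable {m : ℕ} {M : Type*} [TopologicalSpace M] [ChartedSpace (EuclideanSpace ℝ (Fin m)) M]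
  {m' : ℕ} {M' : Type*} [TopologicalSpace M'] [ChartedSpace (EuclideanSpace ℝ (Fin m')) M'] {k : ℕ}

theorem Form.IsSmooth.sub {θ θ' : Form m M k} (h : θ.IsSmooth) (h' : θ'.IsSmooth) :
    Form.IsSmooth (θ - θ' : Form m M k) := fun x => (h x).sub (h' x)

theorem Form.IsSmooth.pullback [IsManifold (𝓡 m) ∞ M] [IsManifold (𝓡 m') ∞ M']
    {θ : Form m' M' k} (h : θ.IsSmooth) {f : M → M'} (hf : ContMDiff (𝓡 m) (𝓡 m') ∞ f) :
    (Form.pullback f θ : Form m M k).IsSmooth := by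
  refine Form.isSmooth_iff.2 fun x => ?_
  have hc := contMDiffAt_extChartAt_symm_of_mem (m := m) (mem_extChartAt_target (I := 𝓡 m) x)
  have h1 : ContDiffAt ℝ ∞ (θ.pull (f ∘ (extChartAt (𝓡 m) x).symm)) (extChartAt (𝓡 m) x x) :=
    (Form.isSmooth_iff.1 h _).pull (hf.contMDiffAt.comp _ hc)
  refine ContDiffAt.congr_of_eventuallyEq h1 ?_
  filter_upwards [extChartAt_target_mem_nhds x] with y hy
  exact Form.pull_pullback θ (hf.contMDiffAt.mdifferentiableAt (by simp))
    (mdifferentiableAt_extChartAt_symm hy)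

end SmoothForms

/-! ### The affine fibration of an almost Lagrangian fibration -/

section InducedFibration

universe uM uB
variable {n : ℕ} {B : Type uB} [TopologicalSpace B] [ChartedSpace (EuclideanSpace ℝ (Fin n)) B]

section Induced

variable {M : Type uM} [TopologicalSpace M] [ChartedSpace (EuclideanSpace ℝ (Fin (2 * n))) M]
  {pr : M → B} {η : Form (2 * n) M 2}

theorem IsAlmostLagrangianFibration.isHorizontal_d (h : IsAlmostLagrangianFibration pr η) :
    η.d.IsHorizontal pr univ := by
  obtain ⟨ψ, -, hψ⟩ := h.basic
  intro z _ v hv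
  rw [hψ]
  exact (ψ (pr z)).map_coord_zero 0 hv

variable [IsManifold (𝓡 n) ∞ B]
  {P : ∀ x : B, AddSubgroup (CotangentSpace n x)} {A : AffineFibration pr P}

theorem AffineFibration.act_eq_self_iff {x : B} {α : CotangentSpace n x} {z : pr ⁻¹' {x}} :
    A.act α z = z ↔ α ∈ P x := by
  have h := A.act_eq_act_iff (α := 0) (β := α) (z := z)
  rwa [A.act_zero, sub_zero, eq_comm] at h

/-- A covector `α` such that all `t • α` act trivially has the shifting zero. -/
theorem AffineFibration.hasNoLines (hA : A.IsGeneratedBy η univ) : HasNoLines P := by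
  intro x α hα
  obtain ⟨z, hz⟩ := A.fibration.exists_pr_eq x
  have hγ := hA x (mem_univ x) α ⟨z, hz⟩
  have hconst : (fun t : ℝ => (A.act (t • α) ⟨z, hz⟩ : M)) = fun _ => z := by
    funext t
    rw [AffineFibration.act_eq_self_iff.2 (hα t)]
  rw [hconst] at hγ
  obtain ⟨hz', v, hv, hd⟩ := hγ 0
  have h1 := hasMFDerivAt_unique hd (hasMFDerivAt_const z (0 : ℝ))
  have h2 : v = 0 :=
    (one_smul ℝ (v : EuclideanSpace ℝ (Fin (2 * n)))).symm.trans (DFunLike.congr_fun h1 (1 : ℝ))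
  have hx := mem_chart_source (Vec n) x
  have h3 : components x x α = 0 := by
    ext u
    obtain ⟨w, hw⟩ := baseDeriv_surjective A.fibration (x₀ := x) (z := z) (by rw [hz]; exact hx) u
    rw [← cov_components hx α] at hv
    rw [← hw, ← isShifting_cov_iff'.1 hv w, h2]
    exact (η z).map_coord_zero 0 rfl
  rw [← cov_components hx α, h3, map_zero]

variable [IsManifold (𝓡 (2 * n)) ∞ M] [T2Space M]

theorem AffineFibration.IsInducedBy.act_eq (hA : A.IsInducedBy η)
    (h : IsAlmostLagrangianFibration pr η) {x : B} (α : CotangentSpace n x) (z : pr ⁻¹' {x}) :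
    A.act α z = timeShift h.complete α z := by
  obtain ⟨γ, hγ, h0, h1⟩ := hA x α z
  have h2 := timeShift_smul_eq h hγ 0 1 z h0
  rw [one_smul, add_zero, h1] at h2
  exact Subtype.ext h2.symm

/-- The hypothesis on the time-one shifts determines the trajectories, by their uniqueness. -/
theorem AffineFibration.IsInducedBy.isGeneratedBy (hA : A.IsInducedBy η)
    (h : IsAlmostLagrangianFibration pr η) : A.IsGeneratedBy η univ := by
  intro x _ α z
  have h1 : (fun t : ℝ => (A.act (t • α) z : M)) =
      fun t => (timeShift h.complete (t • α) z : M) := by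
    funext t; rw [hA.act_eq h]
  rw [h1]
  exact isShiftingTrajectory_timeShift h α z

/-- The shifts of an almost Lagrangian fibration make it an affine fibration over the quotient by a
closed lattice. -/
theorem IsAlmostLagrangianFibration.exists_affineFibration
    (h : IsAlmostLagrangianFibration pr η) :
    ∃ (k : ℕ) (P : ∀ x : B, AddSubgroup (CotangentSpace n x)), IsClosedLattice k P ∧
      ∃ A : AffineFibration pr P, A.IsInducedBy η := by
  have hA := inducedAffineFibration_isInducedBy h
  have hg := hA.isGeneratedBy h
  have hP := AffineFibration.hasNoLines hg
  obtain ⟨k, hk⟩ := (inducedAffineFibration h).exists_isLattice hP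
  exact ⟨k, periodGroup h, ⟨hk, fun W hW α hα hαP x hx =>
    AffineFibration.isClosed_section hg h.smooth h.isHorizontal_d hW hα hαP hx⟩,
    inducedAffineFibration h, hA⟩

theorem AffineFibration.IsInducedBy.pull_orbitMap_eq (hA : A.IsInducedBy η)
    (h : IsAlmostLagrangianFibration pr η) {x₀ : B} {U : Set B} {σ : B → M}
    (hσ : IsSectionOver (n := n) pr x₀ U σ) {y : Vec n} (hy : y ∈ chartImage x₀ U) (ξ : Cov n)
    (v w : Vec n × Cov n) :
    η.pull (A.orbitMap x₀ σ) (y, ξ) ![v, w] =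
      v.2 w.1 - w.2 v.1 + η.pull (A.orbitMap x₀ σ) (y, 0) ![(v.1, 0), (w.1, 0)] :=
  AffineFibration.pull_orbitMap_eq hσ (fun x _ => hA.isGeneratedBy h x (mem_univ x))
    (fun z _ => Form.isSmooth_iff.1 h.smooth z) (fun z _ => h.isHorizontal_d z (mem_univ _))
    hy ξ v w

end Induced

section Equivalence

variable {M₁ : Type*} [TopologicalSpace M₁] [ChartedSpace (EuclideanSpace ℝ (Fin (2 * n))) M₁]
  {M₂ : Type*} [TopologicalSpace M₂] [ChartedSpace (EuclideanSpace ℝ (Fin (2 * n))) M₂]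
  [IsManifold (𝓡 n) ∞ B] [IsManifold (𝓡 (2 * n)) ∞ M₁] [IsManifold (𝓡 (2 * n)) ∞ M₂]
  {pr₁ : M₁ → B} {η₁ : Form (2 * n) M₁ 2} {pr₂ : M₂ → B} {η₂ : Form (2 * n) M₂ 2}

omit [IsManifold (𝓡 (2 * n)) ∞ M₁] [IsManifold (𝓡 (2 * n)) ∞ M₂] in
/-- A fibrewise diffeomorphism respecting the 2-forms up to a form on the base maps trajectories
of shiftings to trajectories of shiftings. -/
theorem IsShiftingTrajectory.comp_diffeomorph (h₁ : IsSmoothFibration (n := n) pr₁)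
    (h₂ : IsSmoothFibration (n := n) pr₂)
    {f : M₁ ≃ₘ^∞⟮𝓡 (2 * n), 𝓡 (2 * n)⟯ M₂} (hf : ∀ z, pr₂ (f z) = pr₁ z)
    {φ : Form n B 2} (hφ : Form.pullback f η₂ = η₁ + Form.pullback pr₁ φ)
    {x : B} {α : CotangentSpace n x} {γ : ℝ → M₁} (hγ : IsShiftingTrajectory pr₁ η₁ α γ) :
    IsShiftingTrajectory pr₂ η₂ α (f ∘ γ) := by
  obtain rfl : pr₁ = pr₂ ∘ f := funext fun z => (hf z).symm
  intro t
  obtain ⟨hz, v, hv, hd⟩ := hγ t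
  have hfd : MDifferentiableAt (𝓡 (2 * n)) (𝓡 (2 * n)) f (γ t) :=
    f.contMDiff.contMDiffAt.mdifferentiableAt (by simp)
  have hprd : MDifferentiableAt (𝓡 (2 * n)) (𝓡 n) pr₂ (f (γ t)) :=
    h₂.1.contMDiffAt.mdifferentiableAt (by simp)
  -- the velocity is tangent to the fibre
  have hv0 : mfderiv (𝓡 (2 * n)) (𝓡 n) (pr₂ ∘ f) (γ t) v = 0 := by
    have h3 := HasMFDerivAt.comp t
      (h₁.1.contMDiffAt.mdifferentiableAt (x := γ t) (by simp)).hasMFDerivAt hd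
    have h4 : (pr₂ ∘ f) ∘ γ = fun _ => x := funext fun s => hγ.pr_eq s
    rw [h4] at h3
    have h5 := DFunLike.congr_fun (hasMFDerivAt_unique h3 (hasMFDerivAt_const x t)) (1 : ℝ)
    refine Eq.trans ?_ h5
    exact congrArg (mfderiv (𝓡 (2 * n)) (𝓡 n) (pr₂ ∘ f) (γ t))
      (one_smul ℝ (v : EuclideanSpace ℝ (Fin (2 * n)))).symm
  have hx := mem_chart_source (Vec n) x
  refine ⟨hz, mfderiv (𝓡 (2 * n)) (𝓡 (2 * n)) f (γ t) v, ?_, ?_⟩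
  · rw [← cov_components hx α] at hv ⊢
    refine isShifting_cov_iff'.2 fun w => ?_
    obtain ⟨w', rfl⟩ : ∃ w', mfderiv (𝓡 (2 * n)) (𝓡 (2 * n)) f (γ t) w' = w :=
      (f.mfderivToContinuousLinearEquiv (by simp) (γ t)).surjective w
    have h6 := DFunLike.congr_fun (congrFun hφ (γ t)) ![v, w']
    have h7 : Form.pullback f η₂ (γ t) ![v, w'] = η₂ (f (γ t))
        ![mfderiv (𝓡 (2 * n)) (𝓡 (2 * n)) f (γ t) v,
          mfderiv (𝓡 (2 * n)) (𝓡 (2 * n)) f (γ t) w'] := by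
      refine congrArg (η₂ (f (γ t))) (funext fun i => ?_)
      fin_cases i <;> rfl
    have h8 : Form.pullback (m := 2 * n) (pr₂ ∘ f) φ (γ t) ![v, w'] = 0 :=
      (φ (pr₂ (f (γ t)))).map_coord_zero 0 hv0
    have h9 : η₁ (γ t) ![v, w'] = components x x α (baseDeriv x (pr₂ ∘ f) (γ t) w') :=
      isShifting_cov_iff'.1 hv w'
    have h10 : baseDeriv x (pr₂ ∘ f) (γ t) w' = baseDeriv x pr₂ (f (γ t))
        (mfderiv (𝓡 (2 * n)) (𝓡 (2 * n)) f (γ t) w') :=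
      congrArg (mfderiv (𝓡 n) 𝓘(ℝ, EuclideanSpace ℝ (Fin n)) (extChartAt (𝓡 n) x)
        (pr₂ (f (γ t)))) (DFunLike.congr_fun (mfderiv_comp (γ t) hprd hfd) w')
    refine h7.symm.trans (h6.trans ?_)
    change η₁ (γ t) ![v, w'] + Form.pullback (m := 2 * n) (pr₂ ∘ f) φ (γ t) ![v, w'] = _
    rw [h8, add_zero, h9, h10]
    rfl
  · refine HasMFDerivAt.congr_mfderiv (HasMFDerivAt.comp t hfd.hasMFDerivAt hd)
      (ContinuousLinearMap.ext fun (s : ℝ) => ?_)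
    exact map_smul (mfderiv (𝓡 (2 * n)) (𝓡 (2 * n)) f (γ t)) s v

variable [T2Space M₁] [T2Space M₂] {P₁ P₂ : ∀ x : B, AddSubgroup (CotangentSpace n x)}
  {A₁ : AffineFibration pr₁ P₁} {A₂ : AffineFibration pr₂ P₂}

/-- A Lagrangian equivalence up to a twisting preserves the trajectories of the shiftings, hence the
action and the periods. -/
theorem AffineFibration.equivalent_of_lagrangianEquivalent (h₁ : IsAlmostLagrangianFibration pr₁ η₁)
    (h₂ : IsAlmostLagrangianFibration pr₂ η₂) (hA₁ : A₁.IsInducedBy η₁) (hA₂ : A₂.IsInducedBy η₂)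
    (h : LagrangianEquivalentUpToTwisting pr₁ η₁ pr₂ η₂) : A₁.Equivalent A₂ := by
  obtain ⟨φ, -, f, hf, hφ⟩ := h
  have hf' : ∀ {x : B} (z : pr₁ ⁻¹' {x}), pr₂ (f z) = x := fun z => (hf z).trans z.2
  have hact : ∀ {x : B} (α : CotangentSpace n x) (z : pr₁ ⁻¹' {x}),
      f (A₁.act α z) = (A₂.act α ⟨f z, hf' z⟩ : M₂) := by
    intro x α z
    have t1 := (hA₁.isGeneratedBy h₁ x (mem_univ x) α z).comp_diffeomorph h₁.fibration
      h₂.fibration hf hφ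
    have t2 := hA₂.isGeneratedBy h₂ x (mem_univ x) α ⟨f z, hf' z⟩
    have h3 := congrFun (trajectory_unique h₂ t1 t2 (t₀ := 0)
      (by simp only [comp_apply, zero_smul, act_zero])) 1
    simpa only [comp_apply, one_smul] using h3
  refine ⟨?_, f, hf, ?_⟩
  · funext x
    ext α
    obtain ⟨z, hz⟩ := h₁.fibration.exists_pr_eq x
    rw [← A₁.act_eq_self_iff (z := ⟨z, hz⟩), ← A₂.act_eq_self_iff (z := ⟨f z, hf' ⟨z, hz⟩⟩),
      ← Subtype.coe_inj, ← Subtype.coe_inj, ← hact α ⟨z, hz⟩]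
    exact f.injective.eq_iff.symm
  · rintro ⟨x, α⟩ z hz
    have e1 := A₁.fibrewiseAct_eq α ⟨z, hz⟩
    have e2 := A₂.fibrewiseAct_eq α ⟨f z, hf' ⟨z, hz⟩⟩
    exact (congrArg f e1).trans ((hact α ⟨z, hz⟩).trans e2.symm)

/-- An equivalence of the affine fibrations takes the coordinates given by the action to each
other, so that both 2-forms have the same canonical part there and differ by a form on the base.
-/
theorem AffineFibration.Equivalent.lagrangianEquivalent (h₁ : IsAlmostLagrangianFibration pr₁ η₁)
    (h₂ : IsAlmostLagrangianFibration pr₂ η₂) (hA₁ : A₁.IsInducedBy η₁) (hA₂ : A₂.IsInducedBy η₂)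
    (h : A₁.Equivalent A₂) : LagrangianEquivalentUpToTwisting pr₁ η₁ pr₂ η₂ := by
  obtain ⟨rfl, f, hf, hact⟩ := h
  have hP := AffineFibration.hasNoLines (hA₁.isGeneratedBy h₁)
  let θ : Form (2 * n) M₁ 2 := Form.pullback f η₂ - η₁
  have hθ : θ.IsSmooth := (h₂.smooth.pullback f.contMDiff).sub h₁.smooth
  obtain ⟨φ, hφ, hθφ⟩ := AffineFibration.exists_eq_pullback (A := A₁) hP hθ fun x => by
    obtain ⟨U, σ, hσ, hxU⟩ := h₁.fibration.exists_isSectionOver_mem x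
    refine ⟨x, U, σ, hxU, hσ, ?_⟩
    have hσ₂ : IsSectionOver (n := n) pr₂ x U (f ∘ σ) :=
      ⟨hσ.isOpen, hσ.subset, f.contMDiff.comp_contMDiffOn hσ.smooth,
        fun x hx => (hf _).trans (hσ.pr_eq x hx)⟩
    have hΦ : f ∘ A₁.orbitMap x σ = A₂.orbitMap x (f ∘ σ) := by
      funext p
      have e1 := hact ⟨pr₁ (σ ((extChartAt (𝓡 n) x).symm p.1)),
        cov x (pr₁ (σ ((extChartAt (𝓡 n) x).symm p.1))) p.2⟩ _ rfl
      have e2 := A₁.fibrewiseAct_eq (cov x (pr₁ (σ ((extChartAt (𝓡 n) x).symm p.1))) p.2)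
        ⟨σ ((extChartAt (𝓡 n) x).symm p.1), rfl⟩
      have e3 := A₂.fibrewiseAct_eq (cov x (pr₁ (σ ((extChartAt (𝓡 n) x).symm p.1))) p.2)
        ⟨f (σ ((extChartAt (𝓡 n) x).symm p.1)), hf _⟩
      exact (congrArg f e2).symm.trans (e1.trans (e3.trans (A₂.shift_eq x p.2
        ⟨f (σ ((extChartAt (𝓡 n) x).symm p.1)), hf _⟩).symm))
    have hpull : ∀ y ∈ chartImage x U, ∀ (ξ : Cov n) (v w : Vec n × Cov n),
        θ.pull (A₁.orbitMap x σ) (y, ξ) ![v, w] =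
          η₂.pull (A₂.orbitMap x (f ∘ σ)) (y, 0) ![(v.1, 0), (w.1, 0)] -
          η₁.pull (A₁.orbitMap x σ) (y, 0) ![(v.1, 0), (w.1, 0)] := by
      intro y hy ξ v w
      have e1 : θ.pull (A₁.orbitMap x σ) (y, ξ) ![v, w] =
          (Form.pullback f η₂ : Form (2 * n) M₁ 2).pull (A₁.orbitMap x σ) (y, ξ) ![v, w] -
          η₁.pull (A₁.orbitMap x σ) (y, ξ) ![v, w] := rfl
      rw [e1, Form.pull_pullback η₂ (f.contMDiff.contMDiffAt.mdifferentiableAt (by simp))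
        ((contMDiffAt_orbitMap (A := A₁) (p := (y, ξ)) hσ hy).mdifferentiableAt (by simp)), hΦ,
        hA₁.pull_orbitMap_eq h₁ hσ hy, hA₂.pull_orbitMap_eq h₂ hσ₂ hy]
      ring
    intro y hy ξ v
    have hv : ∀ v : Fin 2 → Vec n × Cov n, v = ![v 0, v 1] := fun v => by
      funext i; fin_cases i <;> rfl
    rw [hv v, hpull y hy, hv fun i => (((![v 0, v 1] i).1, 0) : Vec n × Cov n), hpull y hy]
    rfl
  refine ⟨φ, hφ, f, hf, ?_⟩
  rw [← hθφ]
  exact (add_sub_cancel η₁ (Form.pullback f η₂)).symm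

end Equivalence

end InducedFibration

/-! ### The canonical form over small open sets -/

section IntegralSpan

variable {V : Type*} [AddCommGroup V] {k : ℕ} {v : Fin k → V} {w : V}

theorem mem_closure_range_iff :
    w ∈ AddSubgroup.closure (range v) ↔ ∃ c : Fin k → ℤ, ∑ i, c i • v i = w := by
  rw [← Submodule.span_int_eq_addSubgroupClosure, Submodule.mem_toAddSubgroup,
    Submodule.mem_span_range_iff_exists_fun]

theorem eq_zero_of_forall_smul_mem_closure_range [Module ℝ V] (hv : LinearIndependent ℝ v)
    (hw : ∀ t : ℝ, t • w ∈ AddSubgroup.closure (range v)) : w = 0 := by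
  simp only [mem_closure_range_iff] at hw
  choose c hc using hw
  -- the coefficients of `t • w` are integers and depend linearly on `t`
  have hlin : ∀ (t : ℝ) (i : Fin k), t * c 1 i = c t i := by
    intro t i
    have h1 : ∑ i, (t * c 1 i - c t i : ℝ) • v i = 0 := by
      simp only [sub_smul, mul_smul, Int.cast_smul_eq_zsmul, Finset.sum_sub_distrib,
        ← Finset.smul_sum]
      rw [hc, hc, one_smul, sub_self]
    exact sub_eq_zero.1 (Fintype.linearIndependent_iff.1 hv _ h1 i)
  have hzero : ∀ i, c 1 i = 0 := by
    intro i
    by_contra hne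
    have h1 := hlin (1 / (2 * c 1 i)) i
    have h2 : ((c 1 i : ℤ) : ℝ) ≠ 0 := Int.cast_ne_zero.2 hne
    have h3 : (2 * c (1 / (2 * c 1 i)) i : ℝ) = 1 := by rw [← h1]; field_simp
    have h4 : 2 * c (1 / (2 * c 1 i)) i = 1 := by exact_mod_cast h3
    omega
  rw [← one_smul ℝ w, ← hc 1]
  exact Finset.sum_eq_zero fun i _ => by rw [hzero, zero_smul]

end IntegralSpan

section Lattice

variable {n : ℕ} {B : Type*} [TopologicalSpace B] [ChartedSpace (EuclideanSpace ℝ (Fin n)) B]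
  [IsManifold (𝓡 n) ∞ B] {P : ∀ x : B, AddSubgroup (CotangentSpace n x)} {k : ℕ}

theorem IsLattice.hasNoLines (h : IsLattice k P) : HasNoLines P := by
  intro x β hβ
  obtain ⟨U, -, hxU, α, -, hα⟩ := h x
  obtain ⟨hli, hP⟩ := hα x hxU
  exact eq_zero_of_forall_smul_mem_closure_range hli fun t => hP ▸ hβ t

/-- Every element of a lattice extends to a smooth local section of the lattice. -/
theorem IsLattice.exists_section (h : IsLattice k P) {x : B} {β : CotangentSpace n x}
    (hβ : β ∈ P x) : ∃ (W : Set B) (α : ∀ x : B, CotangentSpace n x), IsOpen W ∧ x ∈ W ∧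
      IsSmoothCovectorFieldOn α W ∧ (∀ y ∈ W, α y ∈ P y) ∧ α x = β := by
  obtain ⟨W, hW, hxW, α, hα, hP⟩ := h x
  rw [(hP x hxW).2, mem_closure_range_iff] at hβ
  obtain ⟨c, hc⟩ := hβ
  refine ⟨W, fun y => ∑ i, c i • α i y, hW, hxW, fun y hy => ?_, fun y hy => ?_, hc⟩
  · have hs := mem_chart_source (EuclideanSpace ℝ (Fin n)) y
    refine (contMDiffWithinAt_cotangentBundle_iff (x₀ := y) hs).2 ⟨contMDiffWithinAt_id, ?_⟩
    simp only [map_sum, map_zsmul]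
    refine contMDiffWithinAt_finsetSum fun i _ => ?_
    have h1 := ((contMDiffWithinAt_cotangentBundle_iff (x₀ := y) hs).1 (hα i y hy)).2
    simp only [← Int.cast_smul_eq_zsmul ℝ]
    exact (contDiff_const_smul (c i : ℝ)).contMDiff.contMDiffAt.comp_contMDiffWithinAt y h1
  · rw [(hP y hy).2]
    exact mem_closure_range_iff.2 ⟨c, rfl⟩

end Lattice

section CanonicalForm

/-- The canonical 2-form `dξ ∧ dy` on the product of `ℝⁿ` with its dual. -/
def canonicalForm (n : ℕ) : (Vec n × Cov n) [⋀^Fin 2]→L[ℝ] ℝ :=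
  let f : (Vec n × Cov n) →ₗ[ℝ] (Vec n × Cov n) [⋀^Fin 1]→L[ℝ] ℝ :=
    { toFun := fun v => ContinuousAlternatingMap.ofSubsingleton ℝ (Vec n × Cov n) ℝ (0 : Fin 1)
        (v.2.comp (ContinuousLinearMap.fst ℝ (Vec n) (Cov n)))
      map_add' := fun _ _ => rfl
      map_smul' := fun _ _ => rfl }
  ContinuousAlternatingMap.alternatizeUncurryFin (LinearMap.toContinuousLinearMap f)

theorem canonicalForm_apply {n : ℕ} (v w : Vec n × Cov n) :
    canonicalForm n ![v, w] = v.2 w.1 - w.2 v.1 := by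
  rw [canonicalForm, ContinuousAlternatingMap.alternatizeUncurryFin_apply, Fin.sum_univ_two]
  simp only [Fin.val_zero, pow_zero, one_smul, Fin.val_one, pow_one, neg_smul]
  rfl

end CanonicalForm

section LocalForm

universe uM uB
variable {n : ℕ} {B : Type uB} [TopologicalSpace B] [ChartedSpace (EuclideanSpace ℝ (Fin n)) B]
  {M : Type uM} [TopologicalSpace M] [ChartedSpace (EuclideanSpace ℝ (Fin (2 * n))) M]
  {pr : M → B} {P : ∀ x : B, AddSubgroup (CotangentSpace n x)} {η : Form (2 * n) M 2}
  [IsManifold (𝓡 n) ∞ B] [IsManifold (𝓡 (2 * n)) ∞ M] {x₀ : B} {U : Set B} {σ : B → M}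
  {A : AffineFibration pr P} {k : ℕ}

namespace AffineFibration

/-- The form generates the action if its contractions with the vectors in the direction of the
fibres, in the coordinates given by the action, are the canonical ones. -/
theorem isGeneratedBy_of_pull_vertical (hP : HasNoLines P)
    (hσ : IsSectionOver (n := n) pr x₀ U σ)
    (h : ∀ p : Vec n × Cov n, p.1 ∈ chartImage x₀ U → ∀ (a : Cov n) (v : Vec n × Cov n),
      η.pull (A.orbitMap x₀ σ) p ![(0, a), v] = a v.1) : A.IsGeneratedBy η U := by
  intro x hx α z
  have hy := extChartAt_mem_chartImage (n := n) hσ.subset hx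
  obtain ⟨z, hz⟩ := z
  have hz' : pr z = x := hz
  obtain ⟨ξ, hξ⟩ : ∃ ξ : Cov n, A.orbitMap x₀ σ (extChartAt (𝓡 n) x₀ x, ξ) = z := by
    subst hz'; exact exists_orbitMap_eq (A := A) hσ hx
  rw [← cov_components (hσ.subset hx) α]
  set a := components x₀ x α
  have hγ : (fun t : ℝ => (A.act (t • cov x₀ x a) ⟨z, hz⟩ : M)) =
      fun t : ℝ => A.orbitMap x₀ σ (extChartAt (𝓡 n) x₀ x, ξ + t • a) := by
    funext t
    rw [orbitMap_add, ← map_smul, hξ]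
    exact (A.shift_eq x₀ (t • a) ⟨z, hz⟩).symm
  rw [hγ]
  intro t
  have hprt : pr (A.orbitMap x₀ σ (extChartAt (𝓡 n) x₀ x, ξ + t • a)) = x := by
    refine (pr_orbitMap (A := A) hσ (p := (extChartAt (𝓡 n) x₀ x, ξ + t • a)) hy).trans ?_
    exact (extChartAt (𝓡 n) x₀).left_inv (by rw [extChartAt_source]; exact hσ.subset hx)
  refine ⟨hprt, _, ?_, hasMFDerivAt_orbitMap_line (A := A) hσ hy ξ a t⟩
  refine isShifting_cov_iff'.2 fun w => ?_
  obtain ⟨w, rfl⟩ := (bijective_mfderiv_orbitMap (A := A) hP hσ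
    (p := (extChartAt (𝓡 n) x₀ x, ξ + t • a)) hy).2 w
  have h1 := baseDeriv_orbitMap (A := A) (p := (extChartAt (𝓡 n) x₀ x, ξ + t • a)) hσ hy w
  refine Eq.trans ?_ ((h (extChartAt (𝓡 n) x₀ x, ξ + t • a) hy a w).trans (congrArg a h1.symm))
  rw [Form.pull_apply]
  congr 1
  funext i
  fin_cases i <;> rfl

/-- If the lattice is closed, the canonical form is invariant under the changes of the coordinates
given by the action: these are the translations by closed 1-forms. -/
theorem canonicalForm_eq_of_orbitMap_eq (hP : IsClosedLattice k P)
    (hσ : IsSectionOver (n := n) pr x₀ U σ) {p q : Vec n × Cov n} (hp : p.1 ∈ chartImage x₀ U)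
    (hq : q.1 ∈ chartImage x₀ U) (hpq : A.orbitMap x₀ σ p = A.orbitMap x₀ σ q)
    {v w v' w' : Vec n × Cov n}
    (hv : (mfderiv 𝓘(ℝ, Vec n × Cov n) (𝓡 (2 * n)) (A.orbitMap x₀ σ) p v : Vec (2 * n)) =
      mfderiv 𝓘(ℝ, Vec n × Cov n) (𝓡 (2 * n)) (A.orbitMap x₀ σ) q v')
    (hw : (mfderiv 𝓘(ℝ, Vec n × Cov n) (𝓡 (2 * n)) (A.orbitMap x₀ σ) p w : Vec (2 * n)) =
      mfderiv 𝓘(ℝ, Vec n × Cov n) (𝓡 (2 * n)) (A.orbitMap x₀ σ) q w') :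
    canonicalForm n ![v, w] = canonicalForm n ![v', w'] := by
  obtain ⟨y, ξ⟩ := p
  obtain ⟨y', ζ⟩ := q
  obtain rfl : y = y' := by
    have h1 := extChartAt_pr_orbitMap (A := A) (p := (y, ξ)) hσ hp
    rw [hpq] at h1
    exact h1.symm.trans (extChartAt_pr_orbitMap (A := A) (p := (y', ζ)) hσ hq)
  change y ∈ chartImage x₀ U at hp
  -- the two points differ by an element of the lattice, which extends to a closed 1-form
  obtain ⟨W, α, hW, hxW, hα, hαP, hαx⟩ :=
    hP.isLattice.exists_section ((orbitMap_eq_iff (A := A) hσ hp).1 hpq)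
  have hγ := contDiffAt_localComponents hW hα hp.1 hxW
  have hγy : localComponents x₀ α y = ζ - ξ := by
    rw [localComponents, hαx, components_cov (hσ.subset hp.2)]
  let γ' : Vec n →L[ℝ] Cov n := fderiv ℝ (localComponents x₀ α) y
  have hsymm : ∀ u u', γ' u u' = γ' u' u :=
    fderiv_localComponents_symm hW hα (hP.closed W hW α hα hαP) hp.1 hxW
  let T : Vec n × Cov n → Vec n × Cov n := fun r => (r.1, r.2 + localComponents x₀ α r.1)
  have hT : HasFDerivAt T ((ContinuousLinearMap.fst ℝ (Vec n) (Cov n)).prod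
      (ContinuousLinearMap.snd ℝ (Vec n) (Cov n) +
        γ'.comp (ContinuousLinearMap.fst ℝ (Vec n) (Cov n)))) (y, ξ) := by
    have h1 : HasFDerivAt (localComponents x₀ α) γ' ((y, ξ) : Vec n × Cov n).1 :=
      (hγ.differentiableAt (by simp)).hasFDerivAt
    exact hasFDerivAt_fst.prodMk (hasFDerivAt_snd.add (h1.comp (y, ξ) hasFDerivAt_fst))
  have hTp : T (y, ξ) = (y, ζ) := by simp [T, hγy]
  have heq : A.orbitMap x₀ σ =ᶠ[𝓝 (y, ξ)] A.orbitMap x₀ σ ∘ T := by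
    have hy : y ∈ chartImage (n := n) x₀ (U ∩ W) := ⟨hp.1, hp.2, hxW⟩
    filter_upwards [((isOpen_chartImage x₀ (hσ.isOpen.inter hW)).preimage
      continuous_fst).mem_nhds (show (y, ξ) ∈ Prod.fst ⁻¹' chartImage x₀ (U ∩ W) from hy)]
      with r hr
    refine (orbitMap_eq_iff (A := A) hσ (ξ := r.2) (ζ := r.2 + localComponents x₀ α r.1)
      ⟨hr.1, hr.2.1⟩).2 ?_
    rw [add_sub_cancel_left, localComponents, cov_components (hσ.subset hr.2.1)]
    exact hαP _ hr.2.2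
  have hder : ∀ u : Vec n × Cov n,
      (mfderiv 𝓘(ℝ, Vec n × Cov n) (𝓡 (2 * n)) (A.orbitMap x₀ σ) (y, ξ) u : Vec (2 * n)) =
      mfderiv 𝓘(ℝ, Vec n × Cov n) (𝓡 (2 * n)) (A.orbitMap x₀ σ) (y, ζ)
        ((u.1, u.2 + γ' u.1) : Vec n × Cov n) := by
    intro u
    have h1 := mfderiv_comp (y, ξ)
      (by rw [hTp]; exact (contMDiffAt_orbitMap (A := A) (p := (y, ζ)) hσ hq).mdifferentiableAt
            (by simp) :
        MDifferentiableAt 𝓘(ℝ, Vec n × Cov n) (𝓡 (2 * n)) (A.orbitMap x₀ σ) (T (y, ξ)))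
      hT.differentiableAt.mdifferentiableAt
    rw [← heq.mfderiv_eq, mfderiv_eq_fderiv, hT.fderiv, hTp] at h1
    exact DFunLike.congr_fun h1 u
  have hinj := injective_mfderiv_orbitMap (A := A) (p := (y, ζ)) hP.isLattice.hasNoLines hσ hq
  have hv' : v' = (v.1, v.2 + γ' v.1) := hinj (hv.symm.trans (hder v))
  have hw' : w' = (w.1, w.2 + γ' w.1) := hinj (hw.symm.trans (hder w))
  rw [hv', hw', canonicalForm_apply, canonicalForm_apply]
  simp only [add_apply]
  rw [hsymm w.1 v.1]
  ring

/-- Over the domain of a section of the total space there is a 2-form which is the canonical one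
in the coordinates given by the action. -/
theorem exists_pull_orbitMap_eq_canonicalForm (hP : IsClosedLattice k P)
    (hσ : IsSectionOver (n := n) pr x₀ U σ) :
    ∃ η : Form (2 * n) M 2, ∀ p : Vec n × Cov n, p.1 ∈ chartImage x₀ U →
      η.pull (A.orbitMap x₀ σ) p = canonicalForm n := by
  have key : ∀ z : M, ∃ Ω : (Vec (2 * n)) [⋀^Fin 2]→L[ℝ] ℝ, ∀ p : Vec n × Cov n,
      p.1 ∈ chartImage x₀ U → A.orbitMap x₀ σ p = z → ∀ v w : Vec n × Cov n,
        Ω ![mfderiv 𝓘(ℝ, Vec n × Cov n) (𝓡 (2 * n)) (A.orbitMap x₀ σ) p v,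
          mfderiv 𝓘(ℝ, Vec n × Cov n) (𝓡 (2 * n)) (A.orbitMap x₀ σ) p w] =
        canonicalForm n ![v, w] := by
    intro z
    by_cases hz : ∃ q : Vec n × Cov n, q.1 ∈ chartImage x₀ U ∧ A.orbitMap x₀ σ q = z
    · obtain ⟨q, hq, hqz⟩ := hz
      let D : (Vec n × Cov n) →ₗ[ℝ] Vec (2 * n) :=
        (mfderiv 𝓘(ℝ, Vec n × Cov n) (𝓡 (2 * n)) (A.orbitMap x₀ σ) q).toLinearMap
      let e : (Vec n × Cov n) ≃ₗ[ℝ] Vec (2 * n) := LinearEquiv.ofBijective D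
        (bijective_mfderiv_orbitMap (A := A) hP.isLattice.hasNoLines hσ hq)
      have he : ∀ u : Vec (2 * n), (mfderiv 𝓘(ℝ, Vec n × Cov n) (𝓡 (2 * n)) (A.orbitMap x₀ σ) q
          (e.symm u) : Vec (2 * n)) = u := fun u => e.apply_symm_apply u
      refine ⟨(canonicalForm n).compContinuousLinearMap
        (LinearMap.toContinuousLinearMap e.symm.toLinearMap), fun p hp hpz v w => ?_⟩
      rw [ContinuousAlternatingMap.compContinuousLinearMap_apply]
      refine Eq.trans ?_ (canonicalForm_eq_of_orbitMap_eq (A := A) hP hσ hp hq (hpz.trans hqz.symm)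
        (he _).symm (he _).symm).symm
      congr 1
      funext i
      fin_cases i <;> rfl
    -- outside of the part over `U` the value does not matter
    · exact ⟨0, fun p hp hpz => (hz ⟨p, hp, hpz⟩).elim⟩
  choose η hη using key
  refine ⟨fun z => η z, fun p hp => two_ext fun v w => ?_⟩
  rw [← hη _ p hp rfl v w]
  refine congrArg (η (A.orbitMap x₀ σ p)) ?_
  funext i
  fin_cases i <;> rfl

theorem smoothAt_of_pull_orbitMap (hP : HasNoLines P) (hσ : IsSectionOver (n := n) pr x₀ U σ)
    {p : Vec n × Cov n} (hp : p.1 ∈ chartImage x₀ U) {l : ℕ} {θ : Form (2 * n) M l}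
    (h : ContDiffAt ℝ ∞ (θ.pull (A.orbitMap x₀ σ)) p) : θ.SmoothAt (A.orbitMap x₀ σ p) := by
  obtain ⟨χ, hpt, -, hχ, hs, hs'⟩ := exists_orbitChart (A := A) hP hσ hp
  rw [← hχ hpt]
  have hsrc := χ.map_target hpt
  refine Form.smoothAt_of_pull (g := χ.symm) (h := χ)
    (hs.contMDiffAt (χ.open_source.mem_nhds hsrc)) ?_ ?_ ?_
  · rw [χ.right_inv hpt]
    exact hs'.contMDiffAt (χ.open_target.mem_nhds hpt)
  · filter_upwards [χ.open_source.mem_nhds hsrc] with z hz using χ.left_inv hz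
  · rw [χ.right_inv hpt]
    exact h.congr_of_eventuallyEq
      (Form.pull_congr θ (hχ.eventuallyEq_of_mem (χ.open_target.mem_nhds hpt)))

/-- Over small open sets of the base, the action is generated by a closed 2-form. -/
theorem exists_isGeneratedBy (A : AffineFibration pr P) (hP : IsClosedLattice k P)
    (hσ : IsSectionOver (n := n) pr x₀ U σ) :
    ∃ η : Form (2 * n) M 2, A.IsGeneratedBy η U ∧ (∀ z, pr z ∈ U → η.SmoothAt z) ∧
      η.d.IsHorizontal pr U := by
  obtain ⟨η, hη⟩ := exists_pull_orbitMap_eq_canonicalForm (A := A) hP hσ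
  have hL := hP.isLattice.hasNoLines
  have hev : ∀ p : Vec n × Cov n, p.1 ∈ chartImage x₀ U →
      η.pull (A.orbitMap x₀ σ) =ᶠ[𝓝 p] fun _ => canonicalForm n := fun p hp => by
    filter_upwards [((isOpen_chartImage x₀ hσ.isOpen).preimage continuous_fst).mem_nhds hp]
      with q hq using hη q hq
  have hsm : ∀ p : Vec n × Cov n, p.1 ∈ chartImage x₀ U → η.SmoothAt (A.orbitMap x₀ σ p) :=
    fun p hp => smoothAt_of_pull_orbitMap hL hσ hp
      (contDiffAt_const.congr_of_eventuallyEq (hev p hp))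
  have hz : ∀ z, pr z ∈ U → ∃ p : Vec n × Cov n, p.1 ∈ chartImage x₀ U ∧
      A.orbitMap x₀ σ p = z := fun z hz => by
    obtain ⟨ξ, hξ⟩ := exists_orbitMap_eq (A := A) hσ hz
    exact ⟨(extChartAt (𝓡 n) x₀ (pr z), ξ), extChartAt_mem_chartImage hσ.subset hz, hξ⟩
  refine ⟨η, isGeneratedBy_of_pull_vertical hL hσ fun p hp a v => ?_, fun z hzU => ?_,
    fun z hzU v _ => ?_⟩
  · rw [hη p hp, canonicalForm_apply]
    simp
  · obtain ⟨p, hp, rfl⟩ := hz z hzU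
    exact hsm p hp
  · obtain ⟨p, hp, rfl⟩ := hz z hzU
    have h1 := extDeriv_pull (hsm p hp) (contMDiffAt_orbitMap (A := A) hσ hp)
    rw [(hev p hp).extDeriv_eq] at h1
    have h2 : extDeriv (fun _ : Vec n × Cov n => canonicalForm n) p = 0 := by
      rw [extDeriv, fderiv_fun_const]
      exact map_zero (ContinuousAlternatingMap.alternatizeUncurryFinCLM ℝ (Vec n × Cov n) ℝ)
    have h3 : ∀ i, ∃ w : Vec n × Cov n, mfderiv 𝓘(ℝ, Vec n × Cov n) (𝓡 (2 * n))
        (A.orbitMap x₀ σ) p w = v i := fun i =>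
      (bijective_mfderiv_orbitMap (A := A) hL hσ hp).2 (v i)
    choose w hw using h3
    rw [← funext hw]
    exact (Form.pull_apply _ _ _ _).symm.trans (DFunLike.congr_fun (h1.symm.trans h2) w)

end AffineFibration

end LocalForm

/-! ### Realization of affine fibrations -/

section Realization

universe uM uB
variable {n : ℕ} {B : Type uB} [TopologicalSpace B] [ChartedSpace (EuclideanSpace ℝ (Fin n)) B]
  {M : Type uM} [TopologicalSpace M] [ChartedSpace (EuclideanSpace ℝ (Fin (2 * n))) M]
  {pr : M → B} {P : ∀ x : B, AddSubgroup (CotangentSpace n x)} {η : Form (2 * n) M 2}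
  [IsManifold (𝓡 n) ∞ B]

section Gluing

variable {ι : Type*}

/-- Forms on the total space are glued with a partition of unity `ρ` on the base. Of the form
`η i` only the part over the support of `ρ i` matters. -/
def glue (pr : M → B) (ρ : SmoothPartitionOfUnity ι (𝓡 n) B univ)
    (η : ι → Form (2 * n) M 2) : Form (2 * n) M 2 := fun z =>
  ∑ i ∈ ρ.finsupport (pr z), ρ i (pr z) • η i z

omit [IsManifold (𝓡 n) ∞ B] in
theorem pull_glue_apply {V : Type*} [NormedAddCommGroup V] [NormedSpace ℝ V] (pr : M → B)
    (ρ : SmoothPartitionOfUnity ι (𝓡 n) B univ) (η : ι → Form (2 * n) M 2) (g : V → M) {p : V}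
    {S : Finset ι} (hS : ρ.finsupport (pr (g p)) ⊆ S) (v : Fin 2 → V) :
    (glue pr ρ η).pull g p v = ∑ i ∈ S, ρ i (pr (g p)) * (η i).pull g p v := by
  let ev : ((Vec (2 * n)) [⋀^Fin 2]→L[ℝ] ℝ) →+ ℝ :=
    { toFun := fun Ω => Ω fun i => mfderiv 𝓘(ℝ, V) (𝓡 (2 * n)) g p (v i)
      map_zero' := rfl
      map_add' := fun _ _ => rfl }
  refine Eq.trans (map_sum ev _ _) (Finset.sum_subset hS fun i _ hi => ?_)
  rw [ρ.mem_finsupport, mem_support, not_not] at hi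
  rw [hi, zero_smul]
  rfl

omit [IsManifold (𝓡 n) ∞ B] in
theorem isSmooth_glue [IsManifold (𝓡 (2 * n)) ∞ M] (hpr : ContMDiff (𝓡 (2 * n)) (𝓡 n) ∞ pr)
    {U : ι → Set B} {ρ : SmoothPartitionOfUnity ι (𝓡 n) B univ} (hρ : ρ.IsSubordinate U)
    {η : ι → Form (2 * n) M 2} (hη : ∀ i z, pr z ∈ U i → (η i).SmoothAt z) :
    (glue pr ρ η).IsSmooth := by
  refine Form.isSmooth_iff.2 fun z => contDiffAt_alternating_of_apply fun v => ?_
  have hc := contMDiffAt_extChartAt_symm_of_mem (mem_extChartAt_target (I := 𝓡 (2 * n)) z)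
  have hg : ContMDiffAt 𝓘(ℝ, Vec (2 * n)) (𝓡 n) ∞ (pr ∘ (extChartAt (𝓡 (2 * n)) z).symm)
      (extChartAt (𝓡 (2 * n)) z z) := hpr.contMDiffAt.comp _ hc
  have hz : (pr ∘ (extChartAt (𝓡 (2 * n)) z).symm) (extChartAt (𝓡 (2 * n)) z z) = pr z :=
    congrArg pr (extChartAt_to_inv z)
  have h1 : ContDiffAt ℝ ∞ (fun y => ∑ i ∈ ρ.fintsupport (pr z),
      ρ i (pr ((extChartAt (𝓡 (2 * n)) z).symm y)) * (η i).inChart z y v)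
      (extChartAt (𝓡 (2 * n)) z z) := by
    refine ContDiffAt.sum fun i hi => ContDiffAt.mul ?_ ?_
    · exact ((ρ i).contMDiff.contMDiffAt.comp _ hg).contDiffAt
    · exact contDiffAt_alternating_apply (g := fun j _ => v j)
        (hη i z (hρ i ((ρ.mem_fintsupport_iff _ i).1 hi))) fun j => contDiffAt_const
  refine ContDiffAt.congr_of_eventuallyEq h1 ?_
  have hcont := hg.continuousAt
  rw [ContinuousAt, hz] at hcont
  filter_upwards [hcont.eventually (ρ.eventually_finsupport_subset (pr z))] with y hy
  exact pull_glue_apply pr ρ η _ hy v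

end Gluing

namespace AffineFibration

variable {A : AffineFibration pr P} {k : ℕ}

theorem isInducedBy_of_isGeneratedBy (hA : A.IsGeneratedBy η univ) : A.IsInducedBy η := by
  intro x α z
  refine ⟨_, hA x (mem_univ x) α z, ?_, ?_⟩
  · rw [zero_smul, A.act_zero]
  · rw [one_smul]
    rfl

variable [IsManifold (𝓡 (2 * n)) ∞ M]

/-- A smooth 2-form generating the action is the 2-form of an almost Lagrangian fibration if it has
the normal form in the coordinates given by the action. -/
theorem isAlmostLagrangianFibration (hP : HasNoLines P) (hs : η.IsSmooth)
    (hA : A.IsGeneratedBy η univ)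
    (h : ∀ (x₀ : B) (U : Set B) (σ : B → M), IsSectionOver (n := n) pr x₀ U σ →
      ∀ y ∈ chartImage x₀ U, ∀ (ξ : Cov n) (v w : Vec n × Cov n),
        η.pull (A.orbitMap x₀ σ) (y, ξ) ![v, w] =
          v.2 w.1 - w.2 v.1 + η.pull (A.orbitMap x₀ σ) (y, 0) ![(v.1, 0), (w.1, 0)]) :
    IsAlmostLagrangianFibration pr η := by
  have hcoord : ∀ z : M, ∃ (U : Set B) (σ : B → M) (p : Vec n × Cov n),
      IsSectionOver (n := n) pr (pr z) U σ ∧ p.1 ∈ chartImage (pr z) U ∧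
        A.orbitMap (pr z) σ p = z := by
    intro z
    obtain ⟨U, σ, hσ, hU⟩ := A.fibration.exists_isSectionOver_mem (pr z)
    obtain ⟨ξ, hξ⟩ := exists_orbitMap_eq (A := A) hσ hU
    exact ⟨U, σ, _, hσ, extChartAt_mem_chartImage hσ.subset hU, hξ⟩
  have hvert : ∀ {x₀ : B} {U : Set B} {σ : B → M}, IsSectionOver (n := n) pr x₀ U σ →
      ∀ {p : Vec n × Cov n}, p.1 ∈ chartImage x₀ U → ∀ (a : Cov n) (v : Vec n × Cov n),
        η.pull (A.orbitMap x₀ σ) p ![(0, a), v] = a v.1 := fun hσ _ hp =>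
    pull_orbitMap_vertical hσ (fun x _ => hA x (mem_univ x)) hp
  have hpair : ∀ (x₀ : B) (σ : B → M) (p v w : Vec n × Cov n),
      η (A.orbitMap x₀ σ p) ![mfderiv 𝓘(ℝ, Vec n × Cov n) (𝓡 (2 * n)) (A.orbitMap x₀ σ) p v,
        mfderiv 𝓘(ℝ, Vec n × Cov n) (𝓡 (2 * n)) (A.orbitMap x₀ σ) p w] =
      η.pull (A.orbitMap x₀ σ) p ![v, w] := by
    intro x₀ σ p v w
    refine congrArg (η (A.orbitMap x₀ σ p)) (funext fun i => ?_)
    fin_cases i <;> rfl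
  refine ⟨⟨A.fibration, fun x => ?_, hs, fun z v hv => ?_, fun z v w hv hw => ?_⟩,
    fun x α z hz => ?_, ?_⟩
  -- each fibre is an image of the space of covectors
  · obtain ⟨U, σ, hσ, hxU⟩ := A.fibration.exists_isSectionOver_mem x
    have hy := extChartAt_mem_chartImage (n := n) hσ.subset hxU
    have hfib : pr ⁻¹' {x} =
        (fun ξ : Cov n => A.orbitMap x σ (extChartAt (𝓡 n) x x, ξ)) '' univ := by
      ext z
      constructor
      · intro hz
        have hz' : pr z = x := hz
        obtain ⟨ξ, hξ⟩ := exists_orbitMap_eq (A := A) hσ (hz'.symm ▸ hxU)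
        exact ⟨ξ, mem_univ _, hz' ▸ hξ⟩
      · rintro ⟨ξ, -, rfl⟩
        exact (pr_orbitMap (A := A) hσ (p := (extChartAt (𝓡 n) x x, ξ)) hy).trans
          (extChartAt_to_inv x)
    rw [hfib]
    refine isConnected_univ.image _ (Continuous.continuousOn ?_)
    refine continuous_iff_continuousAt.2 fun ξ => ?_
    exact ContinuousAt.comp (f := fun ξ : Cov n => (extChartAt (𝓡 n) x x, ξ))
      (contMDiffAt_orbitMap (A := A) (p := (extChartAt (𝓡 n) x x, ξ)) hσ hy).continuousAt
      (by fun_prop)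
  · obtain ⟨U, σ, p, hσ, hp, hpz⟩ := hcoord z
    generalize pr z = x₀ at hσ hp hpz
    subst hpz
    obtain ⟨⟨u, b⟩, rfl⟩ := (bijective_mfderiv_orbitMap (A := A) hP hσ hp).2 v
    have hv' : ∀ w : Vec n × Cov n, η.pull (A.orbitMap x₀ σ) p ![(u, b), w] = 0 := fun w =>
      (hpair x₀ σ p (u, b) w).symm.trans (hv _)
    have hu : u = 0 := by
      refine SeparatingDual.eq_zero_of_forall_dual_eq_zero (R := ℝ) fun a => ?_
      have h1 := hv' (0, a)
      rwa [two_swap, hvert hσ hp, neg_eq_zero] at h1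
    subst hu
    have hb : b = 0 := by
      ext w
      exact (hvert hσ hp b (w, 0)).symm.trans (hv' (w, 0))
    subst hb
    exact map_zero (mfderiv 𝓘(ℝ, Vec n × Cov n) (𝓡 (2 * n)) (A.orbitMap x₀ σ) p)
  · obtain ⟨U, σ, p, hσ, hp, hpz⟩ := hcoord z
    generalize pr z = x₀ at hσ hp hpz
    subst hpz
    obtain ⟨⟨u, b⟩, rfl⟩ := (bijective_mfderiv_orbitMap (A := A) hP hσ hp).2 v
    obtain ⟨⟨u', b'⟩, rfl⟩ := (bijective_mfderiv_orbitMap (A := A) hP hσ hp).2 w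
    have hmem := pr_orbitMap_mem (A := A) hσ hp
    obtain rfl : u = 0 :=
      (baseDeriv_orbitMap (A := A) hσ hp (u, b)).symm.trans ((baseDeriv_eq_zero_iff hmem).2 hv)
    obtain rfl : u' = 0 :=
      (baseDeriv_orbitMap (A := A) hσ hp (u', b')).symm.trans ((baseDeriv_eq_zero_iff hmem).2 hw)
    refine (hpair x₀ σ p (0, b) (0, b')).trans ((hvert hσ hp b (0, b')).trans ?_)
    exact map_zero b
  · refine ⟨_, ?_, hA x (mem_univ x) α ⟨z, hz⟩⟩
    rw [zero_smul, A.act_zero]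
  · refine exists_eq_pullback (A := A) hP hs.d fun x => ?_
    obtain ⟨U, σ, hσ, hxU⟩ := A.fibration.exists_isSectionOver_mem x
    refine ⟨x, U, σ, hxU, hσ, fun y hy ξ v => ?_⟩
    have hsm : ∀ ξ : Cov n, ContDiffAt ℝ ∞ (η.pull (A.orbitMap x σ)) (y, ξ) := fun ξ =>
      (Form.isSmooth_iff.1 hs _).pull (contMDiffAt_orbitMap (A := A) (p := (y, ξ)) hσ hy)
    -- the part of the normal form coming from the base
    let β : Vec n → (Vec n) [⋀^Fin 2]→L[ℝ] ℝ := fun y =>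
      (η.pull (A.orbitMap x σ) (y, 0)).compContinuousLinearMap
        (ContinuousLinearMap.inl ℝ (Vec n) (Cov n))
    have hβ : ContDiffAt ℝ ∞ β y := by
      refine contDiffAt_compContinuousLinearMap ?_ contDiffAt_const
      exact ContDiffAt.comp (f := fun y : Vec n => (y, (0 : Cov n))) y (hsm 0)
        (contDiffAt_id.prodMk contDiffAt_const)
    have hd : ∀ ξ : Cov n, η.d.pull (A.orbitMap x σ) (y, ξ) =
        (extDeriv β y).compContinuousLinearMap (ContinuousLinearMap.fst ℝ (Vec n) (Cov n)) := by
      intro ξ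
      have hev : η.pull (A.orbitMap x σ) =ᶠ[𝓝 (y, ξ)] fun q => canonicalForm n +
          (β q.1).compContinuousLinearMap (fderiv ℝ (Prod.fst : Vec n × Cov n → Vec n) q) := by
        filter_upwards [((isOpen_chartImage x hσ.isOpen).preimage continuous_fst).mem_nhds
          (show (y, ξ) ∈ Prod.fst ⁻¹' chartImage x U from hy)] with q hq
        refine two_ext fun v w => (h x U σ hσ q.1 hq q.2 v w).trans ?_
        rw [fderiv_fst]
        refine congrArg₂ (· + ·) (canonicalForm_apply v w).symm ?_
        refine congrArg (η.pull (A.orbitMap x σ) (q.1, 0)) (funext fun i => ?_)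
        fin_cases i <;> rfl
      have hdiff : DifferentiableAt ℝ (fun q : Vec n × Cov n => (β q.1).compContinuousLinearMap
          (fderiv ℝ (Prod.fst : Vec n × Cov n → Vec n) q)) (y, ξ) := by
        simp only [fderiv_fst]
        refine (contDiffAt_compContinuousLinearMap (r := ∞) ?_ contDiffAt_const).differentiableAt
          (by simp)
        exact ContDiffAt.comp (g := β) (f := Prod.fst) (y, ξ) hβ contDiffAt_fst
      have hconst : extDeriv (fun _ : Vec n × Cov n => canonicalForm n) (y, ξ) = 0 := by
        rw [extDeriv, fderiv_fun_const]
        exact map_zero (ContinuousAlternatingMap.alternatizeUncurryFinCLM ℝ (Vec n × Cov n) ℝ)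
      rw [← extDeriv_pull (Form.isSmooth_iff.1 hs _)
        (contMDiffAt_orbitMap (A := A) (p := (y, ξ)) hσ hy), hev.extDeriv_eq,
        extDeriv_fun_add (differentiableAt_const _) hdiff, hconst, zero_add,
        extDeriv_pullback (f := (Prod.fst : Vec n × Cov n → Vec n)) (r := ∞)
          (hβ.differentiableAt (by simp)) contDiffAt_fst
          (by simpa using (WithTop.coe_le_coe.2 le_top : ((2 : ℕ∞) : WithTop ℕ∞) ≤ ∞)),
        fderiv_fst]
    rw [hd, hd]
    rfl

/-- Every affine fibration whose lattice is closed is realized by an almost Lagrangian fibration.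
The canonical forms over small open sets are glued with a partition of unity on the base: the
contractions with the vectors tangent to the fibres, which determine the action, are the same for
all of them. The exterior derivative of the result is not zero in general, but it comes from the
base. -/
theorem exists_isAlmostLagrangianFibration [T2Space B] [SecondCountableTopology B]
    (A : AffineFibration pr P) (hP : IsClosedLattice k P) :
    ∃ η : Form (2 * n) M 2, IsAlmostLagrangianFibration pr η ∧ A.IsInducedBy η := by
  have hL := hP.isLattice.hasNoLines
  choose U σ hσ hU using A.fibration.exists_isSectionOver_mem
  choose θ hθA hθs hθd using fun x => A.exists_isGeneratedBy hP (hσ x)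
  have : LocallyCompactSpace B := Manifold.locallyCompact_of_finiteDimensional (𝓡 n)
  obtain ⟨ρ, hρ⟩ := SmoothPartitionOfUnity.exists_isSubordinate (𝓡 n) isClosed_univ U
    (fun x => (hσ x).isOpen) fun x _ => mem_iUnion.2 ⟨x, hU x⟩
  have hmem : ∀ {i : B} {x : B}, i ∈ ρ.finsupport x → x ∈ U i := fun {i x} hi =>
    hρ i (subset_tsupport _ ((ρ.mem_finsupport x).1 hi))
  have hsum : ∀ x, ∑ i ∈ ρ.finsupport x, ρ i x = 1 := fun x => ρ.sum_finsupport x (mem_univ x)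
  have hs : (glue pr ρ θ).IsSmooth := isSmooth_glue A.fibration.1 hρ hθs
  have hres : ∀ {x₀ : B} {V : Set B} {τ : B → M}, IsSectionOver (n := n) pr x₀ V τ → ∀ i,
      IsSectionOver (n := n) pr x₀ (V ∩ U i) τ := fun hτ i =>
    ⟨hτ.isOpen.inter (hσ i).isOpen, fun x hx => hτ.subset hx.1, hτ.smooth.mono inter_subset_left,
      fun x hx => hτ.pr_eq x hx.1⟩
  have hy : ∀ {x₀ : B} {V : Set B} {τ : B → M}, IsSectionOver (n := n) pr x₀ V τ →
      ∀ {p : Vec n × Cov n}, p.1 ∈ chartImage x₀ V →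
        ∀ i ∈ ρ.finsupport (pr (A.orbitMap x₀ τ p)), p.1 ∈ chartImage x₀ (V ∩ U i) :=
    fun hτ p hp i hi => by
      have h1 := hmem hi
      rw [pr_orbitMap (A := A) hτ hp] at h1
      exact ⟨hp.1, hp.2, h1⟩
  have hA : A.IsGeneratedBy (glue pr ρ θ) univ := by
    intro x _
    refine isGeneratedBy_of_pull_vertical hL (hσ x) (fun p hp a v => ?_) x (hU x)
    rw [pull_glue_apply pr ρ θ _ subset_rfl]
    have h1 : ∀ i ∈ ρ.finsupport (pr (A.orbitMap x (σ x) p)),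
        ρ i (pr (A.orbitMap x (σ x) p)) * (θ i).pull (A.orbitMap x (σ x)) p ![(0, a), v] =
        ρ i (pr (A.orbitMap x (σ x) p)) * a v.1 := fun i hi => by
      rw [pull_orbitMap_vertical (hres (hσ x) i) (fun x hx => hθA i x hx.2) (hy (hσ x) hp i hi)]
    rw [Finset.sum_congr rfl h1, ← Finset.sum_mul, hsum, one_mul]
  refine ⟨glue pr ρ θ, isAlmostLagrangianFibration hL hs hA ?_, isInducedBy_of_isGeneratedBy hA⟩
  intro x₀ V τ hτ y hyV ξ v w
  have hpr : pr (A.orbitMap x₀ τ (y, 0)) = pr (A.orbitMap x₀ τ (y, ξ)) :=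
    (pr_orbitMap (A := A) (p := (y, 0)) hτ hyV).trans
      (pr_orbitMap (A := A) (p := (y, ξ)) hτ hyV).symm
  rw [pull_glue_apply pr ρ θ _ subset_rfl, pull_glue_apply pr ρ θ _ (p := (y, 0)) subset_rfl, hpr]
  have h1 : ∀ i ∈ ρ.finsupport (pr (A.orbitMap x₀ τ (y, ξ))),
      ρ i (pr (A.orbitMap x₀ τ (y, ξ))) * (θ i).pull (A.orbitMap x₀ τ) (y, ξ) ![v, w] =
      ρ i (pr (A.orbitMap x₀ τ (y, ξ))) * (v.2 w.1 - w.2 v.1) +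
        ρ i (pr (A.orbitMap x₀ τ (y, ξ))) *
          (θ i).pull (A.orbitMap x₀ τ) (y, 0) ![(v.1, 0), (w.1, 0)] := fun i hi => by
    rw [pull_orbitMap_eq (hres hτ i) (fun x hx => hθA i x hx.2) (fun z hz => hθs i z hz.2)
      (fun z hz => hθd i z hz.2) (hy hτ (p := (y, ξ)) hyV i hi), mul_add]
  rw [Finset.sum_congr rfl h1, Finset.sum_add_distrib, ← Finset.sum_mul, hsum, one_mul]

end AffineFibration

end Realization

end LagFib

end

theorem theorem6 (n : ℕ) {B : Type*} [TopologicalSpace B] [T2Space B] [SecondCountableTopology B]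
    [ChartedSpace (EuclideanSpace ℝ (Fin n)) B] [IsManifold (𝓡 n) ∞ B] :
    -- every almost Lagrangian fibration is an affine fibration via `α ↦ s_α`
    (∀ (M : Type*) [TopologicalSpace M] [T2Space M] [SecondCountableTopology M]
        [ChartedSpace (EuclideanSpace ℝ (Fin (2 * n))) M] [IsManifold (𝓡 (2 * n)) ∞ M]
        (pr : M → B) (η : LagFib.Form (2 * n) M 2),
      LagFib.IsAlmostLagrangianFibration pr η →
        ∃ (k : ℕ) (P : ∀ x : B, AddSubgroup (LagFib.CotangentSpace n x)),
          LagFib.IsClosedLattice k P ∧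
          ∃ A : LagFib.AffineFibration pr P, A.IsInducedBy η) ∧
    -- every affine fibration with underlying fibration `T*B/P` is realized
    (∀ (k : ℕ) (P : ∀ x : B, AddSubgroup (LagFib.CotangentSpace n x)),
      LagFib.IsClosedLattice k P →
      ∀ (E : Type*) [TopologicalSpace E] [T2Space E] [SecondCountableTopology E]
        [ChartedSpace (EuclideanSpace ℝ (Fin (2 * n))) E] [IsManifold (𝓡 (2 * n)) ∞ E]
        (pr : E → B) (A : LagFib.AffineFibration pr P),
        ∃ η : LagFib.Form (2 * n) E 2,
          LagFib.IsAlmostLagrangianFibration pr η ∧ A.IsInducedBy η) ∧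
    -- Lagrangian equivalence up to a twisting is equivalence of the affine fibrations
    (∀ (M₁ : Type*) [TopologicalSpace M₁] [T2Space M₁] [SecondCountableTopology M₁]
        [ChartedSpace (EuclideanSpace ℝ (Fin (2 * n))) M₁] [IsManifold (𝓡 (2 * n)) ∞ M₁]
        (M₂ : Type*) [TopologicalSpace M₂] [T2Space M₂] [SecondCountableTopology M₂]
        [ChartedSpace (EuclideanSpace ℝ (Fin (2 * n))) M₂] [IsManifold (𝓡 (2 * n)) ∞ M₂]
        (pr₁ : M₁ → B) (η₁ : LagFib.Form (2 * n) M₁ 2)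
        (pr₂ : M₂ → B) (η₂ : LagFib.Form (2 * n) M₂ 2),
      LagFib.IsAlmostLagrangianFibration pr₁ η₁ →
      LagFib.IsAlmostLagrangianFibration pr₂ η₂ →
      ∀ (P₁ P₂ : ∀ x : B, AddSubgroup (LagFib.CotangentSpace n x))
        (A₁ : LagFib.AffineFibration pr₁ P₁) (A₂ : LagFib.AffineFibration pr₂ P₂),
        A₁.IsInducedBy η₁ → A₂.IsInducedBy η₂ →
        (LagFib.LagrangianEquivalentUpToTwisting pr₁ η₁ pr₂ η₂ ↔ A₁.Equivalent A₂)) := by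
  refine ⟨fun M _ _ _ _ _ pr η h => h.exists_affineFibration, fun k P hP E _ _ _ _ _ pr A =>
    A.exists_isAlmostLagrangianFibration hP, fun M₁ _ _ _ _ _ M₂ _ _ _ _ _ pr₁ η₁ pr₂ η₂ h₁ h₂
    P₁ P₂ A₁ A₂ hA₁ hA₂ => ⟨fun h => ?_, fun h => ?_⟩⟩
  · exact LagFib.AffineFibration.equivalent_of_lagrangianEquivalent h₁ h₂ hA₁ hA₂ h
  · exact h.lagrangianEquivalent h₁ h₂ hA₁ hA₂
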